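/- Let $G=(V,E)$ be a finite simple undirected graph with $n=|V|$ vertices and $m=|E|$ edges. A set $S\subseteq V$ is a 2-club if any two vertices of $S$ have distance at most two in the induced subgraph $G[S]$. For an integer $t\ge 0$, a set $S\subseteq V$ is - a $t$-robust 2-club if any two distinct vertices of $S$ are joined in $G[S]$ by $t$ distinct, pairwise internally vertex-disjoint paths of length at most two; - a $t$-hereditary 2-club if $S\setminus U$ is a 2-club for every $U\subset S$ with $|U|\le t$; - a $t$-connected 2-club if $S$ is a 2-club, $|S|>t$, and $G[S\setminus U]$ is connected for every $U\subseteq S$ with $|U|<t$. (Sets with at most one vertex satisfy the first two conditions vacuously.) In the problems $t$-Robust, $t$-Hereditary and $t$-Connected 2-Club, the input consists of $G$ and integers $t,k\ge 0$, and the question is whether $G$ contains a $t$-robust, $t$-hereditary or $t$-connected 2-club, respectively, with at least $k$ vertices. Put $\ell:=\max(n-k,0)$. Theorem. On a word RAM with unit-cost instructions and words of $O(\log(n+m+t+k+2))$ bits, with $G$ given by its number of vertices, its number of edges and a list of its edges, $t$-Hereditary 2-Club and $t$-Robust 2-Club can be solved in $O(2^{\ell}\cdot nm+1)$ time, and $t$-Connected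 2-Club can be solved in $O(2^{\ell}\cdot \max(t,1)^2\,nm+1)$ time. In each case a single algorithm handles all inputs and the hidden constant is absolute. -/

import Mathlib

namespace WellConnectedClub

/-! ### The three models of well-connected 2-clubs -/

section Clubs

variable {V : Type*}

/-- `S` is a 2-club of `G`: the induced subgraph `G[S]` has diameter at most two, i.e. any two
vertices of `S` are at distance at most two in `G[S]` (`edist` is `⊤` for disconnected vertices). -/
def IsTwoClub (G : SimpleGraph V) (S : Set V) : Prop :=
  ∀ u v : S, (G.induce S).edist u v ≤ 2

/-- `S` is a `t`-robust 2-club: any two distinct vertices of `S` are joined in `G[S]` by `t`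
(distinct) pairwise internally vertex-disjoint paths of length at most two. -/
def IsRobustTwoClub (G : SimpleGraph V) (t : ℕ) (S : Finset V) : Prop :=
  ∀ u v : (S : Set V), u ≠ v →
    ∃ P : Fin t → (G.induce (S : Set V)).Path u v,
      Function.Injective P ∧
      (∀ i, (P i : (G.induce (S : Set V)).Walk u v).length ≤ 2) ∧
      ∀ i j, i ≠ j → ∀ w,
        w ∈ (P i : (G.induce (S : Set V)).Walk u v).support →
        w ∈ (P j : (G.induce (S : Set V)).Walk u v).support → w = u ∨ w = v

/-- `S` is a `t`-hereditary 2-club: it stays a 2-club after deleting any at most `t` of its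
vertices. -/
def IsHereditaryTwoClub (G : SimpleGraph V) (t : ℕ) (S : Finset V) : Prop :=
  ∀ U : Finset V, U ⊂ S → U.card ≤ t → IsTwoClub G ((S : Set V) \ (U : Set V))

/-- `S` is a `t`-connected 2-club: it is a 2-club, it has more than `t` vertices, and `G[S]` stays
connected after deleting any fewer than `t` vertices. -/
def IsConnectedTwoClub (G : SimpleGraph V) (t : ℕ) (S : Finset V) : Prop :=
  IsTwoClub G (S : Set V) ∧ t < S.card ∧
    ∀ U : Finset V, U ⊆ S → U.card < t → (G.induce ((S : Set V) \ (U : Set V))).Connected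

/-- The decision problems: does `G` contain a set of size at least `k` of the given kind? -/
def RobustTwoClubProblem (G : SimpleGraph V) (t k : ℕ) : Prop :=
  ∃ S : Finset V, k ≤ S.card ∧ IsRobustTwoClub G t S

def HereditaryTwoClubProblem (G : SimpleGraph V) (t k : ℕ) : Prop :=
  ∃ S : Finset V, k ≤ S.card ∧ IsHereditaryTwoClub G t S

def ConnectedTwoClubProblem (G : SimpleGraph V) (t k : ℕ) : Prop :=
  ∃ S : Finset V, k ≤ S.card ∧ IsConnectedTwoClub G t S

end Clubs

/-! ### The machine model: a word RAM with unit-cost instructions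

A program has access to finitely many registers (those it names) and to a random-access memory.
Control flow is structured (`ite`, `loop`), so a program is in particular a RAM program with
jumps, with the same running time up to a constant factor. -/

/-- Arithmetic instructions; subtraction is truncated at zero. -/
inductive ArithOp
  | add
  | sub
  | mul

def ArithOp.eval : ArithOp → ℕ → ℕ → ℕ
  | .add, a, b => a + b
  | .sub, a, b => a - b
  | .mul, a, b => a * b

/-- RAM programs. Registers are named by natural numbers. -/
inductive Prog
  /-- do nothing -/
  | skip
  /-- `R[x] := c` -/
  | const (x c : ℕ)
  /-- `R[x] := R[y] op R[z]` -/
  | arith (op : ArithOp) (x y z : ℕ)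
  /-- `R[x] := M[R[y]]` -/
  | load (x y : ℕ)
  /-- `M[R[x]] := R[y]` -/
  | store (x y : ℕ)
  /-- first `p`, then `q` -/
  | seq (p q : Prog)
  /-- if `R[x] < R[y]` then `p` else `q` -/
  | ite (x y : ℕ) (p q : Prog)
  /-- while `R[x] < R[y]` do `p` -/
  | loop (x y : ℕ) (p : Prog)

/-- The contents of the registers and of the memory. -/
structure State where
  reg : ℕ → ℕ
  mem : ℕ → ℕ

def State.setReg (s : State) (x a : ℕ) : State :=
  { s with reg := Function.update s.reg x a }

def State.setMem (s : State) (x a : ℕ) : State :=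
  { s with mem := Function.update s.mem x a }

/-- `Exec W p s τ s'`: started in state `s`, the program `p` halts after exactly `τ` steps in state
`s'`, and no number larger than `W` is ever written. Every instruction and every evaluation of a
test costs one step. A program that computes a number larger than `W` gets stuck. -/
inductive Exec (W : ℕ) : Prog → State → ℕ → State → Prop
  | skip (s : State) : Exec W .skip s 1 s
  | const (s : State) (x c : ℕ) (h : c ≤ W) : Exec W (.const x c) s 1 (s.setReg x c)
  | arith (s : State) (op : ArithOp) (x y z : ℕ) (h : op.eval (s.reg y) (s.reg z) ≤ W) :
      Exec W (.arith op x y z) s 1 (s.setReg x (op.eval (s.reg y) (s.reg z)))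
  | load (s : State) (x y : ℕ) : Exec W (.load x y) s 1 (s.setReg x (s.mem (s.reg y)))
  | store (s : State) (x y : ℕ) : Exec W (.store x y) s 1 (s.setMem (s.reg x) (s.reg y))
  | seq {p q : Prog} {s s' s'' : State} {a b : ℕ} (hp : Exec W p s a s') (hq : Exec W q s' b s'') :
      Exec W (.seq p q) s (a + b) s''
  | ite_true {x y : ℕ} {p q : Prog} {s s' : State} {a : ℕ} (h : s.reg x < s.reg y)
      (hp : Exec W p s a s') : Exec W (.ite x y p q) s (a + 1) s'
  | ite_false {x y : ℕ} {p q : Prog} {s s' : State} {a : ℕ} (h : ¬ s.reg x < s.reg y)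
      (hq : Exec W q s a s') : Exec W (.ite x y p q) s (a + 1) s'
  | loop_true {x y : ℕ} {p : Prog} {s s' s'' : State} {a b : ℕ} (h : s.reg x < s.reg y)
      (hp : Exec W p s a s') (hl : Exec W (.loop x y p) s' b s'') :
      Exec W (.loop x y p) s (a + b + 1) s''
  | loop_false {x y : ℕ} {p : Prog} {s : State} (h : ¬ s.reg x < s.reg y) :
      Exec W (.loop x y p) s 1 s

/-- `E` lists every edge of `G` exactly once, in an arbitrary order and orientation. -/
def IsEdgeList {n : ℕ} (G : SimpleGraph (Fin n)) (E : List (Fin n × Fin n)) : Prop :=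
  (E.map fun e => s(e.1, e.2)).Nodup ∧ ∀ e, e ∈ (E.map fun e => s(e.1, e.2)) ↔ e ∈ G.edgeSet

/-- The initial state for a graph with vertices `0, …, n - 1` and edge list `E` and for the numbers
`t` and `k`: registers `0, 1, 2, 3` hold `n, m, t, k`, the memory holds the endpoints of the edges
one after the other, and everything else is zero. -/
def inputState (n : ℕ) (E : List (Fin n × Fin n)) (t k : ℕ) : State where
  reg := fun x => [n, E.length, t, k].getD x 0
  mem := fun a => (E.flatMap fun e => [e.1.val, e.2.val]).getD a 0

/-- The problem `Q` about a graph `G` with `n` vertices and `m` edges and numbers `t` and `k` can be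
solved in time `O(T n m t k)`: one RAM program decides all instances (answer `1` for yes and `0` for
no in register `0`) in at most `C * T n m t k` steps, on words of logarithmic length, i.e. without
ever writing a number larger than `(n + m + t + k + 2) ^ c`, where `C` and `c` are constants. -/
def SolvableInTime (Q : ∀ n : ℕ, SimpleGraph (Fin n) → ℕ → ℕ → Prop)
    (T : ℕ → ℕ → ℕ → ℕ → ℕ) : Prop :=
  ∃ (p : Prog) (C c : ℕ), ∀ (n : ℕ) (G : SimpleGraph (Fin n)) (t k : ℕ)
    (E : List (Fin n × Fin n)), IsEdgeList G E →
      ∃ (τ : ℕ) (s : State),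
        Exec ((n + G.edgeSet.ncard + t + k + 2) ^ c) p (inputState n E t k) τ s ∧
        τ ≤ C * T n G.edgeSet.ncard t k ∧
        (Q n G t k → s.reg 0 = 1) ∧ (¬ Q n G t k → s.reg 0 = 0)

end WellConnectedClub

/-! All three problems reduce to one. For parameters `w`, `θ`, `c`, a pair u, v is bad in S if its
common neighbours in S, plus `w` if u and v are adjacent, number fewer than `θ`, or if fewer than
`c` vertices separate u from v in S. A set is a t-hereditary or t-robust 2-club exactly when it has
no bad pair for (t+1, t+1, 0) or (1, t, 0) (`isHereditaryTwoClub_iff`, `isRobustTwoClub_iff`), and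
it is a t-connected 2-club exactly when it has more than t vertices and no bad pair for (1, 1, t)
(`isConnectedTwoClub_iff`); the size condition is absorbed into k.

Badness is inherited by subsets (`BadPair.anti`): shrinking the set loses common neighbours and
keeps separators. So a club inside F avoids one vertex of each bad pair of F, and branching on which
one (`hasClub_iff_of_badPair`) gives a binary search tree. Every branch deletes a vertex, so the
depth is at most |F| - k and there are fewer than 2^(|F| - k + 1) nodes.

At a node, a sweep over the arcs for each u counts the common neighbours of all pairs, in O(n(n+m))
time. Separations are tested from only `c` sources, since a separator with fewer than `c` vertices
misses one of them (`not_separated_of_sources`). Each of these at most cn tests makes at most `c`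
augmentations in O(n+m) time each. Disjoint paths are stored as a predecessor map (`Linkage`);
counting its fibres shows that `c` paths exclude a separator (`Linkage.not_separated`) and that a
failed search produces one (`Linkage.separated`). A node thus costs O(max(c,1)² n(n+m)), see
`nodeTime_le`.

To replace n+m by m, isolated vertices are discarded first; they lie in no club with at least two
vertices if `θ` ≥ 1. If a ≤ 2m vertices remain, the tree has O(2^(a-k)) nodes, and the saved factor
2^(n-a) ≥ n-a pays for the term n (`nodeTime_mul_le`).

The algorithm is written in a small language with variables and arrays, whose programs compile to
RAM programs with constant overhead (`Cmd.exec_compile`). Its running time is controlled by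
invariants and potentials (`Runs.loop`, `Runs.for_potential`). -/

set_option linter.constructorNameAsVariable false

namespace WellConnectedClub

section

/-! ### A small imperative language with named variables and arrays -/

/-- The variables of the search program; the first four hold the input numbers. -/
inductive Var
  | n | m | t | k
  | w | th | tc | ans | mm | ns | l
  | e | c | a | b | x
  | u | v | sc | bad | bu | bv
  | i | ok | head | tail | fin | y | ptr | z
  | d | run
  deriving DecidableEq

/-- The arrays of the search program. -/
inductive Arr
  | src | tgt | next | first | inS | mark | cnt | p | vis | par | via | q | del | alt
  deriving DecidableEq

/-- The register that holds a variable. -/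
def Var.idx (x : Var) : ℕ := x.ctorIdx

/-- The residue class of memory cells that holds an array. -/
def Arr.idx (a : Arr) : ℕ := a.ctorIdx

theorem Var.idx_lt (x : Var) : x.idx < 40 := by cases x <;> decide

theorem Var.idx_injective : Function.Injective Var.idx := by
  intro x y h
  rw [← Var.ofNat_ctorIdx x, ← Var.ofNat_ctorIdx y]
  exact congrArg Var.ofNat h

theorem Arr.idx_lt (a : Arr) : a.idx < 16 := by cases a <;> decide

theorem Arr.idx_injective : Function.Injective Arr.idx := by
  intro x y h
  rw [← Arr.ofNat_ctorIdx x, ← Arr.ofNat_ctorIdx y]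
  exact congrArg Arr.ofNat h

/-- The contents of the variables and of the arrays, and the read-only input. -/
structure Store where
  var : Var → ℕ
  arr : Arr → ℕ → ℕ
  inp : ℕ → ℕ

def Store.set (s : Store) (x : Var) (a : ℕ) : Store :=
  { s with var := Function.update s.var x a }

def Store.put (s : Store) (b : Arr) (i a : ℕ) : Store :=
  { s with arr := Function.update s.arr b (Function.update (s.arr b) i a) }

@[simp] theorem Store.set_var (s : Store) (x y : Var) (a : ℕ) :
    (s.set x a).var y = if y = x then a else s.var y := by
  simp [Store.set, Function.update_apply]

@[simp] theorem Store.set_arr (s : Store) (x : Var) (a : ℕ) : (s.set x a).arr = s.arr := rfl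

@[simp] theorem Store.set_inp (s : Store) (x : Var) (a : ℕ) : (s.set x a).inp = s.inp := rfl

@[simp] theorem Store.put_var (s : Store) (b : Arr) (i a : ℕ) : (s.put b i a).var = s.var := rfl

@[simp] theorem Store.put_inp (s : Store) (b : Arr) (i a : ℕ) : (s.put b i a).inp = s.inp := rfl

@[simp] theorem Store.put_arr (s : Store) (b b' : Arr) (i a : ℕ) :
    (s.put b i a).arr b' = if b' = b then Function.update (s.arr b) i a else s.arr b' := by
  by_cases h : b' = b
  · subst h; simp [Store.put]
  · simp [Store.put, h]

attribute [simp] ArithOp.eval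

/-- Expressions. -/
inductive Expr
  | lit (c : ℕ)
  | var (x : Var)
  | inp (e : Expr)
  | get (b : Arr) (e : Expr)
  | op (o : ArithOp) (e f : Expr)

namespace Expr

@[simp] def eval (s : Store) : Expr → ℕ
  | lit c => c
  | var x => s.var x
  | inp e => s.inp (e.eval s)
  | get b e => s.arr b (e.eval s)
  | op o e f => o.eval (e.eval s) (f.eval s)

/-- All intermediate results and array indices are at most `B`, and the input, which has length
`M`, is read within its bounds. -/
@[simp] def Ok (M B : ℕ) (s : Store) : Expr → Prop
  | lit c => c ≤ B
  | var _ => True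
  | inp e => e.Ok M B s ∧ e.eval s < M
  | get _ e => e.Ok M B s ∧ e.eval s ≤ B
  | op o e f => e.Ok M B s ∧ f.Ok M B s ∧ o.eval (e.eval s) (f.eval s) ≤ B

instance : Coe Var Expr := ⟨var⟩

instance (c : ℕ) : OfNat Expr c := ⟨lit c⟩

instance : Add Expr := ⟨op .add⟩

instance : Sub Expr := ⟨op .sub⟩

instance : Mul Expr := ⟨op .mul⟩

@[simp] theorem eval_sub (s : Store) (e f : Expr) : (e - f).eval s = e.eval s - f.eval s := rfl

@[simp] theorem ok_sub {M B : ℕ} {s : Store} {e f : Expr} :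
    (e - f).Ok M B s ↔ e.Ok M B s ∧ f.Ok M B s ∧ e.eval s - f.eval s ≤ B := .rfl

/-- The number of machine instructions needed to evaluate an expression. -/
def cost : Expr → ℕ
  | lit _ => 1
  | var _ => 2
  | inp e => e.cost + 1
  | get _ e => e.cost + 6
  | op _ e f => e.cost + f.cost + 1

end Expr

/-- Commands. -/
inductive Cmd
  | skip
  | set (x : Var) (e : Expr)
  | put (b : Arr) (e f : Expr)
  | seq (p q : Cmd)
  | ite (e f : Expr) (p q : Cmd)
  | loop (e f : Expr) (p : Cmd)

infixr:40 " ;; " => Cmd.seq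

infix:50 " ::= " => Cmd.set

/-- Big-step semantics of commands with the number of steps. -/
inductive Cmd.Eval (M B : ℕ) : Cmd → Store → ℕ → Store → Prop
  | skip (s : Store) : Eval M B .skip s 1 s
  | set (s : Store) (x : Var) (e : Expr) (h : e.Ok M B s) :
      Eval M B (.set x e) s 1 (s.set x (e.eval s))
  | put (s : Store) (b : Arr) (e f : Expr) (he : e.Ok M B s) (hf : f.Ok M B s)
      (hB : e.eval s ≤ B) : Eval M B (.put b e f) s 1 (s.put b (e.eval s) (f.eval s))
  | seq {p q : Cmd} {s s' s'' : Store} {a b : ℕ} (hp : Eval M B p s a s')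
      (hq : Eval M B q s' b s'') : Eval M B (.seq p q) s (a + b) s''
  | ite_true {e f : Expr} {p q : Cmd} {s s' : Store} {a : ℕ} (he : e.Ok M B s) (hf : f.Ok M B s)
      (h : e.eval s < f.eval s) (hp : Eval M B p s a s') : Eval M B (.ite e f p q) s (a + 1) s'
  | ite_false {e f : Expr} {p q : Cmd} {s s' : Store} {a : ℕ} (he : e.Ok M B s) (hf : f.Ok M B s)
      (h : ¬ e.eval s < f.eval s) (hq : Eval M B q s a s') :
      Eval M B (.ite e f p q) s (a + 1) s'
  | loop_true {e f : Expr} {p : Cmd} {s s' s'' : Store} {a b : ℕ} (he : e.Ok M B s)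
      (hf : f.Ok M B s) (h : e.eval s < f.eval s) (hp : Eval M B p s a s')
      (hl : Eval M B (.loop e f p) s' b s'') : Eval M B (.loop e f p) s (a + b + 1) s''
  | loop_false {e f : Expr} {p : Cmd} {s : Store} (he : e.Ok M B s) (hf : f.Ok M B s)
      (h : ¬ e.eval s < f.eval s) : Eval M B (.loop e f p) s 1 s

/-! ### Compilation to RAM programs -/

/-- The register that holds the address of the first array cell. -/
def baseReg : ℕ := 40

/-- `Repr M W s r`: the machine state `r` represents the store `s`, whose contents are at most
`W`. -/
structure Repr (M W : ℕ) (s : Store) (r : State) : Prop where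
  var : ∀ x : Var, r.reg x.idx = s.var x
  base : r.reg baseReg = M
  inp : ∀ i < M, r.mem i = s.inp i
  -- The arrays are interleaved behind the `M` input cells. The stride 16 exceeds every `b.idx`, so
  -- distinct cells get distinct addresses and no array needs a length.
  arr : ∀ (b : Arr) (i : ℕ), r.mem (16 * i + b.idx + M) = s.arr b i
  var_le : ∀ x : Var, s.var x ≤ W
  arr_le : ∀ (b : Arr) (i : ℕ), s.arr b i ≤ W
  inp_le : ∀ i < M, s.inp i ≤ W

/-- Replace the number `i` in register `d` by the address of the cell `i` of the array `b`. -/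
def addrProg (b : Arr) (d : ℕ) : Prog :=
  .seq (.const (d + 1) 16) <| .seq (.arith .mul d d (d + 1)) <|
    .seq (.const (d + 1) b.idx) <| .seq (.arith .add d d (d + 1)) (.arith .add d d baseReg)

/-- Evaluate an expression into register `d`, using registers from `d` on only. -/
def Expr.compile : Expr → ℕ → Prog
  | lit c, d => .const d c
  -- The machine has no instruction that copies a register; adding zero does it.
  | var x, d => .seq (.const d 0) (.arith .add d x.idx d)
  | inp e, d => .seq (e.compile d) (.load d d)
  | get b e, d => .seq (e.compile d) (.seq (addrProg b d) (.load d d))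
  -- The value of `e` in register `d` survives because `f` is evaluated in registers from `d + 1`
  -- on.
  | op o e f, d => .seq (e.compile d) (.seq (f.compile (d + 1)) (.arith o d d (d + 1)))

/-- Evaluate two expressions into the registers `41` and `42`. -/
def compilePair (e f : Expr) : Prog := .seq (e.compile 41) (f.compile 42)

def Cmd.compile : Cmd → Prog
  | skip => .skip
  | set x e => .seq (e.compile 41) (.seq (.const 42 0) (.arith .add x.idx 41 42))
  | put b e f => .seq (compilePair f e) (.seq (addrProg b 42) (.store 42 41))
  | seq p q => .seq p.compile q.compile
  | ite e f p q => .seq (compilePair e f) (.ite 41 42 p.compile q.compile)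
  -- The machine loop compares two registers, so the test is evaluated once before the loop and
  -- again at the end of every round.
  | loop e f p =>
      .seq (compilePair e f) (.loop 41 42 (.seq p.compile (compilePair e f)))

/-- The overhead of compilation. -/
def Cmd.size : Cmd → ℕ
  | skip => 1
  | set _ e => e.cost + 2
  | put _ e f => f.cost + e.cost + 6
  | seq p q => p.size + q.size
  | ite e f p q => e.cost + f.cost + 1 + p.size + q.size
  | loop e f p => e.cost + f.cost + 1 + p.size

/-! ### Correctness and overhead of the compilation -/

section Correctness

variable {M B W : ℕ}

/-- `r'` differs from `r` in registers from `d` on only. -/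
def SameBelow (d : ℕ) (r r' : State) : Prop :=
  r'.mem = r.mem ∧ ∀ x < d, r'.reg x = r.reg x

theorem SameBelow.trans {d d' : ℕ} {r r' r'' : State} (h : SameBelow d r r')
    (h' : SameBelow d' r' r'') (hd : d ≤ d') : SameBelow d r r'' :=
  ⟨h'.1.trans h.1, fun x hx => (h'.2 x (hx.trans_le hd)).trans (h.2 x hx)⟩

theorem Repr.congr {s : Store} {r r' : State} {d : ℕ} (h : Repr M W s r) (hs : SameBelow d r r')
    (hd : 41 ≤ d) : Repr M W s r' where
  var x := by rw [hs.2 _ (by have := x.idx_lt; omega), h.var]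
  base := by rw [hs.2 _ (by unfold baseReg; omega), h.base]
  inp i hi := by rw [hs.1, h.inp i hi]
  arr b i := by rw [hs.1, h.arr]
  var_le := h.var_le
  arr_le := h.arr_le
  inp_le := h.inp_le

theorem exec_addrProg (hW : 16 * B + 16 + M ≤ W) {r : State} {d i : ℕ} (b : Arr) (hd : 41 ≤ d)
    (hbase : r.reg baseReg = M) (hi : r.reg d = i) (hB : i ≤ B) :
    ∃ r', Exec W (addrProg b d) r 5 r' ∧ SameBelow d r r' ∧ r'.reg d = 16 * i + b.idx + M := by
  have hb := b.idx_lt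
  subst hi
  have hne : baseReg ≠ d := by unfold baseReg; omega
  have hne' : baseReg ≠ d + 1 := by unfold baseReg; omega
  refine ⟨_, .seq (.const _ _ _ (by omega)) <| .seq (.arith _ _ _ _ _ ?_) <|
    .seq (.const _ _ _ (by omega)) <| .seq (.arith _ _ _ _ _ ?_) (.arith _ _ _ _ _ ?_),
    ⟨rfl, ?_⟩, ?_⟩
  · simp [State.setReg, ArithOp.eval]; omega
  · simp [State.setReg, ArithOp.eval]; omega
  · simp [State.setReg, ArithOp.eval, hne, hne', hbase]; omega
  · intro x hx
    have h1 : x ≠ d := by omega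
    have h2 : x ≠ d + 1 := by omega
    simp [State.setReg, h1, h2]
  · simp [State.setReg, ArithOp.eval, hne, hne', hbase]; omega

theorem Expr.eval_le (hW : 16 * B + 16 + M ≤ W) {s : Store} {r : State} (hr : Repr M W s r) :
    ∀ {e : Expr}, e.Ok M B s → e.eval s ≤ W
  | lit c, h => by simp only [Ok, eval] at h ⊢; omega
  | var x, _ => hr.var_le x
  | inp e, h => hr.inp_le _ h.2
  | get b e, _ => hr.arr_le b _
  | op o e f, h => by have := h.2.2; simp only [eval]; omega

theorem Expr.exec_compile (hW : 16 * B + 16 + M ≤ W) {s : Store} (e : Expr) (hok : e.Ok M B s) :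
    ∀ {r : State} {d : ℕ}, Repr M W s r → 41 ≤ d →
      ∃ r', Exec W (e.compile d) r e.cost r' ∧ SameBelow d r r' ∧ r'.reg d = e.eval s := by
  induction e with
  | lit c =>
    intro r d hr hd
    simp only [Ok] at hok
    refine ⟨_, .const _ _ _ (by omega), ⟨rfl, fun x hx => ?_⟩, ?_⟩
    · simp [State.setReg, (show x ≠ d by omega)]
    · simp [State.setReg]
  | var x =>
    intro r d hr hd
    have hx := x.idx_lt
    have hne : x.idx ≠ d := by omega
    refine ⟨_, .seq (.const _ _ _ (by omega)) (.arith _ _ _ _ _ ?_), ⟨rfl, fun y hy => ?_⟩, ?_⟩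
    · simpa [State.setReg, ArithOp.eval, hne, hr.var] using hr.var_le x
    · simp [State.setReg, (show y ≠ d by omega)]
    · simp [State.setReg, ArithOp.eval, hne, hr.var]
  | inp e ih =>
    intro r d hr hd
    obtain ⟨r', h1, h2, h3⟩ := ih hok.1 hr hd
    refine ⟨_, .seq h1 (.load _ _ _), ⟨h2.1, fun x hx => ?_⟩, ?_⟩
    · simp [State.setReg, (show x ≠ d by omega), h2.2 x hx]
    · simp [State.setReg, h3, h2.1, hr.inp _ hok.2]
  | get b e ih =>
    intro r d hr hd
    obtain ⟨r', h1, h2, h3⟩ := ih hok.1 hr hd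
    obtain ⟨r'', h4, h5, h6⟩ := exec_addrProg hW b hd
      ((hr.congr h2 hd).base) h3 hok.2
    refine ⟨_, .seq h1 (.seq h4 (.load _ _ _)), ⟨h5.1.trans h2.1, fun x hx => ?_⟩, ?_⟩
    · simp [State.setReg, (show x ≠ d by omega), h2.2 x hx, h5.2 x hx]
    · simp [State.setReg, h6, h5.1, h2.1, hr.arr]
  | op o e f ihe ihf =>
    intro r d hr hd
    obtain ⟨r', h1, h2, h3⟩ := ihe hok.1 hr hd
    obtain ⟨r'', h4, h5, h6⟩ := ihf hok.2.1 (hr.congr h2 hd) (by omega : 41 ≤ d + 1)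
    have h7 := h5.2 d (by omega)
    have h8 := hok.2.2
    have := Exec.seq h1 (Exec.seq h4
      (Exec.arith (W := W) r'' o d d (d + 1) (by rw [h7, h3, h6]; omega)))
    rw [← add_assoc] at this
    refine ⟨_, this, (h2.trans h5 (by omega)).trans ⟨rfl, fun x hx => ?_⟩ le_rfl, ?_⟩
    · simp [State.setReg, (show x ≠ d by omega)]
    · simp [State.setReg, h7, h3, h6]

theorem exec_compilePair (hW : 16 * B + 16 + M ≤ W) {s : Store} {e f : Expr} (he : e.Ok M B s)
    (hf : f.Ok M B s) {r : State} (hr : Repr M W s r) :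
    ∃ r', Exec W (compilePair e f) r (e.cost + f.cost) r' ∧ Repr M W s r' ∧
      r'.reg 41 = e.eval s ∧ r'.reg 42 = f.eval s := by
  obtain ⟨r', h1, h2, h3⟩ := e.exec_compile hW he hr le_rfl
  have hr' := hr.congr h2 le_rfl
  obtain ⟨r'', h4, h5, h6⟩ := f.exec_compile hW hf hr' (by omega : 41 ≤ 42)
  exact ⟨r'', .seq h1 h4, hr'.congr h5 (by omega), by rw [h5.2 41 (by omega), h3], h6⟩

/-- The overhead factor `c.size` depends on the program text only, so time bounds in the language
become time bounds on the machine up to a constant. The hypothesis on `W` leaves room for the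
largest cell address. -/
theorem Cmd.exec_compile (hW : 16 * B + 16 + M ≤ W) {c : Cmd} {s s' : Store} {τ : ℕ}
    (h : c.Eval M B s τ s') : ∀ {r : State}, Repr M W s r →
      ∃ τ' r', Exec W c.compile r τ' r' ∧ τ' ≤ c.size * τ ∧ Repr M W s' r' := by
  induction h with
  | skip s => exact fun {r} hr => ⟨_, _, .skip _, by simp [size], hr⟩
  | set s x e h =>
    intro r hr
    obtain ⟨r', h1, h2, h3⟩ := e.exec_compile hW h hr le_rfl
    have hr' := hr.congr h2 le_rfl
    have hx := x.idx_lt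
    have hle := Expr.eval_le hW hr h
    have hne : x.idx ≠ 42 := by omega
    refine ⟨_, _, .seq h1 (.seq (.const _ _ _ (by omega)) (.arith _ _ _ _ _ ?_)), ?_, ?_⟩
    · simpa [State.setReg, ArithOp.eval, h3] using hle
    · simp [size]
    · constructor
      · intro y
        have hy := y.idx_lt
        by_cases hxy : y = x
        · subst hxy; simp [State.setReg, ArithOp.eval, h3, Store.set_var]
        · have : y.idx ≠ x.idx := fun h => hxy (Var.idx_injective h)
          simp [State.setReg, hr'.var, this, Store.set_var, hxy, (show y.idx ≠ 42 by omega)]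
      · have : baseReg ≠ x.idx := by unfold baseReg; omega
        simp [State.setReg, this, (show baseReg ≠ 42 by decide), hr'.base]
      · exact hr'.inp
      · exact hr'.arr
      · intro y
        rw [Store.set_var]
        split_ifs
        exacts [hle, hr.var_le y]
      · exact hr.arr_le
      · exact hr.inp_le
  | put s b e f he hf hB =>
    intro r hr
    obtain ⟨r', h1, h2, h3, h4⟩ := exec_compilePair hW hf he hr
    obtain ⟨r'', h5, h6, h7⟩ := exec_addrProg hW b (by omega : 41 ≤ 42) h2.base h4 hB
    have hr' := h2.congr h6 (by omega)
    have h8 := h6.2 41 (by omega)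
    have hle := Expr.eval_le hW hr hf
    have hbi := b.idx_lt
    refine ⟨_, _, .seq h1 (.seq h5 (.store _ _ _)), by simp [size], hr'.var, hr'.base,
      ?_, ?_, hr.var_le, ?_, hr.inp_le⟩
    · intro i hi
      have : i ≠ 16 * e.eval s + b.idx + M := by omega
      simp [State.setMem, h7, this, hr'.inp i hi, Store.put_inp]
    · intro b' i
      have hbi' := b'.idx_lt
      rw [Store.put_arr]
      by_cases hb : b' = b
      · subst hb
        by_cases hi : i = e.eval s
        · subst hi; simp [State.setMem, h7, h8, h3]
        · have : 16 * i + b'.idx + M ≠ 16 * e.eval s + b'.idx + M := by omega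
          simp [State.setMem, h7, hi, hr'.arr]
      · have hne : b'.idx ≠ b.idx := fun h => hb (Arr.idx_injective h)
        have : 16 * i + b'.idx + M ≠ 16 * e.eval s + b.idx + M := by omega
        simp only [State.setMem, h7, Function.update_of_ne this, hb, hr'.arr, if_false]
    · intro b' i
      rw [Store.put_arr]
      split_ifs
      · rw [Function.update_apply]
        split_ifs
        exacts [hle, hr.arr_le _ _]
      · exact hr.arr_le _ _
  | seq hp hq ihp ihq =>
    intro r hr
    obtain ⟨a', r', h1, h2, h3⟩ := ihp hr
    obtain ⟨b', r'', h4, h5, h6⟩ := ihq h3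
    exact ⟨_, r'', .seq h1 h4, by simp only [size]; nlinarith, h6⟩
  | ite_true he hf h hp ih =>
    intro r hr
    obtain ⟨r', h1, h2, h3, h4⟩ := exec_compilePair hW he hf hr
    obtain ⟨a', r'', h5, h6, h7⟩ := ih h2
    exact ⟨_, r'', .seq h1 (.ite_true (by rwa [h3, h4]) h5), by simp only [size]; nlinarith, h7⟩
  | ite_false he hf h hp ih =>
    intro r hr
    obtain ⟨r', h1, h2, h3, h4⟩ := exec_compilePair hW he hf hr
    obtain ⟨a', r'', h5, h6, h7⟩ := ih h2
    exact ⟨_, r'', .seq h1 (.ite_false (by rwa [h3, h4]) h5), by simp only [size]; nlinarith, h7⟩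
  | loop_true he hf h hp hl ihp ihl =>
    intro r hr
    obtain ⟨r₁, h1, h2, h3, h4⟩ := exec_compilePair hW he hf hr
    obtain ⟨a', r₂, h5, h6, h7⟩ := ihp h2
    obtain ⟨b', r₃, h8, h9, h10⟩ := ihl h7
    -- The remaining rounds are available as an evaluation of the test followed by a machine loop.
    -- Splitting them lets this evaluation serve as the end of the present round.
    simp only [compile] at h8
    cases h8 with
    | seq h11 h12 =>
      refine ⟨_, r₃, .seq h1 (.loop_true (by rwa [h3, h4]) (.seq h5 h11) h12), ?_, h10⟩
      simp only [size] at h9 ⊢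
      nlinarith
  | loop_false he hf h =>
    intro r hr
    obtain ⟨r', h1, h2, h3, h4⟩ := exec_compilePair hW he hf hr
    exact ⟨_, r', .seq h1 (.loop_false (by rwa [h3, h4])), by simp only [size]; omega, h2⟩

end Correctness

end

section

/-! ### Reasoning about commands -/

/-- The variables that a command may change. -/
def Cmd.vars : Cmd → List Var
  | skip => []
  | set x _ => [x]
  | put _ _ _ => []
  | seq p q => p.vars ++ q.vars
  | ite _ _ p q => p.vars ++ q.vars
  | loop _ _ p => p.vars

/-- The arrays that a command may change. -/
def Cmd.arrs : Cmd → List Arr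
  | skip => []
  | set _ _ => []
  | put b _ _ => [b]
  | seq p q => p.arrs ++ q.arrs
  | ite _ _ p q => p.arrs ++ q.arrs
  | loop _ _ p => p.arrs

/-- `s'` arises from `s` by changing only what `c` may change. -/
structure Frame (c : Cmd) (s s' : Store) : Prop where
  var : ∀ x, x ∉ c.vars → s'.var x = s.var x
  arr : ∀ b, b ∉ c.arrs → s'.arr b = s.arr b
  inp : s'.inp = s.inp

theorem Frame.refl (c : Cmd) (s : Store) : Frame c s s := ⟨fun _ _ => rfl, fun _ _ => rfl, rfl⟩

theorem Frame.trans {c : Cmd} {s s' s'' : Store} (h : Frame c s s') (h' : Frame c s' s'') :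
    Frame c s s'' :=
  ⟨fun x hx => (h'.var x hx).trans (h.var x hx), fun b hb => (h'.arr b hb).trans (h.arr b hb),
    h'.inp.trans h.inp⟩

theorem Frame.mono {c c' : Cmd} {s s' : Store} (h : Frame c s s') (hv : c.vars ⊆ c'.vars)
    (ha : c.arrs ⊆ c'.arrs) : Frame c' s s' :=
  ⟨fun x hx => h.var x fun h' => hx (hv h'), fun b hb => h.arr b fun h' => hb (ha h'), h.inp⟩

variable {M B : ℕ}

/-- The sets of possibly changed variables and arrays are syntactic, so that `decide` settles what
survives a subprogram. -/
theorem Cmd.Eval.frame {c : Cmd} {s s' : Store} {τ : ℕ} (h : c.Eval M B s τ s') :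
    Frame c s s' := by
  induction h with
  | skip s => exact .refl _ _
  | set s x e h =>
    refine ⟨fun y hy => ?_, fun _ _ => rfl, rfl⟩
    rw [Store.set_var, if_neg (by simpa [vars] using hy)]
  | put s b e f =>
    refine ⟨fun _ _ => rfl, fun b' hb => ?_, rfl⟩
    rw [Store.put_arr, if_neg (by simpa [arrs] using hb)]
  | seq _ _ ihp ihq =>
    exact (ihp.mono (by simp [vars]) (by simp [arrs])).trans
      (ihq.mono (by simp [vars]) (by simp [arrs]))
  | ite_true _ _ _ _ ih => exact ih.mono (by simp [vars]) (by simp [arrs])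
  | ite_false _ _ _ _ ih => exact ih.mono (by simp [vars]) (by simp [arrs])
  | loop_true _ _ _ _ _ ihp ihl =>
    exact (ihp.mono (by simp [vars]) (by simp [arrs])).trans ihl
  | loop_false => exact .refl _ _

/-- Started in `s`, the command `c` halts after some number `τ` of steps in some state `s'` with
`Q τ s'`. -/
def Runs (M B : ℕ) (c : Cmd) (s : Store) (Q : ℕ → Store → Prop) : Prop :=
  ∃ τ s', c.Eval M B s τ s' ∧ Q τ s'

theorem Runs.mono {c : Cmd} {s : Store} {P Q : ℕ → Store → Prop} (h : Runs M B c s P)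
    (hPQ : ∀ τ s', Frame c s s' → P τ s' → Q τ s') : Runs M B c s Q := by
  obtain ⟨τ, s', h1, h2⟩ := h
  exact ⟨τ, s', h1, hPQ τ s' h1.frame h2⟩

@[simp] theorem runs_skip {s : Store} {Q : ℕ → Store → Prop} : Runs M B .skip s Q ↔ Q 1 s := by
  constructor
  · rintro ⟨_, _, ⟨⟩, h⟩
    exact h
  · exact fun h => ⟨_, _, .skip _, h⟩

@[simp] theorem runs_set {x : Var} {e : Expr} {s : Store} {Q : ℕ → Store → Prop} :
    Runs M B (.set x e) s Q ↔ e.Ok M B s ∧ Q 1 (s.set x (e.eval s)) := by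
  constructor
  · rintro ⟨_, _, h', h⟩
    cases h'
    exact ⟨‹_›, h⟩
  · exact fun h => ⟨_, _, .set _ _ _ h.1, h.2⟩

@[simp] theorem runs_put {b : Arr} {e f : Expr} {s : Store} {Q : ℕ → Store → Prop} :
    Runs M B (.put b e f) s Q ↔
      (e.Ok M B s ∧ f.Ok M B s ∧ e.eval s ≤ B) ∧ Q 1 (s.put b (e.eval s) (f.eval s)) := by
  constructor
  · rintro ⟨_, _, h', h⟩
    cases h'
    exact ⟨⟨‹_›, ‹_›, ‹_›⟩, h⟩
  · exact fun h => ⟨_, _, .put _ _ _ _ h.1.1 h.1.2.1 h.1.2.2, h.2⟩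

@[simp] theorem runs_seq {p q : Cmd} {s : Store} {Q : ℕ → Store → Prop} :
    Runs M B (.seq p q) s Q ↔
      Runs M B p s fun τ s' => Runs M B q s' fun τ' s'' => Q (τ + τ') s'' := by
  constructor
  · rintro ⟨_, _, h', h⟩
    cases h' with
    | seq hp hq => exact ⟨_, _, hp, _, _, hq, h⟩
  · rintro ⟨_, _, hp, _, _, hq, h⟩
    exact ⟨_, _, .seq hp hq, h⟩

@[simp] theorem runs_ite {e f : Expr} {p q : Cmd} {s : Store} {Q : ℕ → Store → Prop} :
    Runs M B (.ite e f p q) s Q ↔ (e.Ok M B s ∧ f.Ok M B s) ∧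
      (e.eval s < f.eval s → Runs M B p s fun τ s' => Q (τ + 1) s') ∧
      (¬ e.eval s < f.eval s → Runs M B q s fun τ s' => Q (τ + 1) s') := by
  constructor
  · rintro ⟨_, _, h', h⟩
    cases h' with
    | ite_true he hf hlt hp => exact ⟨⟨he, hf⟩, fun _ => ⟨_, _, hp, h⟩, fun h' => absurd hlt h'⟩
    | ite_false he hf hlt hp => exact ⟨⟨he, hf⟩, fun h' => absurd h' hlt, fun _ => ⟨_, _, hp, h⟩⟩
  · rintro ⟨⟨he, hf⟩, hp, hq⟩
    by_cases hlt : e.eval s < f.eval s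
    · obtain ⟨_, _, h1, h2⟩ := hp hlt
      exact ⟨_, _, .ite_true he hf hlt h1, h2⟩
    · obtain ⟨_, _, h1, h2⟩ := hq hlt
      exact ⟨_, _, .ite_false he hf hlt h1, h2⟩

/-- The rule for loops: `I` is an invariant and `Φ` is a potential that pays for the running time
and decreases with every round. -/
theorem Runs.loop {e f : Expr} {p : Cmd} {s : Store} (I : Store → Prop) (Φ : Store → ℕ)
    (h0 : I s) (hok : ∀ s', I s' → Frame p s s' → e.Ok M B s' ∧ f.Ok M B s')
    (hstep : ∀ s', I s' → Frame p s s' → e.eval s' < f.eval s' →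
      Runs M B p s' fun τ s'' => I s'' ∧ τ + 1 + Φ s'' ≤ Φ s') :
    Runs M B (.loop e f p) s fun τ s' =>
      I s' ∧ ¬ e.eval s' < f.eval s' ∧ τ + Φ s' ≤ Φ s + 1 := by
  -- Induction on a bound for the potential: every round lowers it by at least one, which also gives
  -- termination.
  suffices ∀ N, ∀ s', Φ s' ≤ N → I s' → Frame p s s' → ∃ τ s'', (Cmd.loop e f p).Eval M B s' τ s'' ∧
      I s'' ∧ ¬ e.eval s'' < f.eval s'' ∧ τ + Φ s'' ≤ Φ s' + 1 from
    this (Φ s) s le_rfl h0 (.refl _ _)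
  intro N
  induction N with
  | zero =>
    intro s' hN hI hF
    obtain ⟨he, hf⟩ := hok s' hI hF
    by_cases hlt : e.eval s' < f.eval s'
    · obtain ⟨τ, s'', h1, h2, h3⟩ := hstep s' hI hF hlt
      omega
    · exact ⟨_, _, .loop_false he hf hlt, hI, hlt, by omega⟩
  | succ N ih =>
    intro s' hN hI hF
    obtain ⟨he, hf⟩ := hok s' hI hF
    by_cases hlt : e.eval s' < f.eval s'
    · obtain ⟨τ, s'', h1, h2, h3⟩ := hstep s' hI hF hlt
      obtain ⟨τ', s₃, h4, h5, h6, h7⟩ := ih s'' (by omega) h2 (hF.trans h1.frame)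
      exact ⟨_, _, .loop_true he hf hlt h1 h4, h5, h6, by omega⟩
    · exact ⟨_, _, .loop_false he hf hlt, hI, hlt, by omega⟩

/-- `for i in 0, …, y - 1 do p` -/
def Cmd.for (i y : Var) (p : Cmd) : Cmd :=
  .seq (i ::= 0) (.loop i y (p ;; i ::= i + 1))

/-- The rule for `for` loops, with the number of completed rounds as a parameter of the
invariant and with a bound `T` on the time of each round that is not paid for by the potential
`Φ`. -/
theorem Runs.for_potential {i y : Var} {p : Cmd} {s : Store} (I : ℕ → Store → Prop) (Φ : Store → ℕ) (T : ℕ)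
    (hi : i ∉ p.vars) (hy : y ∉ p.vars) (hiy : y ≠ i) (hB : s.var y ≤ B) (hB1 : 1 ≤ B)
    (h0 : I 0 (s.set i 0))
    (hstep : ∀ j s', j < s.var y → s'.var i = j → Frame (.for i y p) s s' → I j s' →
      Runs M B p s' fun τ s'' => τ + Φ (s''.set i (j + 1)) ≤ T + Φ s' ∧
        I (j + 1) (s''.set i (j + 1))) :
    Runs M B (.for i y p) s fun τ s' => I (s.var y) s' ∧
      τ + Φ s' ≤ (T + 2) * s.var y + 2 + Φ (s.set i 0) := by
  have hsub : ∀ s' : Store, Frame (p ;; i ::= i + 1) (s.set i 0) s' →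
      Frame (.for i y p) s s' := fun s' h => by
    have h1 : Frame (.for i y p) s (s.set i 0) := by
      refine ⟨fun x hx => ?_, fun _ _ => rfl, rfl⟩
      rw [Store.set_var, if_neg]
      rintro rfl
      simp [Cmd.for, Cmd.vars] at hx
    exact h1.trans (h.mono (by simp [Cmd.for, Cmd.vars]) (by simp [Cmd.for, Cmd.arrs]))
  rw [Cmd.for, runs_seq, runs_set]
  refine ⟨by simp, ?_⟩
  refine (Runs.loop (fun s' => s'.var i ≤ s.var y ∧ I (s'.var i) s' ∧ s'.var y = s.var y)
    (fun s' => (T + 2) * (s.var y - s'.var i) + Φ s') ?_ ?_ ?_).mono ?_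
  · refine ⟨by simp [Store.set_var], ?_, by simp [Store.set_var, hiy]⟩
    simpa [Store.set_var] using h0
  · simp
  · rintro s' ⟨h1, h2, h3⟩ hF hlt
    simp only [Expr.eval, h3] at hlt
    rw [runs_seq]
    refine (hstep _ s' hlt rfl (hsub s' hF) h2).mono ?_
    rintro τ s'' hF' ⟨hτ, hI⟩
    have e1 := hF'.var i hi
    have e2 := hF'.var y hy
    rw [runs_set]
    simp only [Expr.Ok, Expr.eval, ArithOp.eval, e1, Store.set_var, if_true, if_neg hiy, e2]
    refine ⟨⟨trivial, hB1, by omega⟩, ⟨by omega, hI, h3⟩, ?_⟩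
    obtain ⟨r, hr⟩ : ∃ r, s.var y - s'.var i = r + 1 := ⟨s.var y - s'.var i - 1, by omega⟩
    have : s.var y - (s'.var i + 1) = r := by omega
    rw [hr, this]
    nlinarith
  · rintro τ s' hF ⟨⟨h1, h2, h3⟩, h4, h5⟩
    simp only [Expr.eval, h3] at h4
    have : s'.var i = s.var y := by omega
    refine ⟨this ▸ h2, ?_⟩
    simp only [Store.set_var, if_true, Expr.eval, Nat.sub_zero] at h5
    omega

/-- The rule for `for` loops with a bound `T` on the time of each round. -/
theorem Runs.for {i y : Var} {p : Cmd} {s : Store} (I : ℕ → Store → Prop) (T : ℕ)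
    (hi : i ∉ p.vars) (hy : y ∉ p.vars) (hiy : y ≠ i) (hB : s.var y ≤ B) (hB1 : 1 ≤ B)
    (h0 : I 0 (s.set i 0))
    (hstep : ∀ j s', j < s.var y → s'.var i = j → Frame (.for i y p) s s' → I j s' →
      Runs M B p s' fun τ s'' => τ ≤ T ∧ I (j + 1) (s''.set i (j + 1))) :
    Runs M B (.for i y p) s fun τ s' => I (s.var y) s' ∧ τ ≤ (T + 2) * s.var y + 2 :=
  Runs.for_potential I (fun _ => 0) T hi hy hiy hB hB1 h0 hstep

end

section

/-! ### Bad pairs and clubs -/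

section Pairs

variable {H : SimpleGraph ℕ}

open Classical in
/-- The number of common neighbours of `u` and `v` in `S`. -/
noncomputable def commonCount (H : SimpleGraph ℕ) (S : Finset ℕ) (u v : ℕ) : ℕ :=
  (S.filter fun x => H.Adj u x ∧ H.Adj x v).card

/-- Fewer than `c` vertices separate `u` from `v` in the subgraph induced by `S`; the set `A` is
the part of `u`. -/
def Separated (H : SimpleGraph ℕ) (S : Finset ℕ) (c u v : ℕ) : Prop :=
  ∃ U A : Finset ℕ, U.card < c ∧ A ⊆ S ∧ Disjoint A U ∧ u ∈ A ∧ v ∉ A ∧ v ∉ U ∧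
    ∀ a ∈ A, ∀ b ∈ S, H.Adj a b → b ∈ A ∨ b ∈ U

open Classical in
/-- `u` and `v` have too few common neighbours in `S`, where an edge between them counts `w`-fold,
or they are separated by fewer than `c` vertices. -/
def BadPair (H : SimpleGraph ℕ) (w θ c : ℕ) (S : Finset ℕ) (u v : ℕ) : Prop :=
  commonCount H S u v + w * (if H.Adj u v then 1 else 0) < θ ∨ Separated H S c u v

/-- `S` contains no bad pair. -/
def IsClub (H : SimpleGraph ℕ) (w θ c : ℕ) (S : Finset ℕ) : Prop :=
  ∀ u ∈ S, ∀ v ∈ S, u ≠ v → ¬ BadPair H w θ c S u v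

theorem commonCount_mono {S F : Finset ℕ} (h : S ⊆ F) (u v : ℕ) :
    commonCount H S u v ≤ commonCount H F u v := by
  classical exact Finset.card_le_card (Finset.filter_subset_filter _ h)

/-- The same separator works with the side of u cut down to S; it is harmless that the separator
need not lie in S. -/
theorem Separated.anti {S F : Finset ℕ} {c u v : ℕ} (h : Separated H F c u v) (hS : S ⊆ F)
    (hu : u ∈ S) : Separated H S c u v := by
  obtain ⟨U, A, h1, h2, h3, h4, h5, h6, h7⟩ := h
  refine ⟨U, A ∩ S, h1, Finset.inter_subset_right, h3.mono_left Finset.inter_subset_left,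
    Finset.mem_inter.2 ⟨h4, hu⟩, fun h => h5 (Finset.mem_inter.1 h).1, h6, ?_⟩
  intro a ha b hb hab
  rcases h7 a (Finset.mem_inter.1 ha).1 b (hS hb) hab with h | h
  · exact .inl (Finset.mem_inter.2 ⟨h, hb⟩)
  · exact .inr h

/-- This heredity is what makes branching on a bad pair sound: the pair stays bad in every smaller
set that could contain both vertices. -/
theorem BadPair.anti {S F : Finset ℕ} {w θ c u v : ℕ} (h : BadPair H w θ c F u v) (hS : S ⊆ F)
    (hu : u ∈ S) : BadPair H w θ c S u v := by
  rcases h with h | h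
  · exact .inl (lt_of_le_of_lt (by gcongr; exact commonCount_mono hS u v) h)
  · exact .inr (h.anti hS hu)

/-- For separations it suffices to consider sufficiently many sources. -/
theorem not_separated_of_sources {F A : Finset ℕ} {c : ℕ} (hAF : A ⊆ F) (hc : c ≤ A.card)
    (h : ∀ u ∈ A, ∀ v ∈ F, ¬ Separated H F c u v) {u v : ℕ} (hu : u ∈ F) (hv : v ∈ F) :
    ¬ Separated H F c u v := by
  rintro ⟨U, D, h1, h2, h3, h4, h5, h6, h7⟩
  -- The separator has fewer than `c` vertices and A has at least `c`. The source a found here lies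
  -- on one side, and v or u lies on the other.
  obtain ⟨a, ha, haU⟩ : ∃ a ∈ A, a ∉ U := by
    by_contra! hcon
    have := Finset.card_le_card (show A ⊆ U from hcon)
    omega
  by_cases haD : a ∈ D
  · exact h a ha v hv ⟨U, D, h1, h2, h3, haD, h5, h6, h7⟩
  -- If a is not on the side D of u, then it lies in the rest of `F \ U`, which U separates from D
  -- by symmetry of adjacency.
  · refine h a ha u hu ⟨U, (F \ U) \ D, h1, Finset.sdiff_subset.trans Finset.sdiff_subset, ?_, ?_,
      by simp [h4], Finset.disjoint_left.1 h3 h4, ?_⟩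
    · exact Finset.disjoint_left.2 fun x hx => (Finset.mem_sdiff.1 (Finset.mem_sdiff.1 hx).1).2
    · simp [hAF ha, haU, haD]
    · intro x hx y hy hxy
      simp only [Finset.mem_sdiff] at hx ⊢
      by_contra! hcon
      have hyD : y ∈ D := by
        by_contra hyD
        exact hyD (hcon.1 ⟨hy, hcon.2⟩)
      rcases h7 y hyD x hx.1.1 hxy.symm with h | h
      exacts [hx.2 h, hx.1.2 h]

/-- An isolated vertex forms a bad pair with every other vertex. -/
theorem badPair_of_isolated {S : Finset ℕ} {w θ c u : ℕ} (hθ : 1 ≤ θ) (hu : ∀ x, ¬ H.Adj u x)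
    (v : ℕ) : BadPair H w θ c S u v := by
  left
  simp [commonCount, hu]
  omega

end Pairs

/-! ### Disjoint paths -/

/-- `p` encodes disjoint paths from `u` to `v` in `F`: every vertex `x ≠ v` of `F` has a
predecessor `p x` (itself if it is not on a path or if it is `u`), where the vertices outside of
`D` are disregarded. There are `c` vertices other than `u` with predecessor `u`. -/
structure Linkage (H : SimpleGraph ℕ) (F : Finset ℕ) (u v : ℕ) (D : Finset ℕ) (p : ℕ → ℕ)
    (c : ℕ) : Prop where
  maps : ∀ x ∈ F.erase v, p x ∈ F.erase v
  edge : ∀ x ∈ F.erase v, p x = x ∨ H.Adj (p x) x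
  inj : ∀ x ∈ D, ∀ y ∈ D, p x = p y → p x ≠ u → x = y
  count : (D.filter (fun x => p x = u)).card = c + 1
  -- A vertex that is nobody's predecessor must be the end of a path, hence adjacent to `v`; a
  -- vertex off the paths is its own predecessor.
  miss : ∀ y ∈ F.erase v, (∀ x ∈ D, p x ≠ y) → H.Adj y v

section Linkage

variable {H : SimpleGraph ℕ} {F : Finset ℕ} {u v c : ℕ} {p : ℕ → ℕ}

theorem Linkage.init (hu : u ∈ F) (huv : u ≠ v) (hp : ∀ x ∈ F, p x = x) :
    Linkage H F u v (F.erase v) p 0 where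
  maps x hx := by rwa [hp x (Finset.mem_of_mem_erase hx)]
  edge x hx := .inl (hp x (Finset.mem_of_mem_erase hx))
  inj x hx y hy h _ := by
    rwa [hp x (Finset.mem_of_mem_erase hx), hp y (Finset.mem_of_mem_erase hy)] at h
  count := by
    rw [Finset.card_eq_one]
    refine ⟨u, ?_⟩
    ext x
    simp only [Finset.mem_filter, Finset.mem_erase, Finset.mem_singleton]
    constructor
    · rintro ⟨⟨_, hx⟩, h⟩
      rwa [hp x hx] at h
    · rintro rfl
      exact ⟨⟨huv, hu⟩, hp _ hu⟩
  miss y hy h := absurd (hp y (Finset.mem_of_mem_erase hy)) (h y hy)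

/-- The fibre of `u` together with the fibres of a set `R`. -/
theorem Linkage.card_filter_le (h : Linkage H F u v (F.erase v) p c) (R : Finset ℕ) (hu : u ∈ R) :
    ((F.erase v).filter (fun x => p x ∈ R)).card ≤ c + R.card := by
  have h1 : (F.erase v).filter (fun x => p x ∈ R) ⊆
      (F.erase v).filter (fun x => p x = u) ∪
        (F.erase v).filter (fun x => p x ∈ R.erase u) := by
    intro x hx
    simp only [Finset.mem_filter, Finset.mem_union, Finset.mem_erase] at hx ⊢
    tauto
  -- Away from the fibre of `u` the map `p` is injective, so only that fibre contributes a surplus.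
  have h2 : ((F.erase v).filter (fun x => p x ∈ R.erase u)).card ≤ (R.erase u).card := by
    refine Finset.card_le_card_of_injOn p (fun x hx => (Finset.mem_filter.1 hx).2) ?_
    intro x hx y hy hxy
    have hx' := Finset.mem_filter.1 hx
    exact h.inj x hx'.1 y (Finset.mem_filter.1 hy).1 hxy (Finset.mem_erase.1 hx'.2).1
  have h3 := Finset.card_le_card h1
  have h4 := Finset.card_union_le ((F.erase v).filter (fun x => p x = u))
    ((F.erase v).filter (fun x => p x ∈ R.erase u))
  rw [h.count] at h4
  rw [Finset.card_erase_of_mem hu] at h2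
  have : 0 < R.card := Finset.card_pos.2 ⟨u, hu⟩
  omega

/-- The easy half of Menger's theorem, by counting the preimage of the side A of u under `p`. Edges
lead from A into A ∪ U only, so the preimage has at most |A| + |U| elements. Every vertex of A other
than u is hit, since a missed one would be adjacent to v, and u is hit `c + 1` times. This gives at
least |A| + `c` elements, so |U| ≥ `c`. -/
theorem Linkage.not_separated (h : Linkage H F u v (F.erase v) p c) (hv : v ∈ F) :
    ¬ Separated H F c u v := by
  rintro ⟨U, A, h1, h2, h3, h4, h5, h6, h7⟩
  have hsub : (F.erase v).filter (fun x => p x ∈ A) ⊆ A ∪ U := by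
    intro x hx
    obtain ⟨hx, hpx⟩ := Finset.mem_filter.1 hx
    rcases h.edge x hx with e | e
    · rw [e] at hpx
      exact Finset.mem_union_left _ hpx
    · exact Finset.mem_union.2 (h7 _ hpx x (Finset.mem_of_mem_erase hx) e)
  have hsurj : A.erase u ⊆ ((F.erase v).filter (fun x => p x ∈ A.erase u)).image p := by
    intro y hy
    have hyA := Finset.mem_of_mem_erase hy
    by_contra hcon
    have hyF : y ∈ F.erase v := Finset.mem_erase.2 ⟨fun e => h5 (e ▸ hyA), h2 hyA⟩
    have := h7 y hyA v hv (h.miss y hyF fun x hx e => hcon (Finset.mem_image.2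
      ⟨x, Finset.mem_filter.2 ⟨hx, e.symm ▸ hy⟩, e⟩))
    tauto
  have hlow : c + 1 + (A.erase u).card ≤ ((F.erase v).filter (fun x => p x ∈ A)).card := by
    have hdisj : Disjoint ((F.erase v).filter (fun x => p x = u))
        ((F.erase v).filter (fun x => p x ∈ A.erase u)) := by
      rw [Finset.disjoint_left]
      intro x hx hx'
      exact (Finset.mem_erase.1 (Finset.mem_filter.1 hx').2).1 (Finset.mem_filter.1 hx).2
    rw [← h.count]
    refine (Nat.add_le_add_left ((Finset.card_le_card hsurj).trans Finset.card_image_le) _).trans ?_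
    rw [← Finset.card_union_of_disjoint hdisj]
    refine Finset.card_le_card fun x hx => ?_
    simp only [Finset.mem_union, Finset.mem_filter, Finset.mem_erase] at hx ⊢
    rcases hx with hx | hx
    · exact ⟨hx.1, hx.2 ▸ h4⟩
    · exact ⟨hx.1, hx.2.2⟩
  have e1 := Finset.card_le_card hsub
  have e2 := Finset.card_union_le A U
  have e3 := Finset.card_erase_of_mem h4
  have : 0 < A.card := Finset.card_pos.2 ⟨u, h4⟩
  omega

/-- The hard half of Menger's theorem: R is the set reached by a failed search. The separator
consists of the vertices outside R whose predecessor is in R. As R lies in its own preimage and this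
preimage has at most `c` + |R| elements, the separator has at most `c` vertices. -/
theorem Linkage.separated (h : Linkage H F u v (F.erase v) p c) {R : Finset ℕ} {c' : ℕ}
    (hc : c < c') (hR : R ⊆ F.erase v) (hu : u ∈ R)
    (hself : ∀ y ∈ R, p y ∈ R) (hclosed : ∀ y ∈ R, ∀ x ∈ F.erase v, H.Adj y x → p x ∈ R)
    (hend : ∀ y ∈ R, ¬ H.Adj y v) : Separated H F c' u v := by
  refine ⟨((F.erase v).filter (fun x => p x ∈ R)) \ R, R, ?_,
    hR.trans (Finset.erase_subset _ _), Finset.disjoint_sdiff, hu,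
    fun h => (Finset.mem_erase.1 (hR h)).1 rfl, by simp, ?_⟩
  · have hsub : R ⊆ (F.erase v).filter (fun x => p x ∈ R) :=
      fun y hy => Finset.mem_filter.2 ⟨hR hy, hself y hy⟩
    rw [Finset.card_sdiff_of_subset hsub]
    have := h.card_filter_le R hu
    omega
  · intro a ha b hb hab
    by_cases hbR : b ∈ R
    · exact .inl hbR
    · have hbv : b ≠ v := fun e => hend a ha (e ▸ hab)
      have hb' : b ∈ F.erase v := Finset.mem_erase.2 ⟨hbv, hb⟩
      exact .inr (Finset.mem_sdiff.2 ⟨Finset.mem_filter.2 ⟨hb', hclosed a ha b hb' hab⟩, hbR⟩)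

/-- The first step of an augmentation: the last vertex gets the successor `v`. -/
theorem Linkage.release (h : Linkage H F u v (F.erase v) p c) {x : ℕ} (hxu : p x ≠ u)
    (hx : H.Adj (p x) v) : Linkage H F u v ((F.erase v).erase x) p c where
  maps := h.maps
  edge := h.edge
  inj a ha b hb := h.inj a (Finset.mem_of_mem_erase ha) b (Finset.mem_of_mem_erase hb)
  count := by
    rw [← h.count]
    congr 1
    ext a
    simp only [Finset.mem_filter, Finset.mem_erase]
    constructor
    · tauto
    · rintro ⟨h1, h2⟩
      exact ⟨⟨fun e => hxu (e ▸ h2), h1⟩, h2⟩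
  miss y hy hm := by
    -- The only vertex that can lose its last successor is `p x`, and it is adjacent to `v`.
    by_cases hyx : p x = y
    · exact hyx ▸ hx
    · exact h.miss y hy fun a ha e => by
        by_cases hax : a = x
        · exact hyx (hax ▸ e)
        · exact hm a (Finset.mem_erase.2 ⟨hax, ha⟩) e

/-- An intermediate step of an augmentation: `x` replaces `x'` as the successor of `p x'`. -/
theorem Linkage.shift {x x' : ℕ} (h : Linkage H F u v ((F.erase v).erase x) p c)
    (hx : x ∈ F.erase v) (hx' : x' ∈ F.erase v) (hne : x' ≠ x) (hu : p x' ≠ u)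
    (he : p x' = x ∨ H.Adj (p x') x) :
    Linkage H F u v ((F.erase v).erase x') (Function.update p x (p x')) c where
  maps a ha := by
    rw [Function.update_apply]
    split_ifs
    exacts [h.maps x' hx', h.maps a ha]
  edge a ha := by
    rw [Function.update_apply]
    split_ifs with hax
    · rwa [hax]
    · exact h.edge a ha
  inj a ha b hb := by
    simp only [Finset.mem_erase, ne_eq] at ha hb hx'
    -- Before the change, no other admissible vertex shares the predecessor of `x'`, so handing it
    -- to `x` keeps injectivity.
    have hI : ∀ d, ¬ d = x' → (¬ d = v ∧ d ∈ F) → ¬ d = x → p x' ≠ p d := fun d hd hd' hdx e =>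
      hd (h.inj x' (by simp [hne, hx']) d (by simp [hdx, hd']) e hu).symm
    simp only [Function.update_apply]
    split_ifs with hax hbx hbx
    · exact fun _ _ => hax.trans hbx.symm
    · exact fun e _ => absurd e (hI b hb.1 hb.2 hbx)
    · exact fun e _ => absurd e.symm (hI a ha.1 ha.2 hax)
    · exact fun e e' => h.inj a (by simp [hax, ha.2]) b (by simp [hbx, hb.2]) e e'
  count := by
    rw [← h.count]
    congr 1
    ext a
    simp only [Finset.mem_filter, Finset.mem_erase, Function.update_apply]
    constructor
    · rintro ⟨⟨h1, h2⟩, h3⟩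
      split_ifs at h3 with hax
      · exact absurd h3 hu
      · exact ⟨⟨hax, h2⟩, h3⟩
    · rintro ⟨⟨h1, h2⟩, h3⟩
      rw [if_neg h1]
      exact ⟨⟨fun e => hu (e ▸ h3), h2⟩, h3⟩
  miss y hy hm := by
    refine h.miss y hy fun a ha e => ?_
    obtain ⟨ha1, ha2⟩ := Finset.mem_erase.1 ha
    by_cases hax : a = x'
    -- The former predecessor of `x'` is not missed, because it is now the predecessor of `x`.
    · refine hm x (Finset.mem_erase.2 ⟨hne.symm, hx⟩) ?_
      rw [Function.update_self, ← hax, e]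
    · refine hm a (Finset.mem_erase.2 ⟨hax, ha2⟩) ?_
      rw [Function.update_of_ne ha1, e]

/-- The last step of an augmentation: `x` becomes a successor of `u`. -/
theorem Linkage.attach {x : ℕ} (h : Linkage H F u v ((F.erase v).erase x) p c)
    (hx : x ∈ F.erase v) (huF : u ∈ F.erase v) (he : u = x ∨ H.Adj u x) :
    Linkage H F u v (F.erase v) (Function.update p x u) (c + 1) where
  maps a ha := by
    rw [Function.update_apply]
    split_ifs
    exacts [huF, h.maps a ha]
  edge a ha := by
    rw [Function.update_apply]
    split_ifs with hax
    · rwa [hax]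
    · exact h.edge a ha
  inj a ha b hb := by
    simp only [Function.update_apply]
    split_ifs with hax hbx hbx
    · exact fun _ _ => hax.trans hbx.symm
    · exact fun _ e => absurd rfl e
    · exact fun e e' => absurd e e'
    · exact fun e e' => h.inj a (Finset.mem_erase.2 ⟨hax, ha⟩) b (Finset.mem_erase.2 ⟨hbx, hb⟩) e e'
  count := by
    rw [← h.count]
    have : (F.erase v).filter (fun a => Function.update p x u a = u) =
        insert x (((F.erase v).erase x).filter (fun a => p a = u)) := by
      ext a
      simp only [Finset.mem_filter, Finset.mem_insert, Finset.mem_erase, Function.update_apply]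
      by_cases hax : a = x
      · subst hax
        simpa using hx
      · simp [hax]
    rw [this, Finset.card_insert_of_notMem (by simp)]
  miss y hy hm := by
    refine h.miss y hy fun a ha e => ?_
    obtain ⟨ha1, ha2⟩ := Finset.mem_erase.1 ha
    refine hm a ha2 ?_
    rw [Function.update_of_ne ha1, e]

end Linkage

end

open _root_.WellConnectedClub.Expr (inp get)

section

/-! ### Reading the graph -/

/-- The last index below `i` with value `y` under `σ`, plus one, and `0` if there is none. -/
def lastArc (σ : ℕ → ℕ) : ℕ → ℕ → ℕ
  | 0, _ => 0
  | i + 1, y => if σ i = y then i + 1 else lastArc σ i y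

theorem lastArc_le (σ : ℕ → ℕ) (i y : ℕ) : lastArc σ i y ≤ i := by
  induction i with
  | zero => simp [lastArc]
  | succ i ih => simp only [lastArc]; split_ifs <;> omega

/-- Store the arc with number `c` from `a` to `b`. -/
def pushArc : Cmd :=
  -- The arc is prepended to the list of its tail. Links are arc numbers plus one, so the initial
  -- value 0 marks the end of a list.
  .put .src Var.c Var.a ;; .put .tgt Var.c Var.b ;; .put .next Var.c (get .first Var.a) ;;
  .put .first Var.a (Var.c + 1) ;;
  .ite (get .inS Var.a) 1 (.ns ::= Var.ns + 1 ;; .put .inS Var.a 1) .skip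

/-- Build adjacency lists, mark the vertices that are not isolated and count them. -/
def readEdges : Cmd :=
  .for .e .m (.c ::= 2 * Var.e ;; .a ::= inp Var.c ;; .b ::= inp (Var.c + 1) ;; pushArc ;;
    -- Exchanging the endpoints stores the reverse orientation of edge e as arc 2e + 1.
    .x ::= Var.a ;; .a ::= Var.b ;; .b ::= Var.x ;; .c ::= Var.c + 1 ;; pushArc)

open Classical in
/-- The data structures after the arcs with numbers below `i` have been read. -/
structure ArcsRead (σ τ : ℕ → ℕ) (i : ℕ) (s : Store) : Prop where
  src : ∀ c < i, s.arr .src c = σ c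
  tgt : ∀ c < i, s.arr .tgt c = τ c
  next : ∀ c < i, s.arr .next c = lastArc σ c (σ c)
  first : ∀ y, s.arr .first y = lastArc σ i y
  inS : ∀ y, s.arr .inS y = if y ∈ (Finset.range i).image σ then 1 else 0
  ns : s.var .ns = ((Finset.range i).image σ).card

theorem ArcsRead.congr {σ τ : ℕ → ℕ} {i : ℕ} {s s' : Store} (h : ArcsRead σ τ i s)
    (ha : s'.arr = s.arr) (hn : s'.var .ns = s.var .ns) : ArcsRead σ τ i s' := by
  constructor <;> simp only [ha, hn]
  exacts [h.src, h.tgt, h.next, h.first, h.inS, h.ns]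

variable {M B : ℕ}

theorem runs_pushArc {σ τ : ℕ → ℕ} {i : ℕ} {s : Store} (h : ArcsRead σ τ i s)
    (hc : s.var .c = i) (ha : s.var .a = σ i) (hb : s.var .b = τ i) (hσ : σ i ≤ B)
    (hi : i + 1 ≤ B) :
    Runs M B pushArc s fun T s' => T ≤ 7 ∧ ArcsRead σ τ (i + 1) s' := by
  have hcard : s.var .ns ≤ i := by
    rw [h.ns]
    simpa using Finset.card_image_le (s := Finset.range i) (f := σ)
  have key : ∀ s' : Store, s'.arr .src = Function.update (s.arr .src) i (σ i) →
      s'.arr .tgt = Function.update (s.arr .tgt) i (τ i) →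
      s'.arr .next = Function.update (s.arr .next) i (lastArc σ i (σ i)) →
      s'.arr .first = Function.update (s.arr .first) (σ i) (i + 1) →
      (∀ y, s'.arr .inS y = if y ∈ (Finset.range (i + 1)).image σ then 1 else 0) →
      s'.var .ns = ((Finset.range (i + 1)).image σ).card → ArcsRead σ τ (i + 1) s' := by
    intro s' h1 h2 h3 h4 h5 h6
    refine ⟨fun c hc => ?_, fun c hc => ?_, fun c hc => ?_, fun y => ?_, h5, h6⟩
    · rw [h1, Function.update_apply]
      split_ifs with e
      exacts [e ▸ rfl, h.src c (by omega)]
    · rw [h2, Function.update_apply]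
      split_ifs with e
      exacts [e ▸ rfl, h.tgt c (by omega)]
    · rw [h3, Function.update_apply]
      split_ifs with e
      exacts [e ▸ rfl, h.next c (by omega)]
    · rw [h4, Function.update_apply, lastArc]
      by_cases e : y = σ i
      · simp [e]
      · rw [if_neg e, if_neg (Ne.symm e), h.first]
  have hmem : ∀ y, y ∈ (Finset.range (i + 1)).image σ ↔
      y = σ i ∨ y ∈ (Finset.range i).image σ := by
    intro y
    rw [Finset.range_add_one, Finset.image_insert, Finset.mem_insert]
  simp only [pushArc, runs_seq, runs_put, runs_set, runs_ite, runs_skip]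
  simp [hc, ha, hb]
  refine ⟨by omega, ⟨hσ, by omega⟩, ⟨⟨by omega, by omega⟩, hσ⟩, ⟨hσ, by omega⟩, ?_, ?_⟩
  · intro h0
    have hnot : σ i ∉ (Finset.range i).image σ := by
      intro hm
      rw [h.inS, if_pos hm] at h0
      omega
    refine ⟨⟨by omega, by omega⟩, ⟨by omega, hσ⟩, key _ (by simp) (by simp) (by simp [h.first])
      (by simp) ?_ ?_⟩
    · intro y
      simp only [hmem, Store.put_arr, if_true, Function.update_apply]
      by_cases e : y = σ i
      · simp [e]
      · simp [e, h.inS]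
    · rw [Finset.range_add_one, Finset.image_insert, Finset.card_insert_of_notMem hnot]
      simp [h.ns]
  · intro h0
    have hin : σ i ∈ (Finset.range i).image σ := by
      by_contra hm
      rw [h.inS, if_neg hm] at h0
      omega
    have : (Finset.range (i + 1)).image σ = (Finset.range i).image σ := by
      rw [Finset.range_add_one, Finset.image_insert, Finset.insert_eq_of_mem hin]
    refine key _ (by simp) (by simp) (by simp [h.first]) (by simp) ?_ ?_
    · intro y
      rw [this]
      simp [h.inS]
    · rw [this]
      simp [h.ns]

/-- The other endpoint of the edge of an arc. -/
def arcHead (σ : ℕ → ℕ) (c : ℕ) : ℕ := if c % 2 = 0 then σ (c + 1) else σ (c - 1)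

theorem runs_readEdges {s : Store} (hM : M = 2 * s.var .m) (hinp : ∀ c < M, s.inp c ≤ B)
    (hB : M + 1 ≤ B) (ha : ∀ b i, s.arr b i = 0) (hns : s.var .ns = 0) :
    Runs M B readEdges s fun T s' =>
      T ≤ 30 * M + 2 ∧ ArcsRead s.inp (arcHead s.inp) M s' := by
  refine (Runs.for (fun j s' => ArcsRead s.inp (arcHead s.inp) (2 * j) s') 40 (by decide)
    (by decide) (by decide) (by omega) (by omega) ?_ ?_).mono ?_
  · constructor <;> simp [ha, hns, lastArc]
  · intro j s' hj hje hF hI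
    have hinp' := hF.inp
    have e1 : arcHead s.inp (2 * j) = s.inp (2 * j + 1) := by simp [arcHead]
    have e2 : arcHead s.inp (2 * j + 1) = s.inp (2 * j) := by
      rw [arcHead, if_neg (by omega)]
      rfl
    have b1 := hinp (2 * j) (by omega)
    have b2 := hinp (2 * j + 1) (by omega)
    simp [hje, hinp']
    refine ⟨⟨by omega, by omega⟩, by omega, ⟨⟨by omega, by omega⟩, by omega⟩, ?_⟩
    refine Runs.mono (runs_pushArc (i := 2 * j) (hI.congr rfl (by simp)) (by simp) (by simp)
      (by simp [e1]) b1 (by omega)) ?_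
    rintro T₁ s₁ hF₁ ⟨hT₁, hI₁⟩
    have v1 := hF₁.var .a (by decide)
    have v2 := hF₁.var .b (by decide)
    have v3 := hF₁.var .c (by decide)
    simp at v1 v2 v3
    simp [v1, v2, v3]
    refine ⟨⟨by omega, by omega⟩, Runs.mono (runs_pushArc (i := 2 * j + 1)
      (hI₁.congr rfl (by simp)) (by simp) (by simp) (by simp [e2]) b2 (by omega)) ?_⟩
    rintro T₂ s₂ hF₂ ⟨hT₂, hI₂⟩
    exact ⟨by omega, hI₂.congr rfl (by simp)⟩
  · rintro T s' _ ⟨h1, h2⟩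
    rw [hM]
    exact ⟨by omega, h1⟩

end

section

/-! ### The instance -/

/-- The graph with its list of arcs, and the parameters of the search. -/
structure Inst where
  H : SimpleGraph ℕ
  n : ℕ
  M : ℕ
  B : ℕ
  w : ℕ
  θ : ℕ
  tc : ℕ
  σ : ℕ → ℕ
  τ : ℕ → ℕ
  tail_lt : ∀ c < M, σ c < n
  head_lt : ∀ c < M, τ c < n
  adj : ∀ c < M, H.Adj (σ c) (τ c)
  exists_arc : ∀ x y, H.Adj x y → ∃ c < M, σ c = x ∧ τ c = y
  arc_inj : ∀ c < M, ∀ d < M, σ c = σ d → τ c = τ d → c = d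
  le_B : n + M + w + tc + 2 ≤ B

/-- The parameters and the adjacency lists are in place. -/
structure Ready (P : Inst) (s : Store) : Prop where
  n : s.var .n = P.n
  mm : s.var .mm = P.M
  w : s.var .w = P.w
  th : s.var .th = P.θ
  tc : s.var .tc = P.tc
  src : ∀ c < P.M, s.arr .src c = P.σ c
  tgt : ∀ c < P.M, s.arr .tgt c = P.τ c
  next : ∀ c < P.M, s.arr .next c = lastArc P.σ c (P.σ c)
  first : ∀ y, s.arr .first y = lastArc P.σ P.M y

theorem Ready.congr {P : Inst} {s s' : Store} (h : Ready P s)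
    (hv : ∀ x ∈ [Var.n, .mm, .w, .th, .tc], s'.var x = s.var x)
    (ha : ∀ b ∈ [Arr.src, .tgt, .next, .first], s'.arr b = s.arr b) : Ready P s' where
  n := by rw [hv _ (by decide), h.n]
  mm := by rw [hv _ (by decide), h.mm]
  w := by rw [hv _ (by decide), h.w]
  th := by rw [hv _ (by decide), h.th]
  tc := by rw [hv _ (by decide), h.tc]
  src := by rw [ha _ (by decide)]; exact h.src
  tgt := by rw [ha _ (by decide)]; exact h.tgt
  next := by rw [ha _ (by decide)]; exact h.next
  first := by rw [ha _ (by decide)]; exact h.first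

theorem Ready.frame {P : Inst} {s s' : Store} {c : Cmd} (h : Ready P s) (hF : Frame c s s')
    (hv : ∀ x ∈ [Var.n, .mm, .w, .th, .tc], x ∉ c.vars)
    (ha : ∀ b ∈ [Arr.src, .tgt, .next, .first], b ∉ c.arrs) : Ready P s' :=
  h.congr (fun x hx => hF.var x (hv x hx)) (fun b hb => hF.arr b (ha b hb))

/-- The array `inS` is the indicator of `F`. -/
def Holds (F : Finset ℕ) (s : Store) : Prop := ∀ x, s.arr .inS x = if x ∈ F then 1 else 0

/-- The number of arcs with number below `i` and tail `y`. -/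
def outArcs (σ : ℕ → ℕ) (i y : ℕ) : ℕ := ((Finset.range i).filter fun c => σ c = y).card

theorem outArcs_mono (σ : ℕ → ℕ) {i j : ℕ} (h : i ≤ j) (y : ℕ) :
    outArcs σ i y ≤ outArcs σ j y :=
  Finset.card_le_card (Finset.filter_subset_filter _ (Finset.range_mono h))

theorem outArcs_succ (σ : ℕ → ℕ) (i : ℕ) : outArcs σ (i + 1) (σ i) = outArcs σ i (σ i) + 1 := by
  rw [outArcs, Finset.range_add_one, Finset.filter_insert, if_pos rfl,
    Finset.card_insert_of_notMem (by simp)]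
  rfl

/-- Scanning every adjacency list once costs only the total number of arcs; this makes the search
linear. -/
theorem sum_outArcs (P : Inst) : ∑ y ∈ Finset.range P.n, outArcs P.σ P.M y = P.M := by
  have := Finset.card_eq_sum_card_fiberwise (s := Finset.range P.M) (t := Finset.range P.n)
    (f := P.σ) (fun c hc => by simpa using P.tail_lt c (by simpa using hc))
  rw [Finset.card_range] at this
  exact this.symm

/-- Following a link skips no arc with tail `y`, and the arc it leads to has tail `y`. -/
theorem lastArc_spec (σ : ℕ → ℕ) (i y : ℕ) :
    (∀ c, lastArc σ i y ≤ c → c < i → σ c ≠ y) ∧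
      ∀ c, lastArc σ i y = c + 1 → σ c = y := by
  induction i with
  | zero => simp [lastArc]
  | succ i ih =>
    simp only [lastArc]
    split_ifs with h
    · refine ⟨fun c h1 h2 => by omega, fun c hc => ?_⟩
      obtain rfl : i = c := by omega
      exact h
    · refine ⟨fun c h1 h2 => ?_, ih.2⟩
      by_cases hc : c = i
      · rwa [hc]
      · exact ih.1 c h1 (by omega)

/-! ### Searching for an augmenting path -/

/-- Visit the predecessor of `x`, coming from `y`. -/
def visit : Cmd :=
  .z ::= get .p Var.x ;;
  .ite (get .vis Var.z) 1
    (.put .vis Var.z 1 ;; .put .par Var.z Var.y ;; .put .via Var.z Var.x ;;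
      .put .q Var.tail Var.z ;; .tail ::= Var.tail + 1)
    .skip

/-- Process the arcs of `y`. -/
def scanArcs : Cmd :=
  .loop 0 Var.ptr
    (.c ::= Var.ptr - 1 ;; .x ::= get .tgt Var.c ;;
      .ite 0 (get .inS Var.x)
        -- With truncated subtraction the sum of both differences is positive exactly when the two
        -- vertices differ. The variable `fin` holds a vertex plus one, so that 0 means that none
        -- was found.
        (.ite 0 ((Var.x - Var.v) + (Var.v - Var.x)) visit (.fin ::= Var.y + 1)) .skip ;;
      .ptr ::= get .next Var.c)

/-- Search from `u` for a vertex adjacent to `v` along alternating paths. -/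
def search : Cmd :=
  .for .x .n (.put .vis Var.x 0) ;;
  .put .vis Var.u 1 ;; .put .q 0 Var.u ;; .head ::= 0 ;; .tail ::= 1 ;; .fin ::= 0 ;;
  .loop Var.head Var.tail
    -- Visiting with x = y adds the predecessor of y itself: the alternating walk may step back
    -- along the path through y.
    (.y ::= get .q Var.head ;; .head ::= Var.head + 1 ;; .x ::= Var.y ;; visit ;;
      .ptr ::= get .first Var.y ;; scanArcs)

/-- The vertices in the queue. -/
def reached (s : Store) : Finset ℕ := (Finset.range (s.var .tail)).image (s.arr .q)

theorem mem_reached {s : Store} {x : ℕ} : x ∈ reached s ↔ ∃ i < s.var .tail, s.arr .q i = x := by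
  simp [reached]

/-- The state of the search. -/
structure SearchTree (P : Inst) (F : Finset ℕ) (u v : ℕ) (s : Store) : Prop where
  pos : 1 ≤ s.var .tail
  root : s.arr .q 0 = u
  inj : ∀ i < s.var .tail, ∀ j < s.var .tail, s.arr .q i = s.arr .q j → i = j
  mem : ∀ i < s.var .tail, s.arr .q i ∈ F.erase v
  vis : ∀ x < P.n, s.arr .vis x = if x ∈ reached s then 1 else 0
  via_mem : ∀ i, 1 ≤ i → i < s.var .tail → s.arr .via (s.arr .q i) ∈ F.erase v
  p_via : ∀ i, 1 ≤ i → i < s.var .tail → s.arr .p (s.arr .via (s.arr .q i)) = s.arr .q i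
  -- A queued vertex other than the root was found as the predecessor of `via`, coming from `par`.
  -- Parents stand earlier in the queue, so walking up ends at the root; along the way `via` can
  -- take the parent as its new predecessor.
  par : ∀ i, 1 ≤ i → i < s.var .tail → ∃ j < i, s.arr .par (s.arr .q i) = s.arr .q j ∧
    (s.arr .q j = s.arr .via (s.arr .q i) ∨ P.H.Adj (s.arr .q j) (s.arr .via (s.arr .q i)))
  fin : s.var .fin ≠ 0 → s.var .fin - 1 ∈ reached s ∧ P.H.Adj (s.var .fin - 1) v

/-- The search has advanced from `s` to `s'`. -/
structure Advance (s s' : Store) : Prop where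
  tail : s.var .tail ≤ s'.var .tail
  q : ∀ i < s.var .tail, s'.arr .q i = s.arr .q i
  fin : s.var .fin ≠ 0 → s'.var .fin ≠ 0

theorem Advance.refl (s : Store) : Advance s s := ⟨le_rfl, fun _ _ => rfl, id⟩

theorem Advance.trans {s s' s'' : Store} (h : Advance s s') (h' : Advance s' s'') :
    Advance s s'' :=
  ⟨h.tail.trans h'.tail, fun i hi => (h'.q i (hi.trans_le h.tail)).trans (h.q i hi),
    fun hf => h'.fin (h.fin hf)⟩

theorem Advance.reached {s s' : Store} (h : Advance s s') : reached s ⊆ reached s' := by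
  intro x hx
  obtain ⟨i, hi, rfl⟩ := mem_reached.1 hx
  exact mem_reached.2 ⟨i, hi.trans_le h.tail, h.q i hi⟩

variable {P : Inst} {F : Finset ℕ} {u v : ℕ}

theorem SearchTree.congr {s s' : Store} (h : SearchTree P F u v s)
    (hv : ∀ x ∈ [Var.tail, .fin], s'.var x = s.var x)
    (ha : ∀ b ∈ [Arr.q, .vis, .via, .p, .par], s'.arr b = s.arr b) : SearchTree P F u v s' := by
  have h1 := hv .tail (by decide)
  have h2 := hv .fin (by decide)
  have h3 := ha .q (by decide)
  have h4 := ha .vis (by decide)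
  have h5 := ha .via (by decide)
  have h6 := ha .p (by decide)
  have h7 := ha .par (by decide)
  have h8 : WellConnectedClub.reached s' = WellConnectedClub.reached s := by
    rw [WellConnectedClub.reached, h1, h3, WellConnectedClub.reached]
  constructor <;> simp only [h1, h2, h3, h4, h5, h6, h7, h8]
  exacts [h.pos, h.root, h.inj, h.mem, h.vis, h.via_mem, h.p_via, h.par, h.fin]

theorem SearchTree.reached_subset {s : Store} (h : SearchTree P F u v s) :
    reached s ⊆ F.erase v := by
  intro x hx
  obtain ⟨i, hi, rfl⟩ := mem_reached.1 hx
  exact h.mem i hi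

theorem SearchTree.card_reached {s : Store} (h : SearchTree P F u v s) :
    (reached s).card = s.var .tail := by
  rw [reached, Finset.card_image_of_injOn, Finset.card_range]
  intro i hi j hj
  exact h.inj i (by simpa using hi) j (by simpa using hj)

/-- At most the vertex `p x` enters the queue, with the parent y already in it; all clauses about
older entries are untouched because the new vertex differs from them. -/
theorem runs_visit {s : Store} (h : SearchTree P F u v s) (hFn : F ⊆ Finset.range P.n)
    (hp : ∀ x ∈ F.erase v, s.arr .p x ∈ F.erase v) (hx : s.var .x ∈ F.erase v)
    (hy : s.var .y ∈ reached s) (he : s.var .y = s.var .x ∨ P.H.Adj (s.var .y) (s.var .x)) :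
    Runs P.M P.B visit s fun T s' => T ≤ 7 ∧ SearchTree P F u v s' ∧ Advance s s' ∧
      s.arr .p (s.var .x) ∈ reached s' := by
  have hB := P.le_B
  have hlt : ∀ x ∈ F.erase v, x < P.n := fun x hx => by
    simpa using hFn (Finset.mem_of_mem_erase hx)
  have hxn := hlt _ hx
  have hz := hp _ hx
  have hzn := hlt _ hz
  set z := s.arr .p (s.var .x) with hzdef
  -- Queue entries are distinct vertices, so the write at the end of the queue stays within bounds.
  have htail : s.var .tail ≤ P.n := by
    rw [← h.card_reached]
    simpa using Finset.card_le_card (h.reached_subset.trans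
      ((Finset.erase_subset _ _).trans hFn))
  simp [visit, ← hzdef]
  refine ⟨by omega, ⟨by omega, by omega⟩, ?_, ?_⟩
  · intro h0
    have hnot : z ∉ reached s := by
      intro hm
      rw [h.vis z hzn, if_pos hm] at h0
      omega
    have hq : ∀ i < s.var .tail, s.arr .q i ≠ z := fun i hi e => hnot (mem_reached.2 ⟨i, hi, e⟩)
    refine ⟨⟨by omega, by omega⟩, by omega, by omega, ⟨by omega, by omega⟩, ?_, ?_, ?_⟩
    · have hreach : ∀ x, x ∈ reached ((((((s.set Var.z z).put Arr.vis z 1).put Arr.par z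
          (s.var Var.y)).put Arr.via z (s.var Var.x)).put Arr.q (s.var Var.tail) z).set Var.tail
          (s.var Var.tail + 1)) ↔ x = z ∨ x ∈ reached s := by
        intro x
        simp only [mem_reached]
        simp
        constructor
        · rintro ⟨i, hi, rfl⟩
          by_cases hit : i = s.var .tail
          · simp [hit]
          · exact .inr ⟨i, by omega, by rw [Function.update_of_ne hit]⟩
        · rintro (rfl | ⟨i, hi, rfl⟩)
          · exact ⟨s.var .tail, by omega, by simp⟩
          · exact ⟨i, by omega, by rw [Function.update_of_ne (by omega)]⟩
      have hcase : ∀ i ≤ s.var .tail, (i = s.var .tail) ∨ (i < s.var .tail ∧ i ≠ s.var .tail) :=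
        fun i hi => by omega
      constructor
      · simp
      · have := h.pos
        simp [Function.update_of_ne (show (0 : ℕ) ≠ s.var .tail by omega), h.root]
      · simp
        intro i hi j hj
        rcases hcase i hi with rfl | ⟨hi', hi⟩ <;> rcases hcase j hj with rfl | ⟨hj', hj⟩
        · simp
        · simp [hj]
          exact fun e => absurd e.symm (hq j hj')
        · simp [hi]
          exact fun e => absurd e (hq i hi')
        · simp [hi, hj]
          exact h.inj i hi' j hj'
      · simp only [Store.set_var, Store.set_arr, Store.put_var, Store.put_arr]
        simp
        intro i hi
        rcases hcase i hi with rfl | ⟨hi', hi⟩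
        · simpa using hz
        · simpa [hi] using h.mem i hi'
      · intro x hxn
        simp only [hreach]
        simp [Function.update_apply]
        by_cases hxz : x = z
        · simp [hxz]
        · simp [hxz, h.vis x hxn]
      · simp
        intro i hi1 hi
        rcases hcase i hi with rfl | ⟨hi', hi⟩
        · simpa using hx
        · simpa [hi, hq i hi'] using h.via_mem i hi1 hi'
      · simp
        intro i hi1 hi
        rcases hcase i hi with rfl | ⟨hi', hi⟩
        · simp [← hzdef]
        · simpa [hi, hq i hi'] using h.p_via i hi1 hi'
      · simp
        intro i hi1 hi
        rcases hcase i hi with rfl | ⟨hi', hi⟩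
        · obtain ⟨j, hj, hj'⟩ := mem_reached.1 hy
          refine ⟨j, hj, ?_⟩
          simp [(show j ≠ s.var .tail by omega), hj', he]
        · obtain ⟨j, hj, hj'⟩ := h.par i hi1 hi'
          refine ⟨j, hj, ?_⟩
          simpa [hi, hq i hi', (show j ≠ s.var .tail by omega)] using hj'
      · simp only [hreach]
        simp
        exact fun hf => ⟨.inr (h.fin hf).1, (h.fin hf).2⟩
    · refine ⟨by simp, fun i hi => ?_, by simp⟩
      simp [(show i ≠ s.var .tail by omega)]
    · exact mem_reached.2 ⟨s.var .tail, by simp, by simp⟩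
  · intro h0
    have hin : z ∈ reached s := by
      by_contra hm
      rw [h.vis z hzn, if_neg hm] at h0
      omega
    refine ⟨h.congr (by simp) (by simp), ⟨by simp, by simp, by simp⟩, ?_⟩
    simpa [reached] using hin

end

/-! ### Closure of the reached set and linear running time of the search -/

section

variable {P : Inst} {F : Finset ℕ} {u v : ℕ}

/-- The neighbour `x` of a processed vertex has been taken care of. -/
def Handled (v : ℕ) (s : Store) (x : ℕ) : Prop :=
  (x = v → s.var .fin ≠ 0) ∧ (x ≠ v → s.arr .p x ∈ reached s)

theorem Handled.advance {s s' : Store} {x : ℕ} (h : Handled v s x) (ha : Advance s s')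
    (hp : s'.arr .p = s.arr .p) : Handled v s' x :=
  ⟨fun e => ha.fin (h.1 e), fun e => hp ▸ ha.reached (h.2 e)⟩

theorem Advance.of_eq {s s' : Store} (h1 : s'.var .tail = s.var .tail)
    (h2 : s'.var .fin = s.var .fin) (h3 : s'.arr .q = s.arr .q) : Advance s s' :=
  ⟨h1.ge, fun _ _ => by rw [h3], fun h => by rwa [h2]⟩

/-- The invariant is that the arcs of y numbered `i` or higher have been handled and that the
pointer is the last arc below `i`. The potential counts the arcs of y below the pointer, so the time
is proportional to the out-degree. -/
theorem runs_scanArcs {s : Store} (hR : Ready P s) (hS : Holds F s) (h : SearchTree P F u v s)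
    (hFn : F ⊆ Finset.range P.n) (hp : ∀ x ∈ F.erase v, s.arr .p x ∈ F.erase v)
    (hv : s.var .v = v) (hvF : v ∈ F) (hy : s.var .y ∈ reached s)
    (hptr : s.var .ptr = lastArc P.σ P.M (s.var .y)) :
    Runs P.M P.B scanArcs s fun T s' => T ≤ 20 * outArcs P.σ P.M (s.var .y) + 1 ∧
      SearchTree P F u v s' ∧ Advance s s' ∧
      ∀ x ∈ F, P.H.Adj (s.var .y) x → Handled v s' x := by
  have hB := P.le_B
  set y := s.var .y with hydef
  have hyn : y < P.n := by
    simpa using hFn (Finset.mem_of_mem_erase (h.reached_subset hy))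
  have hvn : v < P.n := by simpa using hFn hvF
  refine (Runs.loop (fun s' => SearchTree P F u v s' ∧ Advance s s' ∧
    ∃ i ≤ P.M, s'.var .ptr = lastArc P.σ i y ∧
      ∀ c, i ≤ c → c < P.M → P.σ c = y → P.τ c ∈ F → Handled v s' (P.τ c))
    (fun s' => 20 * outArcs P.σ (s'.var .ptr) y) ⟨h, .refl s, P.M, le_rfl, hptr,
      fun c h1 h2 => by omega⟩ (by simp) ?_).mono ?_
  · rintro s' ⟨hT, hA, i, hi, hpt, hH⟩ hF hlt
    simp at hlt
    obtain ⟨c, hc⟩ : ∃ c, s'.var .ptr = c + 1 := ⟨s'.var .ptr - 1, by omega⟩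
    have hle := lastArc_le P.σ i y
    have hcM : c < P.M := by omega
    have hσ : P.σ c = y := (lastArc_spec P.σ i y).2 c (by omega)
    have hR' := hR.frame hF (by decide) (by decide)
    have ev : s'.var .v = v := (hF.var .v (by decide)).trans hv
    have ey : s'.var .y = y := hF.var .y (by decide)
    have ep : s'.arr .p = s.arr .p := hF.arr .p (by decide)
    have eS : s'.arr .inS = s.arr .inS := hF.arr .inS (by decide)
    have etgt := hR'.tgt c hcM
    have hτn := P.head_lt c hcM
    have hadj := P.adj c hcM
    rw [hσ] at hadj
    have hx := hS (P.τ c)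
    -- The next pointer leaves out the arc `c` at least; this drop of the potential pays for the
    -- round.
    have hlow : outArcs P.σ (lastArc P.σ c y) y + 1 ≤ outArcs P.σ (c + 1) y := by
      have h1 := outArcs_succ P.σ c
      have h2 := outArcs_mono P.σ (lastArc_le P.σ c y) y
      rw [hσ] at h1
      omega
    have hfinal : ∀ s'' : Store, SearchTree P F u v s'' → Advance s' s'' →
        s''.arr .p = s'.arr .p → s''.var .ptr = lastArc P.σ c y →
        (P.τ c ∈ F → Handled v s'' (P.τ c)) →
        SearchTree P F u v s'' ∧ Advance s s'' ∧ ∃ i ≤ P.M, s''.var .ptr = lastArc P.σ i y ∧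
          ∀ c, i ≤ c → c < P.M → P.σ c = y → P.τ c ∈ F → Handled v s'' (P.τ c) := by
      intro s'' h1 h2 h3 h4 h5
      refine ⟨h1, hA.trans h2, c, hcM.le, h4, fun d hd1 hd2 hd3 hd4 => ?_⟩
      rcases eq_or_ne d c with rfl | hdc
      · exact h5 hd4
      · by_cases hdi : i ≤ d
        · exact (hH d hdi hd2 hd3 hd4).advance h2 h3
        · exact absurd hd3 ((lastArc_spec P.σ i y).1 d (by omega) (by omega))
    simp [hc, etgt, ev, ey, eS, hx]
    refine ⟨⟨by omega, by omega⟩, by omega, by omega, ?_, ?_⟩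
    · intro hpos
      have hxF : P.τ c ∈ F := by
        by_contra hxF
        simp [hxF] at hpos
      refine ⟨⟨by omega, by omega, by omega⟩, ?_, ?_⟩
      · intro hne
        have hxv : P.τ c ≠ v := by omega
        have hxF' : P.τ c ∈ F.erase v := Finset.mem_erase.2 ⟨hxv, hxF⟩
        refine Runs.mono (runs_visit (hT.congr (by simp) (by simp)) hFn (by simpa [ep] using hp)
          (by simpa using hxF') ?_ (by simpa [ey] using .inr hadj)) ?_
        · simpa [ey, reached] using hA.reached hy
        · rintro T s₁ hF₁ ⟨hT₁, h1, h2, h3⟩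
          have ec := hF₁.var .c (by decide)
          have enext := hF₁.arr .next (by decide)
          have ep₁ := hF₁.arr .p (by decide)
          simp at ec enext ep₁ h3
          have hnext : s₁.arr .next c = lastArc P.σ c y := by rw [enext, hR'.next c hcM, hσ]
          simp only [ec, hnext]
          refine ⟨by omega, hfinal _ (h1.congr (by simp) (by simp)) ?_ (by simp [ep₁])
            (by simp) ?_, by omega⟩
          · exact ((Advance.of_eq (by simp) (by simp) (by simp)).trans h2).trans
              (Advance.of_eq (by simp) (by simp) (by simp))
          · refine fun _ => ⟨fun e => absurd e hxv, fun _ => ?_⟩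
            simpa [reached, ep₁] using h3
      · intro heq
        have hxv : P.τ c = v := by omega
        have hnext : s'.arr .next c = lastArc P.σ c y := by rw [hR'.next c hcM, hσ]
        simp only [hnext]
        refine ⟨⟨by omega, by omega⟩, by omega, hfinal _ ?_ ⟨by simp, by simp, by simp⟩ (by simp)
          (by simp) ?_, by omega⟩
        · have key : SearchTree P F u v (s'.set .fin (y + 1)) := by
            refine ⟨hT.pos, hT.root, hT.inj, hT.mem, hT.vis, hT.via_mem, hT.p_via, hT.par, ?_⟩
            simp only [Store.set_var, if_true]
            exact fun _ => ⟨hA.reached hy, hxv ▸ hadj⟩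
          exact key.congr (by simp) (by simp)
        · exact fun _ => ⟨fun _ => by simp, fun e => absurd hxv e⟩
    · intro hxF
      have hnext : s'.arr .next c = lastArc P.σ c y := by rw [hR'.next c hcM, hσ]
      simp only [hnext]
      refine ⟨by omega, hfinal _ (hT.congr (by simp) (by simp)) ⟨by simp, by simp, by simp⟩
        (by simp) (by simp) (fun e => absurd e hxF), by omega⟩
  · rintro T s' hF ⟨⟨hT, hA, i, hi, hpt, hH⟩, h1, h2⟩
    simp at h1
    rw [h1] at hpt
    refine ⟨?_, hT, hA, ?_⟩
    · have := outArcs_mono P.σ (hptr.trans_le (lastArc_le _ _ _)) y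
      omega
    · intro x hx hyx
      obtain ⟨c, hc, h3, h4⟩ := P.exists_arc y x hyx
      by_cases hci : i ≤ c
      · exact h4 ▸ hH c hci hc h3 (h4.symm ▸ hx)
      · exact absurd h3 ((lastArc_spec P.σ i y).1 c (by omega) (by omega))

theorem runs_clear {b : Arr} {s : Store} (hn : s.var .n ≤ P.B) (hB : 1 ≤ P.B) :
    Runs P.M P.B (.for .x .n (.put b Var.x 0)) s fun T s' =>
      T ≤ 3 * s.var .n + 2 ∧ ∀ x < s.var .n, s'.arr b x = 0 := by
  refine (Runs.for (fun j s' => ∀ x < j, s'.arr b x = 0) 1 (by simp [Cmd.vars])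
    (by simp [Cmd.vars]) (by decide) hn hB (by simp) ?_).mono ?_
  · intro j s' hj hje hF hI
    simp [hje]
    refine ⟨by omega, fun x hx => ?_⟩
    rw [Function.update_apply]
    split_ifs
    exacts [rfl, hI x (by omega)]
  · rintro T s' _ ⟨h1, h2⟩
    exact ⟨h2, h1⟩

/-- All vertices in front of the queue's head have been handled. When the queue is exhausted, the
reached set therefore has the closure properties that `Linkage.separated` asks for, unless a
neighbour of v was found. -/
theorem runs_search {s : Store} (hR : Ready P s) (hS : Holds F s)
    (hFn : F ⊆ Finset.range P.n) (hp : ∀ x ∈ F.erase v, s.arr .p x ∈ F.erase v)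
    (hu : s.var .u = u) (hv : s.var .v = v) (huF : u ∈ F) (hvF : v ∈ F) (huv : u ≠ v) :
    Runs P.M P.B search s fun T s' => T ≤ 20 * P.M + 33 * P.n + 10 ∧
      SearchTree P F u v s' ∧ ∀ y ∈ reached s', s'.arr .p y ∈ reached s' ∧
        ∀ x ∈ F, P.H.Adj y x → Handled v s' x := by
  have hB := P.le_B
  have hun : u < P.n := by simpa using hFn huF
  have hn := hR.n
  rw [search, runs_seq]
  refine (runs_clear (by omega) (by omega)).mono ?_
  rintro T₀ s₀ hF₀ ⟨hT₀, hvis₀⟩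
  have hR₀ := hR.frame hF₀ (by decide) (by decide)
  have hS₀ : Holds F s₀ := by rwa [Holds, hF₀.arr .inS (by decide)]
  have ep₀ := hF₀.arr .p (by decide)
  have eu₀ := hF₀.var .u (by decide)
  have ev₀ := hF₀.var .v (by decide)
  simp only [runs_seq, runs_set, runs_put]
  simp [eu₀, hu]
  refine ⟨⟨by omega, by omega⟩, by omega, ?_⟩
  set s₁ := ((((s₀.put Arr.vis u 1).put Arr.q 0 u).set Var.head 0).set Var.tail 1).set Var.fin 0
    with hs₁
  have hreach : ∀ x, x ∈ reached s₁ ↔ x = u := by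
    intro x
    simp [mem_reached, hs₁, eq_comm]
  have hTree : SearchTree P F u v s₁ := by
    refine ⟨by simp [hs₁], by simp [hs₁], ?_, ?_, ?_, ?_, ?_, ?_, by simp [hs₁]⟩
    · simp [hs₁]
    · simp [hs₁, huv, huF]
    · intro x hx
      simp only [hreach]
      simp [hs₁, Function.update_apply, hvis₀ x (by omega)]
    · simp [hs₁]; omega
    · simp [hs₁]; omega
    · simp [hs₁]; omega
  have hR₁ : Ready P s₁ := hR₀.congr (by simp [hs₁]) (by simp [hs₁])
  have hS₁ : Holds F s₁ := by simpa [Holds, hs₁] using hS₀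
  have hp₁ : ∀ x ∈ F.erase v, s₁.arr .p x ∈ F.erase v := by simpa [hs₁, ep₀] using hp
  have hv₁ : s₁.var .v = v := by simpa [hs₁, ev₀] using hv
  have hh₁ : s₁.var .head = 0 := by simp [hs₁]
  clear_value s₁
  refine (Runs.loop (fun s' => SearchTree P F u v s' ∧ s'.var .head ≤ s'.var .tail ∧
    ∀ i < s'.var .head, s'.arr .p (s'.arr .q i) ∈ reached s' ∧
      ∀ x ∈ F, P.H.Adj (s'.arr .q i) x → Handled v s' x)
    -- Each unprocessed vertex holds credit for its own round. Queue entries are distinct, so a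
    -- round removes exactly one summand.
    (fun s' => ∑ y ∈ Finset.range P.n \ (Finset.range (s'.var .head)).image (s'.arr .q),
      (20 * outArcs P.σ P.M y + 30)) ⟨hTree, by omega, by simp [hh₁]⟩ (by simp) ?_).mono ?_
  · rintro s' ⟨hT, hle, hcl⟩ hF hlt
    simp at hlt
    have hR' := hR₁.frame hF (by decide) (by decide)
    have hS' : Holds F s' := by rwa [Holds, hF.arr .inS (by decide)]
    have ep' := hF.arr .p (by decide)
    have ev' := hF.var .v (by decide)
    have htail : s'.var .tail ≤ P.n := by
      rw [← hT.card_reached]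
      simpa using Finset.card_le_card (hT.reached_subset.trans
        ((Finset.erase_subset _ _).trans hFn))
    set h := s'.var .head with hhead
    set y := s'.arr .q h with hydef
    have hy : y ∈ reached s' := mem_reached.2 ⟨h, hlt, rfl⟩
    have hyF := hT.reached_subset hy
    have hyn : y < P.n := by simpa using hFn (Finset.mem_of_mem_erase hyF)
    rw [runs_seq, runs_set, runs_seq, runs_set, runs_seq, runs_set, runs_seq]
    simp [← hhead, ← hydef]
    refine ⟨by omega, ⟨by omega, by omega⟩, ?_⟩
    refine Runs.mono (runs_visit (hT.congr (by simp) (by simp)) hFn (by simpa [ep'] using hp₁)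
      (by simpa using hyF) (by simpa [reached] using hy) (by simp)) ?_
    rintro T₂ s₂ hF₂ ⟨hT₂, h1, h2, h3⟩
    have hR₂ := (hR'.congr (by simp) (by simp)).frame hF₂ (by decide) (by decide)
    have ep₂ := hF₂.arr .p (by decide)
    have ev₂ := hF₂.var .v (by decide)
    have ey₂ := hF₂.var .y (by decide)
    have eh₂ := hF₂.var .head (by decide)
    have eS₂ := hF₂.arr .inS (by decide)
    simp at ep₂ ev₂ ey₂ eh₂ eS₂ h3
    have hA₂ : Advance s' s₂ := (Advance.of_eq (by simp) (by simp) (by simp)).trans h2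
    simp [ey₂]
    refine ⟨by omega, ?_⟩
    refine Runs.mono (runs_scanArcs (F := F) (u := u) (v := v) (hR₂.congr (by simp) (by simp))
      (by simpa [Holds, eS₂] using hS') (h1.congr (by simp) (by simp)) hFn
      (by simpa [ep₂, ep'] using hp₁) (by simp [ev₂, ev', hv₁]) hvF
      (by simpa [ey₂, reached] using hA₂.reached hy) (by simp [ey₂, hR₂.first])) ?_
    rintro T₃ s₃ hF₃ ⟨hT₃, h4, h5, h6⟩
    have ep₃ := hF₃.arr .p (by decide)
    have eh₃ := hF₃.var .head (by decide)
    simp [eh₂, ep₂] at ep₃ eh₃ hT₃ h6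
    rw [ey₂] at hT₃ h6
    have hA₃ : Advance s₂ s₃ := (Advance.of_eq (by simp) (by simp) (by simp)).trans h5
    have hA := hA₂.trans hA₃
    have hq : ∀ i < h + 1, s₃.arr .q i = s'.arr .q i := fun i hi => hA.q i (by omega)
    refine ⟨⟨h4, ?_, ?_⟩, ?_⟩
    · have := hA.tail
      omega
    · intro i hi
      rw [eh₃] at hi
      rw [hq i hi, ep₃]
      rcases Nat.lt_succ_iff_lt_or_eq.1 hi with hi | rfl
      · exact ⟨hA.reached (hcl i hi).1, fun x hx hxy => ((hcl i hi).2 x hx hxy).advance hA ep₃⟩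
      · exact ⟨hA₃.reached h3, h6⟩
    · have himg : (Finset.range (s₃.var .head)).image (s₃.arr .q) =
          insert y ((Finset.range h).image (s'.arr .q)) := by
        rw [eh₃, Finset.range_add_one, Finset.image_insert, hq h (by omega)]
        congr 1
        exact Finset.image_congr fun i hi => hq i (by
          have : i < h := by simpa using hi
          omega)
      have hnot : y ∉ (Finset.range h).image (s'.arr .q) := by
        intro hm
        obtain ⟨i, hi, e⟩ := Finset.mem_image.1 hm
        have hi' : i < h := by simpa using hi
        have := hT.inj i (by omega) h hlt e
        omega
      rw [himg, Finset.sdiff_insert]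
      have := Finset.add_sum_erase (Finset.range P.n \ (Finset.range h).image (s'.arr .q))
        (fun y => 20 * outArcs P.σ P.M y + 30) (a := y)
        (Finset.mem_sdiff.2 ⟨by simpa using hyn, hnot⟩)
      omega
  · rintro T s' hF ⟨⟨hT, hle, hcl⟩, h1, h2⟩
    simp at h1
    refine ⟨?_, hT, ?_⟩
    · have hsum : ∑ y ∈ Finset.range P.n, (20 * outArcs P.σ P.M y + 30) =
          20 * P.M + 30 * P.n := by
        rw [Finset.sum_add_distrib, ← Finset.mul_sum, sum_outArcs]
        simp [mul_comm]
      rw [hh₁] at h2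
      simp only [Finset.range_zero, Finset.image_empty, Finset.sdiff_empty, hsum] at h2
      omega
    · intro y hy
      obtain ⟨i, hi, rfl⟩ := mem_reached.1 hy
      exact hcl i (by omega)

end

section

variable {P : Inst} {F : Finset ℕ} {u v : ℕ}

/-! ### Testing whether two vertices are separated -/

/-- Augment along the path found by the search. -/
def augment : Cmd :=
  .y ::= Var.fin - 1 ;;
  .loop 0 ((Var.y - Var.u) + (Var.u - Var.y))
    (.x ::= get .via Var.y ;; .y ::= get .par Var.y ;; .put .p Var.x Var.y)

/-- Set `ok` to a positive number if `u` and `v` are not separated by fewer than `tc` vertices, and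
to `0` otherwise. -/
def flow : Cmd :=
  .for .x .n (.put .p Var.x Var.x) ;; .ok ::= 1 ;;
  .for .i .tc (.ite 0 Var.ok (search ;; .ite 0 Var.fin augment (.ok ::= 0)) .skip)

/-- The walk goes from the found neighbour of v up to the root. `Linkage.release` frees the first
`via`, each further step is a `Linkage.shift` that moves the one exempted vertex upwards, and
reaching u is a `Linkage.attach`, which gains a path. -/
theorem runs_augment {s : Store} {c : ℕ} (hT : SearchTree P F u v s)
    (hL : Linkage P.H F u v (F.erase v) (s.arr .p) c) (hFn : F ⊆ Finset.range P.n)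
    (hu : s.var .u = u) (hadj : ¬ P.H.Adj u v) (hfin : s.var .fin ≠ 0) :
    Runs P.M P.B augment s fun T s' => T ≤ 4 * P.n + 2 ∧
      Linkage P.H F u v (F.erase v) (s'.arr .p) (c + 1) := by
  have hB := P.le_B
  have hlt : ∀ i < s.var .tail, s.arr .q i < P.n := fun i hi => by
    simpa using hFn (Finset.mem_of_mem_erase (hT.mem i hi))
  have htail : s.var .tail ≤ P.n := by
    rw [← hT.card_reached]
    simpa using Finset.card_le_card (hT.reached_subset.trans
      ((Finset.erase_subset _ _).trans hFn))
  have hun : u < P.n := hT.root ▸ hlt 0 hT.pos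
  -- The position in the queue, as a function of the vertex, serves as potential because parents
  -- have smaller positions.
  obtain ⟨f, hf⟩ : ∃ f : ℕ → ℕ, ∀ i < s.var .tail, f (s.arr .q i) = i := by
    refine ⟨Function.invFunOn (s.arr .q) {i | i < s.var .tail}, fun i hi => ?_⟩
    have hex : ∃ a ∈ {i | i < s.var .tail}, s.arr .q a = s.arr .q i := ⟨i, hi, rfl⟩
    exact hT.inj _ (Function.invFunOn_mem hex) i hi (Function.invFunOn_eq hex)
  obtain ⟨hy, hyv⟩ := hT.fin hfin
  obtain ⟨i₀, hi₀, hq₀⟩ := mem_reached.1 hy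
  -- The vertex found is not the root, as u is not adjacent to v.
  have hi₀pos : 1 ≤ i₀ := by
    rcases Nat.eq_zero_or_pos i₀ with rfl | h
    · rw [hT.root] at hq₀
      exact absurd (hq₀ ▸ hyv) hadj
    · exact h
  have hne : ∀ i, 1 ≤ i → i < s.var .tail → s.arr .q i ≠ u := fun i h1 h2 e => by
    have := hT.inj i h2 0 hT.pos (e.trans hT.root.symm)
    omega
  rw [augment, runs_seq, runs_set]
  simp
  have := hlt i₀ hi₀
  refine ⟨⟨by omega, by omega⟩, ?_⟩
  -- The last clause says that the predecessors still needed above the current position have not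
  -- been overwritten.
  refine (Runs.loop (fun s' => ∃ i < s.var .tail, s'.var .y = s.arr .q i ∧
    (i = 0 → Linkage P.H F u v (F.erase v) (s'.arr .p) (c + 1)) ∧
    (1 ≤ i → Linkage P.H F u v ((F.erase v).erase (s.arr .via (s.arr .q i))) (s'.arr .p) c) ∧
    ∀ j, 1 ≤ j → j ≤ i → s'.arr .p (s.arr .via (s.arr .q j)) = s.arr .q j)
    (fun s' => 4 * f (s'.var .y)) ?_ ?_ ?_).mono ?_
  · refine ⟨i₀, hi₀, by simp [hq₀], by omega, fun _ => ?_, fun j h1 h2 => ?_⟩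
    · refine hL.release ?_ ?_
      · rw [hT.p_via i₀ hi₀pos hi₀]
        exact hne i₀ hi₀pos hi₀
      · rw [hT.p_via i₀ hi₀pos hi₀, hq₀]
        exact hyv
    · exact hT.p_via j h1 (by omega)
  · rintro s' ⟨i, hi, hy, -⟩ hF
    have eu := hF.var .u (by decide)
    have := hlt i hi
    simp [hy, eu, hu]
    omega
  · rintro s' ⟨i, hi, hy, -, hlink, hp⟩ hF hpos
    have eu := hF.var .u (by decide)
    have evia := hF.arr .via (by decide)
    have epar := hF.arr .par (by decide)
    simp at eu evia epar
    simp [hy, eu, hu] at hpos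
    have hi1 : 1 ≤ i := by
      rcases Nat.eq_zero_or_pos i with rfl | h
      · rw [hT.root] at hpos
        omega
      · exact h
    obtain ⟨j, hj, hpar, hedge⟩ := hT.par i hi1 hi
    have hvia := hT.via_mem i hi1 hi
    have hvian : s.arr .via (s.arr .q i) < P.n := by
      simpa using hFn (Finset.mem_of_mem_erase hvia)
    have := hlt i hi
    have hjt : j < s.var .tail := by omega
    -- Vertices `via` of different queue entries differ because their predecessors, the entries
    -- themselves, differ.
    have hdist : ∀ l, 1 ≤ l → l < i → s.arr .via (s.arr .q l) ≠ s.arr .via (s.arr .q i) := by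
      intro l h1 h2 e
      have h3 := hp l h1 h2.le
      rw [e, hp i hi1 le_rfl] at h3
      have := hT.inj i hi l (by omega) h3
      omega
    have hlink := hlink hi1
    simp [hy, evia, epar, hpar]
    refine ⟨by omega, by omega, ⟨j, hjt, rfl, ?_, ?_, ?_⟩, ?_⟩
    · rintro rfl
      rw [hT.root] at hedge ⊢
      exact hlink.attach hvia (hT.root ▸ hT.mem 0 hT.pos) hedge
    · intro hj1
      have h1 := hp j hj1 hj.le
      have := hlink.shift (x' := s.arr .via (s.arr .q j)) hvia (hT.via_mem j hj1 hjt)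
        (hdist j hj1 hj) (by rw [h1]; exact hne j hj1 hjt) (by rwa [h1])
      rwa [h1] at this
    · intro l h1 h2
      rw [Function.update_of_ne (hdist l h1 (by omega)), hp l h1 (by omega)]
    · rw [hf j hjt, hf i hi]
      omega
  · rintro T s' hF ⟨⟨i, hi, hy, h0, -, -⟩, h1, h2⟩
    have eu := hF.var .u (by decide)
    simp at eu
    simp [hy, eu, hu] at h1 h2
    rw [← hq₀, hf i₀ hi₀] at h2
    refine ⟨by omega, h0 ?_⟩
    by_contra hi0
    exact hne i (by omega) hi (by omega)

/-- While `ok` is positive, every round adds a path, so `tc` rounds yield a linkage that excludes a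
separator. The first failed search yields a separator with at most as many vertices as there are
paths, which is fewer than `tc`. -/
theorem runs_flow {s : Store} (hR : Ready P s) (hS : Holds F s) (hFn : F ⊆ Finset.range P.n)
    (hu : s.var .u = u) (hv : s.var .v = v) (huF : u ∈ F) (hvF : v ∈ F) (huv : u ≠ v)
    (hadj : ¬ P.H.Adj u v) :
    Runs P.M P.B flow s fun T s' => T ≤ (20 * P.M + 37 * P.n + 20) * P.tc + 3 * P.n + 5 ∧
      (s'.var .ok = 0 → Separated P.H F P.tc u v) ∧
      (s'.var .ok ≠ 0 → ¬ Separated P.H F P.tc u v) := by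
  have hB := P.le_B
  have hn := hR.n
  rw [flow, runs_seq]
  have hinit : Runs P.M P.B (.for .x .n (.put .p Var.x Var.x)) s fun T s' =>
      T ≤ 3 * P.n + 2 ∧ ∀ x < P.n, s'.arr .p x = x := by
    refine (Runs.for (fun j s' => ∀ x < j, s'.arr .p x = x) 1 (by decide) (by decide) (by decide)
      (by omega) (by omega) (by simp) ?_).mono ?_
    · intro j s' hj hje hF hI
      simp [hje]
      refine ⟨by omega, fun x hx => ?_⟩
      rw [Function.update_apply]
      split_ifs with h
      exacts [h.symm, hI x (by omega)]
    · rintro T s' _ ⟨h1, h2⟩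
      rw [hn] at h1 h2
      exact ⟨h2, h1⟩
  refine hinit.mono ?_
  rintro T₀ s₀ hF₀ ⟨hT₀, hp₀⟩
  have hR₀ := hR.frame hF₀ (by decide) (by decide)
  have eS₀ := hF₀.arr .inS (by decide)
  have eu₀ := hF₀.var .u (by decide)
  have ev₀ := hF₀.var .v (by decide)
  rw [runs_seq, runs_set]
  simp
  refine ⟨by omega, ?_⟩
  refine (Runs.for (fun j s' => (s'.var .ok ≠ 0 → Linkage P.H F u v (F.erase v) (s'.arr .p) j) ∧
    (s'.var .ok = 0 → Separated P.H F P.tc u v)) (20 * P.M + 37 * P.n + 18) (by decide)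
    (by decide) (by decide) (by simp [hR₀.tc]; omega) (by omega) ?_ ?_).mono ?_
  · simp
    exact .init huF huv fun x hx => hp₀ x (by simpa using hFn hx)
  · rintro j s₁ hj hji hF₁ ⟨h1, h2⟩
    have hR₁ : Ready P s₁ := (hR₀.congr (by simp) (by simp)).frame hF₁ (by decide) (by decide)
    have eS₁ := hF₁.arr .inS (by decide)
    have eu₁ := hF₁.var .u (by decide)
    have ev₁ := hF₁.var .v (by decide)
    simp at eS₁ eu₁ ev₁
    have hS₁ : Holds F s₁ := by rwa [Holds, eS₁, eS₀]
    rw [runs_ite]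
    simp
    refine ⟨fun hok => ?_, fun hok => ⟨fun h => absurd hok h, h2⟩⟩
    have hL := h1 (by omega)
    refine (runs_search hR₁ hS₁ hFn hL.maps (by rw [eu₁, eu₀, hu]) (by rw [ev₁, ev₀, hv]) huF hvF
      huv).mono ?_
    rintro T₂ s₂ hF₂ ⟨hT₂, h3, h4⟩
    have ep₂ := hF₂.arr .p (by decide)
    have eu₂ := hF₂.var .u (by decide)
    have eok₂ := hF₂.var .ok (by decide)
    refine ⟨fun hfin => ?_, fun hfin => ?_⟩
    · refine (runs_augment (c := j) h3 (by rwa [ep₂]) hFn (by rw [eu₂, eu₁, eu₀, hu]) hadj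
        (by omega)).mono ?_
      rintro T₃ s₃ hF₃ ⟨hT₃, h5⟩
      have eok₃ := hF₃.var .ok (by decide)
      exact ⟨by omega, fun _ => h5, fun h => by omega⟩
    · refine ⟨by omega, ?_⟩
      refine hL.separated (c' := P.tc) (R := reached s₂) ?_ h3.reached_subset
        (mem_reached.2 ⟨0, h3.pos, h3.root⟩) (fun y hy => ep₂ ▸ (h4 y hy).1) ?_ ?_
      · simpa [hR₀.tc] using hj
      · intro y hy x hx hyx
        exact ep₂ ▸ ((h4 y hy).2 x (Finset.mem_of_mem_erase hx) hyx).2 (Finset.ne_of_mem_erase hx)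
      · intro y hy hyv
        exact ((h4 y hy).2 v hvF hyv).1 rfl hfin
  · rintro T s' _ ⟨⟨h1, h2⟩, h3⟩
    simp [hR₀.tc] at h1 h3
    rw [show 20 * P.M + 37 * P.n + 18 + 2 = 20 * P.M + 37 * P.n + 20 from rfl] at h3
    exact ⟨by omega, h2, fun h => (h1 h).not_separated hvF⟩

end

section

variable {P : Inst} {F : Finset ℕ} {u v : ℕ}

/-! ### Searching for a bad pair -/

/-- Mark the neighbours of `u` in the current set. -/
def markNeighbours : Cmd :=
  .for .x .n (.put .mark Var.x 0) ;;
  .for .e .mm (.a ::= get .src Var.e ;; .b ::= get .tgt Var.e ;;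
    -- The sum of both truncated differences is below 1 exactly when a = u.
    .ite ((Var.a - Var.u) + (Var.u - Var.a)) 1 (.put .mark Var.b (get .inS Var.b)) .skip)

/-- Count the marked neighbours of each vertex. -/
def countMarked : Cmd :=
  .for .x .n (.put .cnt Var.x 0) ;;
  .for .e .mm (.a ::= get .src Var.e ;; .b ::= get .tgt Var.e ;;
    .put .cnt Var.b (get .cnt Var.b + get .mark Var.a))

/-- Record that `u` and `v` form a bad pair. -/
def report : Cmd := .bad ::= 1 ;; .bu ::= Var.u ;; .bv ::= Var.v

/-- Test whether `u` and `v` form a bad pair. -/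
def testPair : Cmd :=
  .ite (get .cnt Var.v + Var.w * get .mark Var.v) Var.th report
    -- Adjacent vertices are never separated, and a flow is computed only while fewer than `tc`
    -- sources have been used.
    (.ite (get .mark Var.v) 1 (.ite Var.sc Var.tc (flow ;; .ite Var.ok 1 report .skip) .skip) .skip)

/-- Test all pairs that contain `u`. -/
def testPairs : Cmd :=
  .for .v .n (.ite 0 (get .inS Var.v)
    (.ite 0 ((Var.v - Var.u) + (Var.u - Var.v)) testPair .skip) .skip)

/-- Search for a bad pair in the current set; separations are tested for the first `tc` vertices of
the set only. -/
def findBad : Cmd :=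
  .bad ::= 0 ;; .sc ::= 0 ;;
  .for .u .n (.ite 0 (get .inS Var.u)
    (markNeighbours ;; countMarked ;; testPairs ;; .ite Var.sc Var.tc (.sc ::= Var.sc + 1) .skip)
    .skip)

open Classical in
/-- The array `mark` is the indicator of the neighbours of `u` in `F`. -/
def Marked (P : Inst) (F : Finset ℕ) (u : ℕ) (s : Store) : Prop :=
  ∀ x < P.n, s.arr .mark x = if x ∈ F ∧ P.H.Adj u x then 1 else 0

theorem runs_markNeighbours {s : Store} (hR : Ready P s) (hS : Holds F s)
    (hu : s.var .u = u) (hun : u < P.n) :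
    Runs P.M P.B markNeighbours s fun T s' => T ≤ 6 * P.M + 3 * P.n + 4 ∧ Marked P F u s' := by
  classical
  have hB := P.le_B
  have hn := hR.n
  rw [markNeighbours, runs_seq]
  refine (runs_clear (by omega) (by omega)).mono ?_
  rintro T₀ s₀ hF₀ ⟨hT₀, h0⟩
  have hR₀ := hR.frame hF₀ (by decide) (by decide)
  have eS₀ := hF₀.arr .inS (by decide)
  have eu₀ := hF₀.var .u (by decide)
  have hmm := hR₀.mm
  refine (Runs.for (fun j s' => ∀ x < P.n, s'.arr .mark x =
    if x ∈ F ∧ ∃ c < j, P.σ c = u ∧ P.τ c = x then 1 else 0) 4 (by decide) (by decide) (by decide)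
    (by omega) (by omega) ?_ ?_).mono ?_
  · simp
    exact fun x hx => h0 x (by omega)
  · intro j s₁ hj hje hF₁ hI
    have hR₁ := hR₀.frame hF₁ (by decide) (by decide)
    have eS₁ := hF₁.arr .inS (by decide)
    have eu₁ := hF₁.var .u (by decide)
    have hjM : j < P.M := by omega
    have h1 := hR₁.src j hjM
    have h2 := hR₁.tgt j hjM
    have h3 := P.tail_lt j hjM
    have h4 := P.head_lt j hjM
    have hex : ∀ x, (∃ c < j + 1, P.σ c = u ∧ P.τ c = x) ↔
        (P.σ j = u ∧ P.τ j = x) ∨ ∃ c < j, P.σ c = u ∧ P.τ c = x := by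
      intro x
      constructor
      · rintro ⟨c, hc, h⟩
        rcases Nat.lt_succ_iff_lt_or_eq.1 hc with hc | rfl
        exacts [.inr ⟨c, hc, h⟩, .inl h]
      · rintro (h | ⟨c, hc, h⟩)
        exacts [⟨j, by omega, h⟩, ⟨c, by omega, h⟩]
    simp only [hex]
    simp [hje, h1, h2, eu₁, eu₀, hu, eS₁, eS₀, hS (P.τ j)]
    refine ⟨by omega, ⟨⟨by omega, by omega, by omega⟩, by omega⟩, ?_, ?_⟩
    · intro h5 h5'
      have h6 : P.σ j = u := by omega
      refine ⟨by omega, fun x hx => ?_⟩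
      rw [Function.update_apply]
      by_cases hxj : x = P.τ j
      · simp [hxj, h6]
      · simp [hxj, hI x hx, Ne.symm hxj]
    · intro h5 x hx
      have h6 : P.σ j ≠ u := by omega
      simp [hI x hx, h6]
  · rintro T s' _ ⟨h1, h2⟩
    rw [hmm] at h1 h2
    refine ⟨by omega, fun x hx => ?_⟩
    rw [h1 x hx]
    congr 1
    refine propext (and_congr_right fun _ => ⟨?_, P.exists_arc u x⟩)
    rintro ⟨c, hc, rfl, rfl⟩
    exact P.adj c hc

theorem runs_countMarked {s : Store} (hR : Ready P s) (hm : Marked P F u s) :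
    Runs P.M P.B countMarked s fun T s' => T ≤ 5 * P.M + 3 * P.n + 4 ∧
      ∀ x < P.n, s'.arr .cnt x = commonCount P.H F u x := by
  classical
  have hB := P.le_B
  have hn := hR.n
  rw [countMarked, runs_seq]
  refine (runs_clear (by omega) (by omega)).mono ?_
  rintro T₀ s₀ hF₀ ⟨hT₀, h0⟩
  have hR₀ := hR.frame hF₀ (by decide) (by decide)
  have em₀ := hF₀.arr .mark (by decide)
  have hmm := hR₀.mm
  let g : ℕ → ℕ → Finset ℕ := fun j x =>
    (Finset.range j).filter fun c => P.τ c = x ∧ P.σ c ∈ F ∧ P.H.Adj u (P.σ c)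
  refine (Runs.for (fun j s' => ∀ x < P.n, s'.arr .cnt x = (g j x).card) 3
    (by decide) (by decide) (by decide) (by omega) (by omega) ?_ ?_).mono ?_
  · simp [g]
    exact fun x hx => h0 x (by omega)
  · intro j s₁ hj hje hF₁ hI
    have hR₁ := hR₀.frame hF₁ (by decide) (by decide)
    have em₁ := hF₁.arr .mark (by decide)
    have hjM : j < P.M := by omega
    have h1 := hR₁.src j hjM
    have h2 := hR₁.tgt j hjM
    have h3 := P.tail_lt j hjM
    have h4 := P.head_lt j hjM
    have h5 := hm _ h3
    have h6 : (g j (P.τ j)).card ≤ j := by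
      simpa using Finset.card_filter_le (Finset.range j)
        (fun c => P.τ c = P.τ j ∧ P.σ c ∈ F ∧ P.H.Adj u (P.σ c))
    have h7 : (if P.σ j ∈ F ∧ P.H.Adj u (P.σ j) then 1 else 0) ≤ 1 := by split_ifs <;> omega
    simp [hje, h1, h2, em₁, em₀, h5, hI _ h4]
    refine ⟨by omega, ⟨⟨by omega, by omega, by omega⟩, by omega⟩, fun x hx => ?_⟩
    simp only [g]
    rw [Function.update_apply, Finset.range_add_one, Finset.filter_insert]
    by_cases hxj : x = P.τ j
    · subst hxj
      by_cases hc : P.σ j ∈ F ∧ P.H.Adj u (P.σ j)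
      · simp [hc]
      · simp [hc]
    · simp [hxj, Ne.symm hxj, hI x hx, g]
  · rintro T s' _ ⟨h1, h2⟩
    rw [hmm] at h1 h2
    refine ⟨by omega, fun x hx => ?_⟩
    rw [h1 x hx, commonCount]
    -- Common neighbours correspond to the counted arcs by taking tails; this is injective because
    -- no arc is listed twice.
    refine Finset.card_bij (fun c _ => P.σ c) ?_ ?_ ?_
    · intro c hc
      simp only [g, Finset.mem_filter, Finset.mem_range] at hc ⊢
      exact ⟨hc.2.2.1, hc.2.2.2, hc.2.1 ▸ P.adj c hc.1⟩
    · intro c hc d hd e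
      simp only [g, Finset.mem_filter, Finset.mem_range] at hc hd
      exact P.arc_inj c hc.1 d hd.1 e (hc.2.1.trans hd.2.1.symm)
    · intro y hy
      obtain ⟨h3, h4, h5⟩ := Finset.mem_filter.1 hy
      obtain ⟨c, hc, rfl, rfl⟩ := P.exists_arc y x h5
      exact ⟨c, by simpa [g] using ⟨hc, h3, h4⟩, rfl⟩

/-- A reported pair is a bad pair. -/
def ReportOk (P : Inst) (F : Finset ℕ) (s : Store) : Prop :=
  s.var .bad ≠ 0 → s.var .bu ∈ F ∧ s.var .bv ∈ F ∧ s.var .bu ≠ s.var .bv ∧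
    BadPair P.H P.w P.θ P.tc F (s.var .bu) (s.var .bv)

theorem ReportOk.congr {s s' : Store} (h : ReportOk P F s)
    (hv : ∀ x ∈ [Var.bad, .bu, .bv], s'.var x = s.var x) : ReportOk P F s' := by
  rw [ReportOk, hv _ (by decide), hv .bu (by decide), hv .bv (by decide)]
  exact h

theorem runs_report {s : Store} (hB : 1 ≤ P.B) (hu : s.var .u = u) (hv : s.var .v = v) (huF : u ∈ F)
    (hvF : v ∈ F) (huv : u ≠ v) (hbad : BadPair P.H P.w P.θ P.tc F u v) :
    Runs P.M P.B report s fun T s' => T ≤ 3 ∧ ReportOk P F s' ∧ s'.var .bad ≠ 0 := by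
  simp [report, hu, hv]
  exact ⟨hB, fun _ => by simpa using ⟨huF, hvF, huv, hbad⟩⟩

theorem not_separated_of_adj (hv : v ∈ F) {c : ℕ} (h : P.H.Adj u v) :
    ¬ Separated P.H F c u v := by
  rintro ⟨U, A, -, -, -, h1, h2, h3, h4⟩
  rcases h4 u h1 v hv h with h | h
  exacts [h2 h, h3 h]

/-- A bound on the running time of `flow`. -/
def flowTime (P : Inst) : ℕ := (20 * P.M + 37 * P.n + 20) * P.tc + 3 * P.n + 5

open Classical in
/-- `u` and `v` have sufficiently many common neighbours, and they are not separated if the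
number `sc` of previous sources is smaller than `tc`. -/
def PairOk (P : Inst) (F : Finset ℕ) (sc u v : ℕ) : Prop :=
  P.θ ≤ commonCount P.H F u v + P.w * (if P.H.Adj u v then 1 else 0) ∧
    (sc < P.tc → ¬ Separated P.H F P.tc u v)

theorem runs_testPair {s : Store} (hR : Ready P s) (hS : Holds F s) (hFn : F ⊆ Finset.range P.n)
    (hu : s.var .u = u) (hv : s.var .v = v) (huF : u ∈ F) (hvF : v ∈ F) (huv : u ≠ v)
    (hm : Marked P F u s) (hc : ∀ x < P.n, s.arr .cnt x = commonCount P.H F u x)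
    (hr : ReportOk P F s) :
    Runs P.M P.B testPair s fun T s' =>
      T ≤ 10 + (if s.var .sc < P.tc then flowTime P else 0) ∧ ReportOk P F s' ∧
        (s'.var .bad = 0 → s.var .bad = 0 ∧ PairOk P F (s.var .sc) u v) := by
  classical
  have hB := P.le_B
  have hvn : v < P.n := by simpa using hFn hvF
  have hw := hR.w
  have hth := hR.th
  have htc := hR.tc
  have h1 := hm v hvn
  simp only [hvF, true_and] at h1
  have h2 := hc v hvn
  have h3 : commonCount P.H F u v ≤ P.n := by
    refine (Finset.card_filter_le _ _).trans ?_
    simpa using Finset.card_le_card hFn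
  rw [testPair]
  simp only [runs_ite]
  simp [hw, hth, htc, h1, h2, hv]
  refine ⟨⟨by omega, by split_ifs <;> omega, by split_ifs <;> omega⟩, ?_, ?_⟩
  · intro h4
    refine (runs_report (F := F) (by omega) hu hv huF hvF huv (.inl (by simpa using h4))).mono ?_
    rintro T s' hF ⟨h5, h6, h7⟩
    exact ⟨by omega, h6, fun h => absurd h h7⟩
  · intro h4
    have h4' : P.θ ≤ commonCount P.H F u v + P.w * (if P.H.Adj u v then 1 else 0) := by
      simpa using h4
    refine ⟨⟨by omega, by omega⟩, ?_, ?_⟩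
    · intro hadj
      refine ⟨?_, ?_⟩
      · intro hsc
        refine (runs_flow hR hS hFn hu hv huF hvF huv hadj).mono ?_
        rintro T s' hF ⟨hT, h5, h6⟩
        have eu := hF.var .u (by decide)
        have ev := hF.var .v (by decide)
        have ebad := hF.var .bad (by decide)
        have ebu := hF.var .bu (by decide)
        have ebv := hF.var .bv (by decide)
        refine ⟨by omega, ?_, ?_⟩
        · intro hok
          refine (runs_report (F := F) (by omega) (eu.trans hu) (ev.trans hv) huF hvF huv
            (.inr (h5 hok))).mono ?_
          rintro T' s'' - ⟨h7, h8, h9⟩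
          rw [if_pos hsc, flowTime]
          exact ⟨by omega, h8, fun h => absurd h h9⟩
        · intro hok
          rw [if_pos hsc, flowTime]
          refine ⟨by omega, hr.congr (by simp [ebad, ebu, ebv]), fun h => ⟨by omega, h4', fun _ => h6 hok⟩⟩
      · intro hsc
        exact ⟨by omega, hr, fun h => ⟨h, h4', fun h => by omega⟩⟩
    · intro hadj
      exact ⟨by omega, hr, fun h => ⟨h, h4', fun _ => not_separated_of_adj hvF hadj⟩⟩

theorem runs_testPairs {s : Store} (hR : Ready P s) (hS : Holds F s) (hFn : F ⊆ Finset.range P.n)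
    (hu : s.var .u = u) (huF : u ∈ F) (hm : Marked P F u s)
    (hc : ∀ x < P.n, s.arr .cnt x = commonCount P.H F u x) (hr : ReportOk P F s) :
    Runs P.M P.B testPairs s fun T s' =>
      T ≤ (14 + (if s.var .sc < P.tc then flowTime P else 0)) * P.n + 2 ∧ ReportOk P F s' ∧
        (s'.var .bad = 0 → s.var .bad = 0 ∧
          ∀ v ∈ F, v ≠ u → PairOk P F (s.var .sc) u v) := by
  have hB := P.le_B
  have hn := hR.n
  have hun : u < P.n := by simpa using hFn huF
  set K := if s.var .sc < P.tc then flowTime P else 0 with hK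
  refine (Runs.for (fun j s' => ReportOk P F s' ∧ (s'.var .bad = 0 → s.var .bad = 0 ∧
    ∀ v < j, v ∈ F → v ≠ u → PairOk P F (s.var .sc) u v)) (12 + K) (by decide) (by decide)
    (by decide) (by omega) (by omega) ?_ ?_).mono ?_
  · exact ⟨hr.congr (by simp), by simp⟩
  · rintro j s₁ hj hjv hF₁ ⟨h1, h2⟩
    have hR₁ := hR.frame hF₁ (by decide) (by decide)
    have eS₁ := hF₁.arr .inS (by decide)
    have em₁ := hF₁.arr .mark (by decide)
    have ec₁ := hF₁.arr .cnt (by decide)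
    have eu₁ := hF₁.var .u (by decide)
    have esc₁ := hF₁.var .sc (by decide)
    have hS₁ : Holds F s₁ := by rwa [Holds, eS₁]
    simp only [runs_ite]
    simp [hjv, eu₁, hu, hS₁ j]
    refine ⟨by omega, ?_, ?_⟩
    · intro hpos
      have hjF : j ∈ F := by
        by_contra hjF
        simp [hjF] at hpos
      refine ⟨⟨by omega, by omega, by omega⟩, ?_, ?_⟩
      · intro hne
        refine (runs_testPair hR₁ hS₁ hFn (eu₁.trans hu) hjv huF hjF (by omega)
          (by rwa [Marked, em₁]) (by rwa [ec₁]) h1).mono ?_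
        rintro T s₂ hF₂ ⟨h3, h4, h5⟩
        rw [esc₁] at h3 h5
        rw [← hK] at h3
        refine ⟨by omega, h4.congr (by simp), fun hb => ?_⟩
        obtain ⟨h6, h7⟩ := h5 hb
        refine ⟨(h2 h6).1, fun v hv hvF hvu => ?_⟩
        rcases eq_or_ne v j with rfl | hvj
        · exact h7
        · exact (h2 h6).2 v (by omega) hvF hvu
      · intro heq
        refine ⟨by omega, h1.congr (by simp), fun hb => ⟨(h2 hb).1, fun v hv hvF hvu => ?_⟩⟩
        exact (h2 hb).2 v (by omega) hvF hvu
    · intro hjF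
      refine ⟨by omega, h1.congr (by simp), fun hb => ⟨(h2 hb).1, fun v hv hvF hvu => ?_⟩⟩
      have : v ≠ j := by
        rintro rfl
        exact hjF hvF
      exact (h2 hb).2 v (by omega) hvF hvu
  · rintro T s' _ ⟨⟨h1, h2⟩, h3⟩
    rw [hn] at h2 h3
    rw [show 12 + K + 2 = 14 + K by omega] at h3
    exact ⟨h3, h1, fun hb => ⟨(h2 hb).1, fun v hv hvu =>
      (h2 hb).2 v (by simpa using hFn hv) hv hvu⟩⟩

/-- A bound on the running time of `findBad`. -/
def findBadTime (P : Inst) : ℕ := (11 * P.M + 20 * P.n + 20) * P.n + 4 + P.tc * (flowTime P * P.n)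

/-- Only rounds with one of the first `tc` vertices as source are expensive; the potential holds
`flowTime P * P.n` for each source not yet used. The set `A` collects the sources, and until there
are `tc` of them it consists of all vertices of F passed so far. The hypothesis on F guarantees that
`tc` sources exist. -/
theorem runs_findBad {s : Store} (hR : Ready P s) (hS : Holds F s) (hFn : F ⊆ Finset.range P.n)
    (htc : P.tc ≤ F.card) :
    Runs P.M P.B findBad s fun T s' => T ≤ findBadTime P ∧ ReportOk P F s' ∧
      (s'.var .bad = 0 → IsClub P.H P.w P.θ P.tc F) := by
  classical
  have hB := P.le_B
  have hn := hR.n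
  rw [findBad, runs_seq, runs_set, runs_seq, runs_set]
  simp
  refine (Runs.for_potential (fun j s' => ReportOk P F s' ∧ s'.var .sc ≤ P.tc ∧ ∃ A ⊆ F,
    A.card = s'.var .sc ∧ (s'.var .sc < P.tc → A = F.filter (· < j)) ∧
    (s'.var .bad = 0 → (∀ u < j, u ∈ F → ∀ v ∈ F, v ≠ u → PairOk P F P.tc u v) ∧
      ∀ u ∈ A, ∀ v ∈ F, v ≠ u → ¬ Separated P.H F P.tc u v))
    (fun s' => (P.tc - s'.var .sc) * (flowTime P * P.n)) (11 * P.M + 20 * P.n + 15)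
    (by decide) (by decide) (by decide) (by simp; omega) (by omega) ?_ ?_).mono ?_
  · simp
    exact fun h => absurd (by simp) h
  · rintro j s₁ hj hju hF₁ ⟨hrep, hsc, A, hAF, hAc, hA, hbad⟩
    have hR₁ : Ready P s₁ := (hR.congr (by simp) (by simp)).frame hF₁ (by decide) (by decide)
    have eS₁ := hF₁.arr .inS (by decide)
    simp at eS₁ hj
    have hS₁ : Holds F s₁ := by rwa [Holds, eS₁]
    have hjn : j < P.n := by omega
    rw [runs_ite]
    simp [hju, hS₁ j]
    refine ⟨by omega, ?_, ?_⟩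
    · intro hpos
      have hjF : j ∈ F := by
        by_contra hjF
        simp [hjF] at hpos
      refine (runs_markNeighbours hR₁ hS₁ hju hjn).mono ?_
      rintro T₂ s₂ hF₂ ⟨hT₂, hm₂⟩
      have hR₂ := hR₁.frame hF₂ (by decide) (by decide)
      refine (runs_countMarked hR₂ hm₂).mono ?_
      rintro T₃ s₃ hF₃ ⟨hT₃, hc₃⟩
      have hR₃ := hR₂.frame hF₃ (by decide) (by decide)
      have eS₂ := hF₂.arr .inS (by decide)
      have eS₃ := hF₃.arr .inS (by decide)
      have em₃ := hF₃.arr .mark (by decide)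
      have eu₂ := hF₂.var .u (by decide)
      have eu₃ := hF₃.var .u (by decide)
      have ev : ∀ x ∈ [Var.bad, .bu, .bv, .sc], s₃.var x = s₁.var x := by
        intro x hx
        rw [hF₃.var x (by revert x; decide), hF₂.var x (by revert x; decide)]
      refine (runs_testPairs (u := j) hR₃ (by rwa [Holds, eS₃, eS₂]) hFn
        (by rw [eu₃, eu₂, hju]) hjF (by rwa [Marked, em₃]) hc₃
        (hrep.congr fun x hx => ev x (by revert x; decide))).mono ?_
      rintro T₄ s₄ hF₄ ⟨hT₄, hrep₄, hbad₄⟩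
      have hR₄ := hR₃.frame hF₄ (by decide) (by decide)
      have esc₄ := hF₄.var .sc (by decide)
      have htc₄ := hR₄.tc
      have esc := ev .sc (by decide)
      rw [ev .bad (by decide), esc] at hbad₄
      rw [esc] at hT₄
      simp [esc₄, esc, htc₄]
      -- With `P.tc` in place of the source count the second half of `PairOk` is void: only the
      -- common neighbours are recorded for all u.
      have hpair : s₄.var .bad = 0 → ∀ u ≤ j, u ∈ F → ∀ v ∈ F, v ≠ u →
          PairOk P F P.tc u v := by
        intro hb u hu huF v hvF hvu
        obtain ⟨h1, h2⟩ := hbad₄ hb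
        rcases eq_or_ne u j with rfl | huj
        · exact ⟨(h2 v hvF hvu).1, fun h => absurd h (lt_irrefl _)⟩
        · exact (hbad h1).1 u (by omega) huF v hvF hvu
      refine ⟨?_, ?_⟩
      · intro hlt
        have hAj := hA hlt
        refine ⟨⟨by omega, by omega⟩, ?_, hrep₄.congr (by simp), by omega, insert j A, ?_, ?_, ?_,
          fun hb => ⟨hpair hb, ?_⟩⟩
        · rw [if_pos hlt] at hT₄
          obtain ⟨r, hr⟩ : ∃ r, P.tc - s₁.var .sc = r + 1 := ⟨P.tc - s₁.var .sc - 1, by omega⟩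
          rw [hr, show P.tc - (s₁.var .sc + 1) = r by omega]
          nlinarith
        · exact Finset.insert_subset hjF hAF
        · rw [Finset.card_insert_of_notMem (by simp [hAj]), hAc]
        · intro _
          rw [hAj]
          ext x
          simp only [Finset.mem_insert, Finset.mem_filter]
          constructor
          · rintro (rfl | h)
            exacts [⟨hjF, by omega⟩, ⟨h.1, by omega⟩]
          · rintro ⟨h, h'⟩
            rcases eq_or_ne x j with rfl | hxj
            exacts [.inl rfl, .inr ⟨h, by omega⟩]
        · intro u hu v hvF hvu
          obtain ⟨h1, h2⟩ := hbad₄ hb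
          rcases Finset.mem_insert.1 hu with rfl | hu
          · exact (h2 v hvF hvu).2 hlt
          · exact (hbad h1).2 u hu v hvF hvu
      · intro hge
        refine ⟨?_, hrep₄.congr (by simp), by omega, A, hAF, hAc, by omega,
          fun hb => ⟨hpair hb, (hbad (hbad₄ hb).1).2⟩⟩
        rw [if_neg (by omega)] at hT₄
        omega
    · intro hjF
      refine ⟨hrep.congr (by simp), hsc, A, hAF, hAc, fun h => ?_, fun hb =>
        ⟨fun u hu huF => ?_, (hbad hb).2⟩⟩
      · rw [hA h]
        refine Finset.filter_congr fun x hx => ?_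
        have : x ≠ j := by
          rintro rfl
          exact hjF hx
        omega
      · refine (hbad hb).1 u ?_ huF
        have : u ≠ j := by
          rintro rfl
          exact hjF huF
        omega
  · rintro T s' _ ⟨⟨h1, h2, A, hAF, hAc, hA, hbad⟩, hT⟩
    simp [hn] at hA hbad hT
    refine ⟨?_, h1, fun hb u hu v hv huv => ?_⟩
    · rw [findBadTime]
      rw [show 11 * P.M + 20 * P.n + 15 + 2 = 11 * P.M + 20 * P.n + 17 from rfl] at hT
      have := Nat.mul_le_mul_right P.n (show 11 * P.M + 20 * P.n + 17 ≤ 11 * P.M + 20 * P.n + 20 by omega)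
      omega
    · obtain ⟨h3, h4⟩ := hbad hb
      -- With fewer than `tc` sources, `A` would be all of F, which has at least `tc` vertices.
      have hcA : P.tc ≤ A.card := by
        by_contra hlt
        have := hA (by omega)
        rw [Finset.filter_true_of_mem fun x hx => by simpa using hFn hx] at this
        rw [this] at hlt
        exact hlt htc
      rintro (h | h)
      · have := (h3 u (by simpa using hFn hu) hu v hv huv.symm).1
        omega
      · refine not_separated_of_sources hAF hcA (fun a ha b hb => ?_) hu hv h
        rcases eq_or_ne b a with rfl | hne
        · rintro ⟨U, D, -, -, -, h5, h6, -⟩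
          exact h6 h5
        · exact h4 a ha b hb hne

end

section

variable {P : Inst} {F : Finset ℕ} {u v : ℕ}

/-! ### The search tree -/

/-- Return to the last vertex of the search tree with an unexplored second child, and go there. -/
def backtrack : Cmd :=
  -- The value 0 of `alt` says that no second child is left; otherwise it is the vertex plus one.
  -- The entry 1 at depth 0 is a sentinel that stops the climb at the root.
  .loop (get .alt Var.d) 1 (.put .inS (get .del Var.d) 1 ;; .d ::= Var.d - 1) ;;
  .ite Var.d 1 (.run ::= 0)
    -- The deleted vertex returns and the alternative one is deleted instead; clearing `alt` marks
    -- the second child as taken.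
    (.put .inS (get .del Var.d) 1 ;; .put .del Var.d (get .alt Var.d - 1) ;;
      .put .inS (get .del Var.d) 0 ;; .put .alt Var.d 0)

/-- Delete the first vertex of the bad pair, and remember the second one. -/
def descend : Cmd :=
  .d ::= Var.d + 1 ;; .put .del Var.d Var.bu ;; .put .alt Var.d (Var.bv + 1) ;;
  .put .inS Var.bu 0

/-- Explore the search tree of depth `l`. -/
def explore : Cmd :=
  .ans ::= 0 ;; .d ::= 0 ;; .put .alt 0 1 ;; .run ::= 1 ;;
  .loop 0 Var.run (findBad ;;
    .ite Var.bad 1 (.ans ::= 1 ;; .run ::= 0) (.ite Var.d Var.l descend backtrack))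

/-- `F` contains a club with at least `k` vertices. -/
def HasClub (P : Inst) (k : ℕ) (F : Finset ℕ) : Prop :=
  ∃ S ⊆ F, k ≤ S.card ∧ IsClub P.H P.w P.θ P.tc S

/-- By heredity, a club inside F that contained both vertices would contain them as a bad pair. -/
theorem hasClub_iff_of_badPair {k : ℕ} (huv : u ≠ v)
    (h : BadPair P.H P.w P.θ P.tc F u v) :
    HasClub P k F ↔ HasClub P k (F.erase u) ∨ HasClub P k (F.erase v) := by
  constructor
  · rintro ⟨S, hS, hk, hclub⟩
    by_cases huS : u ∈ S
    · have hvS : v ∉ S := fun hvS => hclub u huS v hvS huv (h.anti hS huS)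
      exact .inr ⟨S, Finset.subset_erase.2 ⟨hS, hvS⟩, hk, hclub⟩
    · exact .inl ⟨S, Finset.subset_erase.2 ⟨hS, huS⟩, hk, hclub⟩
  · rintro (⟨S, hS, h⟩ | ⟨S, hS, h⟩)
    · exact ⟨S, hS.trans (Finset.erase_subset _ _), h⟩
    · exact ⟨S, hS.trans (Finset.erase_subset _ _), h⟩

/-- The path from the root of the search tree, which is at `F₀`, to the current vertex. The sets on
the path are `G 0, …, G d`. -/
structure Trail (F₀ : Finset ℕ) (G : ℕ → Finset ℕ) (d : ℕ) (del alt : ℕ → ℕ) : Prop where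
  zero : G 0 = F₀
  alt_zero : alt 0 = 1
  mem : ∀ i < d, del (i + 1) ∈ G i
  succ : ∀ i < d, G (i + 1) = (G i).erase (del (i + 1))
  alt_mem : ∀ i < d, alt (i + 1) ≠ 0 → alt (i + 1) - 1 ∈ G i

/-- An unexplored vertex of the search tree yields a club. -/
def Pending (P : Inst) (k : ℕ) (G : ℕ → Finset ℕ) (alt : ℕ → ℕ) (d : ℕ) : Prop :=
  ∃ i < d, alt (i + 1) ≠ 0 ∧ HasClub P k ((G i).erase (alt (i + 1) - 1))

/-- A bound on the number of vertices of the search tree below unexplored vertices. -/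
def pendingCount (l : ℕ) (alt : ℕ → ℕ) (d : ℕ) : ℕ :=
  -- An unexplored sibling at depth i + 1 roots a binary tree of remaining depth l - (i + 1), with
  -- at most 2^(l - i) - 1 nodes.
  ∑ i ∈ Finset.range d, if alt (i + 1) = 0 then 0 else 2 ^ (l - i) - 1

section Trail

variable {F₀ : Finset ℕ} {G : ℕ → Finset ℕ} {d k : ℕ} {del alt : ℕ → ℕ}

theorem Trail.anti (h : Trail F₀ G d del alt) {d' : ℕ} (hd : d' ≤ d) : Trail F₀ G d' del alt :=
  ⟨h.zero, h.alt_zero, fun i hi => h.mem i (by omega), fun i hi => h.succ i (by omega),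
    fun i hi => h.alt_mem i (by omega)⟩

theorem Trail.subset (h : Trail F₀ G d del alt) : ∀ i ≤ d, G i ⊆ F₀ := by
  intro i
  induction i with
  | zero => exact fun _ => h.zero.subset
  | succ i ih =>
    intro hi
    rw [h.succ i (by omega)]
    exact (Finset.erase_subset _ _).trans (ih (by omega))

theorem Trail.card (h : Trail F₀ G d del alt) : ∀ i ≤ d, (G i).card + i = F₀.card := by
  intro i
  induction i with
  | zero => exact fun _ => by rw [h.zero, add_zero]
  | succ i ih =>
    intro hi
    have h1 := ih (by omega)
    have h2 := h.mem i (by omega)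
    have := Finset.card_pos.2 ⟨_, h2⟩
    rw [h.succ i (by omega), Finset.card_erase_of_mem h2]
    omega

/-- Replace the last vertex of a trail. -/
theorem Trail.extend (h : Trail F₀ G d del alt) {a b : ℕ} (ha : a ∈ G d)
    (hb : b ≠ 0 → b - 1 ∈ G d) :
    Trail F₀ (Function.update G (d + 1) ((G d).erase a)) (d + 1) (Function.update del (d + 1) a)
      (Function.update alt (d + 1) b) where
  zero := by simpa using h.zero
  alt_zero := by simpa using h.alt_zero
  mem i hi := by
    rw [Function.update_of_ne (by omega : i ≠ d + 1), Function.update_apply]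
    split_ifs with e
    · obtain rfl : i = d := by omega
      exact ha
    · exact h.mem i (by omega)
  succ i hi := by
    rw [Function.update_of_ne (by omega : i ≠ d + 1)]
    by_cases e : i = d
    · subst e
      simp
    · rw [Function.update_of_ne (by omega), Function.update_of_ne (by omega), h.succ i (by omega)]
  alt_mem i hi := by
    rw [Function.update_of_ne (by omega : i ≠ d + 1), Function.update_apply]
    split_ifs with e
    · obtain rfl : i = d := by omega
      exact hb
    · exact h.alt_mem i (by omega)

theorem pending_succ : Pending P k G alt (d + 1) ↔ Pending P k G alt d ∨
    (alt (d + 1) ≠ 0 ∧ HasClub P k ((G d).erase (alt (d + 1) - 1))) := by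
  constructor
  · rintro ⟨i, hi, h⟩
    rcases Nat.lt_succ_iff_lt_or_eq.1 hi with hi | rfl
    exacts [.inl ⟨i, hi, h⟩, .inr h]
  · rintro (⟨i, hi, h⟩ | h)
    exacts [⟨i, by omega, h⟩, ⟨d, by omega, h⟩]

theorem pending_update {X : Finset ℕ} {b : ℕ} :
    Pending P k (Function.update G (d + 1) X) (Function.update alt (d + 1) b) d ↔
      Pending P k G alt d := by
  refine exists_congr fun i => and_congr_right fun hi => ?_
  rw [Function.update_of_ne (by omega : i ≠ d + 1),
    Function.update_of_ne (by omega : i + 1 ≠ d + 1)]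

theorem pendingCount_succ (l : ℕ) : pendingCount l alt (d + 1) = pendingCount l alt d +
    if alt (d + 1) = 0 then 0 else 2 ^ (l - d) - 1 := Finset.sum_range_succ _ _

theorem pendingCount_update (l b : ℕ) :
    pendingCount l (Function.update alt (d + 1) b) d = pendingCount l alt d := by
  refine Finset.sum_congr rfl fun i hi => ?_
  rw [Function.update_of_ne]
  have : i < d := by simpa using hi
  omega

end Trail

/-- The answer is correct. -/
def Answered (P : Inst) (k : ℕ) (F₀ : Finset ℕ) (s : Store) : Prop :=
  (s.var .ans = 1 ∧ HasClub P k F₀) ∨ (s.var .ans = 0 ∧ ¬ HasClub P k F₀)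

/-- The exploration of the search tree is in progress. -/
def Exploring (P : Inst) (k l : ℕ) (F₀ : Finset ℕ) (s : Store) : Prop :=
  s.var .ans = 0 ∧ s.var .d ≤ l ∧ ∃ G, Trail F₀ G (s.var .d) (s.arr .del) (s.arr .alt) ∧
    Holds (G (s.var .d)) s ∧
    (HasClub P k F₀ ↔ HasClub P k (G (s.var .d)) ∨ Pending P k G (s.arr .alt) (s.var .d))

/-- The hypothesis `hiff` says that the current node is settled, so only pending siblings matter.
The climb drops exhausted levels; then the deepest pending sibling becomes the current node, and its
node count moves out of the pending sum. -/
theorem runs_backtrack {s : Store} {G : ℕ → Finset ℕ} {k l : ℕ} {F₀ : Finset ℕ}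
    (hF₀ : F₀ ⊆ Finset.range P.n) (hd : s.var .d ≤ l) (hl : l ≤ P.n)
    (ht : Trail F₀ G (s.var .d) (s.arr .del) (s.arr .alt)) (hS : Holds (G (s.var .d)) s)
    (ha : s.var .ans = 0) (hrun : s.var .run = 1)
    (hiff : HasClub P k F₀ ↔ Pending P k G (s.arr .alt) (s.var .d)) :
    Runs P.M P.B backtrack s fun T s' => T ≤ 3 * P.n + 10 ∧
      ((s'.var .run = 0 ∧ Answered P k F₀ s') ∨
        (s'.var .run = 1 ∧ Exploring P k l F₀ s' ∧
          2 ^ (l - s'.var .d + 1) - 1 + pendingCount l (s'.arr .alt) (s'.var .d) ≤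
            pendingCount l (s.arr .alt) (s.var .d))) := by
  have hB := P.le_B
  have hlt : ∀ i < s.var .d, s.arr .del (i + 1) < P.n := fun i hi => by
    simpa using hF₀ (ht.subset i hi.le (ht.mem i hi))
  rw [backtrack, runs_seq]
  refine (Runs.loop (fun s' => s'.var .d ≤ s.var .d ∧ Holds (G (s'.var .d)) s' ∧
    (HasClub P k F₀ ↔ Pending P k G (s.arr .alt) (s'.var .d)) ∧
    pendingCount l (s.arr .alt) (s'.var .d) ≤ pendingCount l (s.arr .alt) (s.var .d))
    (fun s' => 3 * s'.var .d) ⟨le_rfl, hS, hiff, le_rfl⟩ ?_ ?_).mono ?_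
  · rintro s' ⟨h1, -⟩ _
    simp
    omega
  · rintro s' ⟨h1, h2, h3, h4⟩ hF hpos
    have ealt := hF.arr .alt (by decide)
    have edel := hF.arr .del (by decide)
    simp [ealt] at hpos
    obtain ⟨e, he⟩ : ∃ e, s'.var .d = e + 1 := by
      refine ⟨s'.var .d - 1, ?_⟩
      by_contra hcon
      rw [show s'.var .d = 0 by omega, ht.alt_zero] at hpos
      omega
    rw [he] at hpos h1 h2 h3 h4
    have h5 := hlt e (by omega)
    simp [he, edel]
    refine ⟨⟨by omega, by omega, by omega⟩, ⟨by omega, by omega⟩, ⟨by omega, ?_, ?_, ?_⟩, by omega⟩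
    · intro x
      simp [Function.update_apply]
      rw [h2 x, ht.succ e (by omega)]
      by_cases hx : x = s.arr .del (e + 1)
      · simp [hx, ht.mem e (by omega)]
      · simp [hx]
    · rw [h3, pending_succ]
      simp [hpos]
    · rw [pendingCount_succ, if_pos hpos] at h4
      simpa using h4
  · rintro T s' hF ⟨⟨h1, h2, h3, h4⟩, h5, h6⟩
    have ealt := hF.arr .alt (by decide)
    have edel := hF.arr .del (by decide)
    have eans := hF.var .ans (by decide)
    have erun := hF.var .run (by decide)
    simp [ealt] at h5
    simp [ealt, edel]
    refine ⟨by omega, ?_, ?_⟩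
    · intro h0
      rw [h0] at h3
      refine ⟨by omega, .inr ⟨by simpa [eans] using ha, ?_⟩⟩
      rw [h3]
      rintro ⟨i, hi, -⟩
      omega
    · intro h0
      obtain ⟨e, he⟩ : ∃ e, s'.var .d = e + 1 := ⟨s'.var .d - 1, by omega⟩
      rw [he] at h1 h2 h3 h4 h5 h6
      have h7 := hlt e (by omega)
      have h8 := ht.alt_mem e (by omega) h5
      have h9 : s.arr .alt (e + 1) - 1 < P.n := by
        simpa using hF₀ (ht.subset e (by omega) h8)
      have ht' := (ht.anti (show e ≤ s.var .d by omega)).extend h8 (b := 0) (by simp)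
      simp [he]
      refine ⟨⟨by omega, by omega⟩, by omega, by omega, by omega, by omega, .inr ⟨by omega, ?_, ?_⟩⟩
      · refine ⟨by simp [eans, ha], by simp [he]; omega,
          Function.update G (e + 1) ((G e).erase (s.arr .alt (e + 1) - 1)), ?_, ?_, ?_⟩
        · simpa [he, ealt, edel] using ht'
        · intro x
          simp [he, Function.update_apply]
          rw [h2 x, ht.succ e (by omega)]
          by_cases hx : x = s.arr .alt (e + 1) - 1
          · simp [hx]
          · by_cases hx' : x = s.arr .del (e + 1)
            · simp [hx', ht.mem e (by omega)]
            · simp [hx, hx']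
        · simp [he, ealt]
          rw [pending_succ, pending_update, h3, pending_succ]
          simp [h5, or_comm]
      · rw [pendingCount_succ, pendingCount_update]
        rw [pendingCount_succ, if_neg h5] at h4
        simp
        rw [show l - (e + 1) + 1 = l - e by omega]
        omega

/-- The count is the identity 2^(r+1) - 1 = 1 + 2 (2^r - 1): a node and two subtrees, of which the
second becomes pending. The unit on the left is what the visited node is charged to. -/
theorem runs_descend {s : Store} {G : ℕ → Finset ℕ} {k l : ℕ} {F₀ : Finset ℕ}
    (hF₀ : F₀ ⊆ Finset.range P.n) (hd : s.var .d < l) (hl : l ≤ P.n)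
    (ht : Trail F₀ G (s.var .d) (s.arr .del) (s.arr .alt)) (hS : Holds (G (s.var .d)) s)
    (ha : s.var .ans = 0) (hu : s.var .bu ∈ G (s.var .d)) (hv : s.var .bv ∈ G (s.var .d))
    (huv : s.var .bu ≠ s.var .bv)
    (hbad : BadPair P.H P.w P.θ P.tc (G (s.var .d)) (s.var .bu) (s.var .bv))
    (hiff : HasClub P k F₀ ↔
      HasClub P k (G (s.var .d)) ∨ Pending P k G (s.arr .alt) (s.var .d)) :
    Runs P.M P.B descend s fun T s' => T ≤ 4 ∧ Exploring P k l F₀ s' ∧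
      2 ^ (l - s'.var .d + 1) - 1 + pendingCount l (s'.arr .alt) (s'.var .d) + 1 ≤
        2 ^ (l - s.var .d + 1) - 1 + pendingCount l (s.arr .alt) (s.var .d) := by
  have hB := P.le_B
  set d := s.var .d with hddef
  have h1 : s.var .bu < P.n := by simpa using hF₀ (ht.subset d le_rfl hu)
  have h2 : s.var .bv < P.n := by simpa using hF₀ (ht.subset d le_rfl hv)
  have ht' := ht.extend hu (b := s.var .bv + 1) (by simpa using hv)
  simp [descend, ← hddef]
  refine ⟨⟨by omega, by omega⟩, by omega, ⟨by omega, by omega⟩, by omega, ?_, ?_⟩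
  · refine ⟨by simp [ha], by simp; omega,
      Function.update G (d + 1) ((G d).erase (s.var .bu)), ?_, ?_, ?_⟩
    · simpa using ht'
    · intro x
      simp [Function.update_apply, hS x]
      by_cases hx : x = s.var .bu <;> simp [hx]
    · simp
      rw [pending_succ, pending_update, hiff, hasClub_iff_of_badPair huv hbad]
      simp
      tauto
  · rw [pendingCount_succ, pendingCount_update]
    simp
    rw [show l - (d + 1) + 1 = l - d by omega, pow_succ]
    have := Nat.one_le_two_pow (n := l - d)
    omega

/-- A bound on the running time spent at one vertex of the search tree. -/
def nodeTime (P : Inst) : ℕ := findBadTime P + 3 * P.n + 15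

/-- The potential is `nodeTime P` times a bound on the number of nodes not yet settled. Since every
set on the trail has at least `k` vertices, `htc` supplies enough sources for `runs_findBad`. -/
theorem runs_explore {s : Store} {k : ℕ} {F₀ : Finset ℕ} (hR : Ready P s) (hS : Holds F₀ s)
    (hF₀ : F₀ ⊆ Finset.range P.n) (hk : k ≤ F₀.card) (hl : s.var .l = F₀.card - k)
    (htc : P.tc ≤ k) :
    Runs P.M P.B explore s fun T s' => T ≤ nodeTime P * 2 ^ (F₀.card - k + 1) + 5 ∧
      Answered P k F₀ s' := by
  have hB := P.le_B
  have hcard : F₀.card ≤ P.n := by simpa using Finset.card_le_card hF₀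
  set l := F₀.card - k with hldef
  rw [explore]
  rw [runs_seq, runs_set, runs_seq, runs_set, runs_seq, runs_put, runs_seq, runs_set]
  simp
  refine ⟨by omega, ?_⟩
  refine (Runs.loop (fun s' => (s'.var .run = 0 ∧ Answered P k F₀ s') ∨
    (s'.var .run = 1 ∧ Exploring P k l F₀ s'))
    (fun s' => nodeTime P * if s'.var .run = 0 then 0 else
      2 ^ (l - s'.var .d + 1) - 1 + pendingCount l (s'.arr .alt) (s'.var .d)) ?_ (by simp)
      ?_).mono ?_
  · refine .inr ⟨by simp, by simp, by simp, fun _ => F₀, ?_, ?_, ?_⟩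
    · constructor <;> simp
    · simpa [Holds] using hS
    · simp [Pending]
  · rintro s₁ hI hF hpos
    simp at hpos
    obtain ⟨hrun, ha, hd, G, ht, hG, hiff⟩ : s₁.var .run = 1 ∧ Exploring P k l F₀ s₁ := by
      rcases hI with h | h
      · omega
      · exact h
    have hR₁ : Ready P s₁ := (hR.congr (by simp) (by simp)).frame hF (by decide) (by decide)
    have el₁ : s₁.var .l = l := by
      rw [hF.var .l (by decide)]
      simpa using hl
    have hsub := ht.subset _ le_rfl
    have hcd := ht.card _ le_rfl
    rw [runs_seq]
    refine (runs_findBad hR₁ hG (hsub.trans hF₀) (by omega)).mono ?_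
    rintro T₂ s₂ hF₂ ⟨hT₂, hrep, hclub⟩
    have ed : s₂.var .d = s₁.var .d := hF₂.var .d (by decide)
    have el : s₂.var .l = l := (hF₂.var .l (by decide)).trans el₁
    have erun : s₂.var .run = 1 := (hF₂.var .run (by decide)).trans hrun
    have eans : s₂.var .ans = 0 := (hF₂.var .ans (by decide)).trans ha
    have eS : s₂.arr .inS = s₁.arr .inS := hF₂.arr .inS (by decide)
    have edel : s₂.arr .del = s₁.arr .del := hF₂.arr .del (by decide)
    have ealt : s₂.arr .alt = s₁.arr .alt := hF₂.arr .alt (by decide)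
    have hG₂ : Holds (G (s₂.var .d)) s₂ := by rwa [Holds, eS, ed]
    rw [← ed, ← edel, ← ealt] at ht
    rw [← ed, ← ealt] at hiff
    have hnode : nodeTime P = findBadTime P + 3 * P.n + 15 := rfl
    -- Every round settles at least one node and so releases `nodeTime P`.
    have hpay : ∀ a b T : ℕ, T ≤ nodeTime P → b + 1 ≤ a →
        T + nodeTime P * b ≤ nodeTime P * a := by
      intro a b T h1 h2
      refine le_trans ?_ (Nat.mul_le_mul_left _ h2)
      rw [Nat.mul_succ]
      omega
    have hpow := Nat.one_lt_two_pow (n := l - s₁.var .d + 1) (by omega)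
    rw [runs_ite]
    simp
    refine ⟨by omega, ?_, ?_⟩
    · intro hb
      refine ⟨by omega, .inl ⟨by simp, G (s₁.var .d), hsub, by omega, hclub hb⟩, ?_⟩
      rw [if_neg (by omega)]
      have := hpay _ 0 (T₂ + 4) (by omega) (show 0 + 1 ≤ 2 ^ (l - s₁.var .d + 1) - 1 +
        pendingCount l (s₁.arr .alt) (s₁.var .d) by omega)
      omega
    · intro hb
      obtain ⟨hu, hv, huv, hbad⟩ := hrep hb
      rw [← ed] at hu hv hbad
      rw [el]
      refine ⟨?_, ?_⟩
      · intro hlt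
        refine (runs_descend hF₀ hlt (by omega) ht hG₂ eans hu hv huv hbad hiff).mono ?_
        rintro T₃ s₃ hF₃ ⟨hT₃, hex, hcount⟩
        have erun₃ := hF₃.var .run (by decide)
        rw [if_neg (by omega), if_neg (by omega)]
        rw [ed, ealt] at hcount
        exact ⟨.inr ⟨by omega, hex⟩, hpay _ _ _ (by omega) hcount⟩
      · intro hge
        have hdl : s₁.var .d = l := by omega
        -- At depth `l` exactly `k` vertices remain, so the only candidate is the whole set, which
        -- has a bad pair.
        have hno : ¬ HasClub P k (G (s₂.var .d)) := by
          rintro ⟨S, hSG, hkS, hS⟩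
          have : S = G (s₂.var .d) := by
            refine Finset.eq_of_subset_of_card_le hSG ?_
            rw [ed]
            omega
          subst this
          exact hS _ hu _ hv huv hbad
        refine (runs_backtrack (l := l) hF₀ (by omega) (by omega) ht hG₂ eans erun
          (by rw [hiff]; tauto)).mono ?_
        rintro T₃ s₃ hF₃ ⟨hT₃, hend | ⟨hrun₃, hex, hcount⟩⟩
        · refine ⟨.inl hend, ?_⟩
          rw [if_pos hend.1, if_neg (by omega)]
          exact hpay _ 0 _ (by omega) (by omega)
        · rw [if_neg (by omega), if_neg (by omega)]
          rw [ed, ealt] at hcount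
          exact ⟨.inr ⟨hrun₃, hex⟩, hpay _ _ _ (by omega) (by omega)⟩
  · rintro T s' _ ⟨h1, h2, h3⟩
    simp at h2
    rcases h1 with h1 | h1
    · refine ⟨?_, h1.2⟩
      simp [pendingCount] at h3
      have : nodeTime P * (2 ^ (l + 1) - 1) ≤ nodeTime P * 2 ^ (l + 1) :=
        Nat.mul_le_mul_left _ (Nat.sub_le _ _)
      omega
    · omega

end

section

variable {P : Inst}

/-! ### The complete program -/

/-- Find out whether there is a club with at least `k` vertices. -/
def core : Cmd :=
  .ite Var.n Var.k (.ans ::= 0)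
    -- This and the next test remove k ≤ 1 and θ = 0, so that isolated vertices may be discarded
    -- afterwards.
    (.ite Var.k 2 (.ans ::= 1)
      (.ite Var.th 1 (.ans ::= 1)
        -- Without edges the time bound is constant, so the answer has to come before any loop over
        -- the vertices.
        (.ite Var.m 1 (.ans ::= 0)
          (.mm ::= 2 * Var.m ;; readEdges ;;
            .ite Var.ns Var.k (.ans ::= 0) (.l ::= Var.ns - Var.k ;; explore))))) ;;
  -- The variable `n` lives in register 0, where the machine has to leave the answer.
  .n ::= Var.ans

/-- The vertices that are not isolated. -/
def Inst.support (P : Inst) : Finset ℕ := (Finset.range P.M).image P.σ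

theorem Inst.support_subset (P : Inst) : P.support ⊆ Finset.range P.n := by
  intro x hx
  obtain ⟨c, hc, rfl⟩ := Finset.mem_image.1 hx
  simpa using P.tail_lt c (by simpa using hc)

theorem Inst.card_support_le (P : Inst) : P.support.card ≤ P.M := by
  exact Finset.card_image_le.trans (by simp)

/-- An isolated vertex has no neighbours at all, so it is bad with any second vertex of the set, and
`hk` provides one. -/
theorem hasClub_support_iff {k : ℕ} (hk : 2 ≤ k) (hθ : 1 ≤ P.θ) :
    HasClub P k P.support ↔ HasClub P k (Finset.range P.n) := by
  constructor
  · rintro ⟨S, hS, h⟩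
    exact ⟨S, hS.trans P.support_subset, h⟩
  · rintro ⟨S, hS, hkS, hclub⟩
    refine ⟨S, fun u hu => ?_, hkS, hclub⟩
    by_contra hnot
    obtain ⟨v, hv, hvu⟩ := Finset.exists_mem_ne (by omega : 1 < S.card) u
    refine hclub u hu v hv hvu.symm (badPair_of_isolated hθ (fun x hux => hnot ?_) v)
    obtain ⟨c, hc, h1, -⟩ := P.exists_arc u x hux
    exact Finset.mem_image.2 ⟨c, by simpa using hc, h1⟩

theorem hasClub_range_of_le_one {k : ℕ} (hk : k < 2) (hn : k ≤ P.n) :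
    HasClub P k (Finset.range P.n) := by
  refine ⟨Finset.range k, Finset.range_mono hn, by simp, fun u hu v hv huv => ?_⟩
  have h1 : u < k := by simpa using hu
  have h2 : v < k := by simpa using hv
  omega

theorem hasClub_range_of_theta_eq_zero {k : ℕ} (hθ : P.θ = 0) (htc : P.tc = 0) (hn : k ≤ P.n) :
    HasClub P k (Finset.range P.n) := by
  refine ⟨Finset.range P.n, subset_rfl, by simpa using hn, fun u _ v _ _ => ?_⟩
  rintro (h | ⟨U, A, h, -⟩) <;> omega

theorem not_hasClub_of_card_lt {k : ℕ} {F : Finset ℕ} (h : F.card < k) : ¬ HasClub P k F := by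
  rintro ⟨S, hS, hk, -⟩
  have := Finset.card_le_card hS
  omega

theorem nodeTime_le (P : Inst) (hn : 1 ≤ P.n) :
    nodeTime P ≤ 130 * (max P.tc 1 ^ 2 * P.n * (P.n + P.M)) := by
  set f := max P.tc 1 with hf
  have h1 : 1 ≤ f := le_max_right _ _
  have h2 : P.tc ≤ f := le_max_left _ _
  have hflow : flowTime P ≤ f * (20 * P.M + 40 * P.n + 25) := by
    rw [flowTime]
    have := Nat.mul_le_mul_left (20 * P.M + 37 * P.n + 20) h2
    nlinarith
  have hff : 1 ≤ f ^ 2 := Nat.one_le_pow _ _ h1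
  have h3 : P.tc * (flowTime P * P.n) ≤ f ^ 2 * P.n * (20 * P.M + 40 * P.n + 25) :=
    calc P.tc * (flowTime P * P.n) ≤ f * (f * (20 * P.M + 40 * P.n + 25) * P.n) := by gcongr
      _ = _ := by ring
  have h4 : (11 * P.M + 20 * P.n + 20) * P.n + 4 + 3 * P.n + 15 ≤
      P.n * (11 * P.M + 20 * P.n + 42) := by nlinarith
  have h5 : P.n * (11 * P.M + 20 * P.n + 42) ≤ f ^ 2 * P.n * (11 * P.M + 20 * P.n + 42) := by
    rw [mul_assoc]
    exact Nat.le_mul_of_pos_left _ hff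
  -- The sum of the two brackets is 31M + 60n + 67, and 67 ≤ 67n because n ≥ 1.
  have h6 : f ^ 2 * P.n * (20 * P.M + 40 * P.n + 25) + f ^ 2 * P.n * (11 * P.M + 20 * P.n + 42) ≤
      f ^ 2 * P.n * (130 * (P.n + P.M)) := by
    rw [← mul_add]
    exact Nat.mul_le_mul_left _ (by omega)
  rw [nodeTime, findBadTime]
  calc _ ≤ f ^ 2 * P.n * (130 * (P.n + P.M)) := by omega
    _ = _ := by ring

/-- The exponent is smaller than n - k by the number n - a of isolated vertices. The factor 2^(n -
a) gained in this way absorbs the summand n of the time per node. -/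
theorem nodeTime_mul_le (P : Inst) {k : ℕ} (hn : 1 ≤ P.n) (hM : 1 ≤ P.M)
    (hk : k ≤ P.support.card) :
    nodeTime P * 2 ^ (P.support.card - k + 1) ≤
      780 * (2 ^ (P.n - k) * (max P.tc 1 ^ 2 * (P.n * P.M))) := by
  have h1 := P.card_support_le
  have h2 : P.support.card ≤ P.n := by simpa using Finset.card_le_card P.support_subset
  set a := P.support.card
  -- Write n = a + (n - a) with a ≤ M and n - a ≤ 2^(n - a).
  have h3 : P.n + P.M ≤ 3 * P.M * 2 ^ (P.n - a) := by
    have h4 := (Nat.lt_two_pow_self (n := P.n - a)).le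
    have h5 : 2 * P.M ≤ 2 * P.M * 2 ^ (P.n - a) := Nat.le_mul_of_pos_right _ (by positivity)
    have h6 : 2 ^ (P.n - a) ≤ P.M * 2 ^ (P.n - a) := Nat.le_mul_of_pos_left _ hM
    have h7 : 3 * P.M * 2 ^ (P.n - a) = 2 * P.M * 2 ^ (P.n - a) + P.M * 2 ^ (P.n - a) := by ring
    omega
  have h8 : 2 ^ (P.n - a) * 2 ^ (a - k + 1) = 2 * 2 ^ (P.n - k) := by
    rw [← pow_add, ← pow_succ']
    congr 1
    omega
  calc nodeTime P * 2 ^ (a - k + 1)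
      ≤ 130 * (max P.tc 1 ^ 2 * P.n * (3 * P.M * 2 ^ (P.n - a))) * 2 ^ (a - k + 1) := by
        refine Nat.mul_le_mul_right _ ((nodeTime_le P hn).trans ?_)
        gcongr
    _ = 390 * (max P.tc 1 ^ 2 * P.n * P.M) * (2 ^ (P.n - a) * 2 ^ (a - k + 1)) := by ring
    _ = _ := by rw [h8]; ring

theorem runs_core {s : Store} {k : ℕ} (hσ : P.σ = s.inp) (hτ : P.τ = arcHead s.inp)
    (hM : P.M = 2 * s.var .m) (hn : s.var .n = P.n) (hw : s.var .w = P.w) (hth : s.var .th = P.θ)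
    (htc : s.var .tc = P.tc) (hk : s.var .k = k) (harr : ∀ b i, s.arr b i = 0)
    (hns : s.var .ns = 0) (htck : P.tc ≤ k) (hθ : P.θ = 0 → P.tc = 0) :
    Runs P.M P.B core s fun T s' =>
      T ≤ 2000 * (2 ^ (P.n - k) * (max P.tc 1 ^ 2 * (P.n * s.var .m)) + 1) ∧
      (HasClub P k (Finset.range P.n) → s'.var .n = 1) ∧
      (¬ HasClub P k (Finset.range P.n) → s'.var .n = 0) := by
  have hB := P.le_B
  rw [core, runs_seq]
  have hmain : ∀ c : Cmd, (Runs P.M P.B c s fun T s' =>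
      T ≤ 1990 * (2 ^ (P.n - k) * (max P.tc 1 ^ 2 * (P.n * s.var .m)) + 1) ∧
      Answered P k (Finset.range P.n) s') → Runs P.M P.B c s fun τ s' =>
      Runs P.M P.B (.n ::= Var.ans) s' fun τ' s'' =>
      τ + τ' ≤ 2000 * (2 ^ (P.n - k) * (max P.tc 1 ^ 2 * (P.n * s.var .m)) + 1) ∧
      (HasClub P k (Finset.range P.n) → s''.var .n = 1) ∧
      (¬ HasClub P k (Finset.range P.n) → s''.var .n = 0) := by
    intro c hc
    refine hc.mono ?_
    rintro T s' - ⟨h1, h2⟩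
    simp
    refine ⟨by omega, fun h => ?_, fun h => ?_⟩ <;> rcases h2 with h2 | h2
    · exact h2.1
    · exact absurd h h2.2
    · exact absurd h2.2 h
    · exact h2.1
  apply hmain
  simp only [runs_ite]
  simp [hn, hk, hth]
  refine ⟨fun h => ⟨by omega, .inr ⟨by simp, not_hasClub_of_card_lt (by simpa using h)⟩⟩,
    fun h1 => ⟨by omega, fun h => ⟨by omega, by omega,
      .inl ⟨by simp, hasClub_range_of_le_one (by omega) h1⟩⟩,
    fun h2 => ⟨by omega, fun h => ⟨by omega, by omega, .inl ⟨by simp,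
      hasClub_range_of_theta_eq_zero h (hθ h) h1⟩⟩, fun h3 => ⟨by omega, fun h => ⟨by omega, .inr ⟨by simp, ?_⟩⟩,
      fun h4 => ⟨⟨by omega, by omega⟩, ?_⟩⟩⟩⟩⟩
  · rw [← hasClub_support_iff h2 (by omega)]
    apply not_hasClub_of_card_lt
    have := P.card_support_le
    omega
  · have hpos : 1 ≤ s.var .m := by omega
    have hn1 : 1 ≤ P.n := by omega
    refine Runs.mono (runs_readEdges (M := P.M) (by simpa using hM) ?_ (by omega) (by simpa using harr)
      (by simpa using hns)) ?_
    · intro c hc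
      have := P.tail_lt c hc
      rw [hσ] at this
      simp
      omega
    · rintro T₁ s₁ hF₁ ⟨hT₁, hA⟩
      rw [Store.set_inp, ← hτ, ← hσ] at hA
      have ev : ∀ x ∉ readEdges.vars, x ≠ .mm → s₁.var x = s.var x := fun x hx hne => by
        rw [hF₁.var x hx]
        simp [hne]
      have ek := ev .k (by decide) (by decide)
      have hns₁ : s₁.var .ns = P.support.card := hA.ns
      have hsmall : 60 * s.var .m ≤
          60 * (2 ^ (P.n - k) * (max P.tc 1 ^ 2 * (P.n * s.var .m))) := by
        refine Nat.mul_le_mul_left _ ?_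
        refine le_trans ?_ (Nat.le_mul_of_pos_left _ (by positivity))
        refine le_trans ?_ (Nat.le_mul_of_pos_left _ (by positivity))
        exact Nat.le_mul_of_pos_left _ hn1
      simp [ek, hk, hns₁]
      refine ⟨fun h => ⟨by omega, .inr ⟨by simp, ?_⟩⟩, fun h => ⟨?_, ?_⟩⟩
      · rw [← hasClub_support_iff h2 (by omega)]
        exact not_hasClub_of_card_lt h
      · have : P.support.card ≤ P.n := by simpa using Finset.card_le_card P.support_subset
        omega
      · have hR : Ready P (s₁.set .l (P.support.card - k)) := by
          refine ⟨?_, ?_, ?_, ?_, ?_, ?_, ?_, ?_, ?_⟩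
          · simpa using (ev .n (by decide) (by decide)).trans hn
          · have := hF₁.var .mm (by decide)
            simp at this
            simp [this, hM]
          · simpa using (ev .w (by decide) (by decide)).trans hw
          · simpa using (ev .th (by decide) (by decide)).trans hth
          · simpa using (ev .tc (by decide) (by decide)).trans htc
          · simpa using hA.src
          · simpa using hA.tgt
          · simpa using hA.next
          · simpa using hA.first
        refine Runs.mono (runs_explore (F₀ := P.support) hR ?_ P.support_subset h (by simp) htck) ?_
        · intro x
          simpa [Inst.support] using hA.inS x
        · rintro T₂ s₂ - ⟨hT₂, hans⟩
          refine ⟨?_, ?_⟩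
          · have h5 := nodeTime_mul_le P hn1 (by omega) h
            have h6 : 780 * (2 ^ (P.n - k) * (max P.tc 1 ^ 2 * (P.n * P.M))) =
                1560 * (2 ^ (P.n - k) * (max P.tc 1 ^ 2 * (P.n * s.var .m))) := by
              rw [hM]
              ring
            omega
          · rw [Answered, hasClub_support_iff h2 (by omega)] at hans
            exact hans

end

/-! ### The instance described by an edge list -/

section EdgeList

variable {n : ℕ} {G : SimpleGraph (Fin n)} {E : List (Fin n × Fin n)}

theorem IsEdgeList.ncard_edgeSet (h : IsEdgeList G E) : G.edgeSet.ncard = E.length := by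
  have : G.edgeSet = ((E.map fun e => s(e.1, e.2)).toFinset : Set (Sym2 (Fin n))) := by
    ext e
    rw [← h.2 e]
    simp
  rw [this, Set.ncard_coe_finset, List.toFinset_card_of_nodup h.1, List.length_map]

theorem IsEdgeList.adj (h : IsEdgeList G E) {i : ℕ} (hi : i < E.length) :
    G.Adj E[i].1 E[i].2 := by
  rw [← SimpleGraph.mem_edgeSet, ← h.2]
  exact List.mem_map.2 ⟨E[i], List.getElem_mem hi, rfl⟩

theorem IsEdgeList.eq_of_sym2_eq (h : IsEdgeList G E) {i j : ℕ} (hi : i < E.length)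
    (hj : j < E.length) (hij : s(E[i].1, E[i].2) = s(E[j].1, E[j].2)) : i = j := by
  refine (h.1.getElem_inj_iff (hi := by simpa using hi) (hj := by simpa using hj)).1 ?_
  simpa using hij

theorem IsEdgeList.exists_getElem (h : IsEdgeList G E) {a b : Fin n} (hab : G.Adj a b) :
    ∃ (i : ℕ) (hi : i < E.length), E[i] = (a, b) ∨ E[i] = (b, a) := by
  obtain ⟨e, he, hes⟩ := List.mem_map.1 ((h.2 s(a, b)).2 hab)
  obtain ⟨i, hi, rfl⟩ := List.mem_iff_getElem.1 he
  refine ⟨i, hi, ?_⟩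
  rw [Sym2.eq_iff] at hes
  exact hes.imp (fun h => Prod.ext h.1 h.2) fun h => Prod.ext h.1 h.2

theorem getD_flatMap_pair {α : Type*} (f g : α → ℕ) (L : List α) {i : ℕ} (hi : i < L.length) :
    (L.flatMap fun e => [f e, g e]).getD (2 * i) 0 = f L[i] ∧
      (L.flatMap fun e => [f e, g e]).getD (2 * i + 1) 0 = g L[i] := by
  induction L generalizing i with
  | nil => simp at hi
  | cons a L ih =>
    cases i with
    | zero => simp
    | succ i =>
      have := ih (i := i) (by simpa using hi)
      simpa [Nat.mul_add] using this

theorem getD_flatMap_pair_of_le {α : Type*} (f g : α → ℕ) (L : List α) {c : ℕ}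
    (hc : 2 * L.length ≤ c) : (L.flatMap fun e => [f e, g e]).getD c 0 = 0 := by
  rw [List.getD_eq_default]
  simpa [List.length_flatMap, mul_comm] using hc

variable (t k : ℕ)

theorem arc_cases {c : ℕ} (hc : c < 2 * E.length) :
    ∃ (i : ℕ) (hi : i < E.length),
      (c = 2 * i ∧ (inputState n E t k).mem c = E[i].1 ∧
        arcHead (inputState n E t k).mem c = E[i].2) ∨
      (c = 2 * i + 1 ∧ (inputState n E t k).mem c = E[i].2 ∧
        arcHead (inputState n E t k).mem c = E[i].1) := by
  have hi : c / 2 < E.length := by omega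
  have h := getD_flatMap_pair (fun e : Fin n × Fin n => e.1.val) (fun e => e.2.val) E hi
  refine ⟨c / 2, hi, ?_⟩
  rcases Nat.mod_two_eq_zero_or_one c with h0 | h0
  · have hc2 : 2 * (c / 2) = c := by omega
    rw [hc2] at h
    exact .inl ⟨hc2.symm, h.1, by simpa [arcHead, inputState, h0] using h.2⟩
  · have hc2 : 2 * (c / 2) + 1 = c := by omega
    have hc1 : 2 * (c / 2) = c - 1 := by omega
    rw [hc2, hc1] at h
    exact .inr ⟨hc2.symm, h.2, by simpa [arcHead, inputState, h0] using h.1⟩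

/-- The instance given by an edge list. -/
def IsEdgeList.inst (h : IsEdgeList G E) (w θ tc B : ℕ)
    (hB : n + 2 * E.length + w + tc + 2 ≤ B) : Inst where
  H := G.map Fin.valEmbedding
  n := n
  M := 2 * E.length
  B := B
  w := w
  θ := θ
  tc := tc
  σ := (inputState n E t k).mem
  τ := arcHead (inputState n E t k).mem
  tail_lt c hc := by
    obtain ⟨i, hi, ⟨-, h1, -⟩ | ⟨-, h1, -⟩⟩ := arc_cases t k hc <;> rw [h1] <;> exact Fin.isLt _
  head_lt c hc := by
    obtain ⟨i, hi, ⟨-, -, h1⟩ | ⟨-, -, h1⟩⟩ := arc_cases t k hc <;> rw [h1] <;> exact Fin.isLt _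
  adj c hc := by
    obtain ⟨i, hi, ⟨-, h1, h2⟩ | ⟨-, h1, h2⟩⟩ := arc_cases t k hc <;> rw [h1, h2]
    · exact (SimpleGraph.map_adj _ _ _ _).2 ⟨_, _, h.adj hi, rfl, rfl⟩
    · exact (SimpleGraph.map_adj _ _ _ _).2 ⟨_, _, (h.adj hi).symm, rfl, rfl⟩
  exists_arc x y hxy := by
    obtain ⟨a, b, hab, rfl, rfl⟩ := (SimpleGraph.map_adj _ _ _ _).1 hxy
    obtain ⟨i, hi, he⟩ := h.exists_getElem hab
    have hg := getD_flatMap_pair (fun e : Fin n × Fin n => e.1.val) (fun e => e.2.val) E hi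
    rcases he with he | he <;> rw [he] at hg
    · exact ⟨2 * i, by omega, hg.1, by simpa [arcHead, inputState] using hg.2⟩
    · exact ⟨2 * i + 1, by omega, hg.2, by simpa [arcHead, inputState] using hg.1⟩
  arc_inj c hc d hd h1 h2 := by
    obtain ⟨i, hi, hci⟩ := arc_cases t k hc
    obtain ⟨j, hj, hdj⟩ := arc_cases t k hd
    have hne := (h.adj hi).ne
    have hij : i = j := by
      apply h.eq_of_sym2_eq hi hj
      rw [Sym2.eq_iff]
      rcases hci with ⟨-, h3, h4⟩ | ⟨-, h3, h4⟩ <;> rcases hdj with ⟨-, h5, h6⟩ | ⟨-, h5, h6⟩ <;>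
        rw [h3, h5] at h1 <;> rw [h4, h6] at h2 <;> simp [Fin.ext h1, Fin.ext h2]
    subst hij
    rcases hci with ⟨hc', h3, h4⟩ | ⟨hc', h3, h4⟩ <;>
      rcases hdj with ⟨hd', h5, h6⟩ | ⟨hd', h5, h6⟩
    · rw [hc', hd']
    -- The two orientations of an edge have different tails because an edge is not a loop.
    · exact absurd (Fin.ext (by rw [← h3, ← h5, h1])) hne
    · exact absurd (Fin.ext (by rw [← h3, ← h5, h1])) hne.symm
    · rw [hc', hd']
  le_B := hB

end EdgeList

/-! ### From the search program to the machine -/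

/-- The store of the search program that the initial state of the machine represents. -/
def inputStore (n : ℕ) (E : List (Fin n × Fin n)) (t k : ℕ) : Store where
  var x := (inputState n E t k).reg x.idx
  arr _ _ := 0
  inp := (inputState n E t k).mem

theorem inputState_reg_le (n : ℕ) (E : List (Fin n × Fin n)) (t k x : ℕ) :
    (inputState n E t k).reg x ≤ n + E.length + t + k := by
  rcases x with _ | _ | _ | _ | x <;> simp [inputState] <;> omega

theorem inputState_mem_le (n : ℕ) (E : List (Fin n × Fin n)) (t k : ℕ) {c : ℕ}
    (hc : c < 2 * E.length) : (inputState n E t k).mem c ≤ n := by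
  obtain ⟨i, hi, ⟨-, h1, -⟩ | ⟨-, h1, -⟩⟩ := arc_cases t k hc <;> rw [h1] <;>
    exact (Fin.isLt _).le

theorem repr_inputStore (n : ℕ) (E : List (Fin n × Fin n)) (t k : ℕ) {W : ℕ}
    (hW : n + E.length + t + k ≤ W) :
    Repr (2 * E.length) W (inputStore n E t k)
      ((inputState n E t k).setReg baseReg (2 * E.length)) where
  var x := Function.update_of_ne (by have := x.idx_lt; rw [baseReg]; omega) _ _
  base := by simp [State.setReg]
  inp _ _ := rfl
  -- Memory behind the input is zero, so all arrays start out as zero.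
  arr b i := getD_flatMap_pair_of_le _ _ _ (by omega)
  var_le x := (inputState_reg_le n E t k _).trans hW
  arr_le _ _ := Nat.zero_le _
  inp_le i hi := (inputState_mem_le n E t k hi).trans (by omega)

/-- A command that computes the parameters `w`, `th`, `tc` and `k` of the search from `t` and
`k`. -/
def Prepares (setup : Cmd) (w θ tc k' : ℕ → ℕ → ℕ) : Prop :=
  ∀ (M B : ℕ) (s : Store), s.var .t + 1 ≤ B → Runs M B setup s fun T s' =>
    T ≤ 10 ∧ s'.inp = s.inp ∧ s'.arr = s.arr ∧ s'.var .n = s.var .n ∧ s'.var .m = s.var .m ∧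
    s'.var .ns = s.var .ns ∧ s'.var .w = w (s.var .t) (s.var .k) ∧
    s'.var .th = θ (s.var .t) (s.var .k) ∧ s'.var .tc = tc (s.var .t) (s.var .k) ∧
    s'.var .k = k' (s.var .t) (s.var .k)

/-- This isolates what a problem has to supply: parameters computable in constant time and a
reformulation through clubs. The bound k ≤ k' keeps the exponent below n - k, and tc ≤ k' ensures
enough sources at every node. -/
theorem solvableInTime_of_prepares {setup : Cmd} {w θ tc k' : ℕ → ℕ → ℕ}
    {Q : ∀ n : ℕ, SimpleGraph (Fin n) → ℕ → ℕ → Prop} {T : ℕ → ℕ → ℕ → ℕ → ℕ}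
    (hsetup : Prepares setup w θ tc k') (hw : ∀ t k, w t k ≤ t + 1) (htc : ∀ t k, tc t k ≤ t)
    (htck : ∀ t k, tc t k ≤ k' t k) (hθ : ∀ t k, θ t k = 0 → tc t k = 0)
    (hk : ∀ t k, k ≤ k' t k)
    (hQ : ∀ n (G : SimpleGraph (Fin n)) t k, Q n G t k ↔ ∃ S ⊆ Finset.range n, k' t k ≤ S.card ∧
      IsClub (G.map Fin.valEmbedding) (w t k) (θ t k) (tc t k) S)
    (hT : ∀ n m t k, 2 ^ (n - k) * (max (tc t k) 1 ^ 2 * (n * m)) + 1 ≤ T n m t k) :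
    SolvableInTime Q T := by
  -- The first instruction stores 2m, the length of the input, as the base address. The factor 2010
  -- is 2000 for the search plus 10 for the setup.
  refine ⟨.seq (.arith .add baseReg 1 1) (setup ;; core).compile,
    (setup ;; core).size * 2010 + 1, 7, fun n G t k E hE => ?_⟩
  rw [hE.ncard_edgeSet]
  set m := E.length with hm
  set N := n + m + t + k + 2 with hN
  -- With B = 2N, compilation needs words up to 16B + 16 + 2m ≤ 42N, and N ≥ 2 gives N^6 ≥ 64.
  have hW : 42 * N ≤ N ^ 7 := by
    have h6 : 2 ^ 6 ≤ N ^ 6 := Nat.pow_le_pow_left (by omega) 6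
    rw [pow_succ]
    exact Nat.mul_le_mul_right _ (by omega)
  have hwt := hw t k
  have htct := htc t k
  set P : Inst := hE.inst t k (w t k) (θ t k) (tc t k) (2 * N) (by omega) with hP
  obtain ⟨τ, s', hev, hτ, hyes, hno⟩ : Runs (2 * m) (2 * N) (setup ;; core) (inputStore n E t k)
      fun τ s' => τ ≤ 2010 * (2 ^ (n - k' t k) * (max (tc t k) 1 ^ 2 * (n * m)) + 1) ∧
        (HasClub P (k' t k) (Finset.range n) → s'.var .n = 1) ∧
        (¬ HasClub P (k' t k) (Finset.range n) → s'.var .n = 0) := by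
    rw [runs_seq]
    refine Runs.mono (hsetup (2 * m) (2 * N) (inputStore n E t k) ?_) ?_
    · change t + 1 ≤ 2 * N
      omega
    · rintro T₁ s₁ - ⟨h1, h2, h3, h4, h5, h6, h7, h8, h9, h10⟩
      have hcore := runs_core (P := P) (s := s₁) (k := k' t k) h2.symm
        (by rw [h2]; rfl) (by rw [h5]; rfl) h4 h7 h8 h9 h10 (fun b i => by rw [h3]; rfl)
        (by rw [h6]; rfl) (htck t k) (hθ t k)
      refine Runs.mono hcore ?_
      rintro T₂ s₂ - ⟨h11, h12⟩
      refine ⟨?_, h12⟩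
      rw [h5] at h11
      change T₂ ≤ 2000 * (2 ^ (n - k' t k) * (max (tc t k) 1 ^ 2 * (n * m)) + 1) at h11
      omega
  obtain ⟨τ', r', hex, hτ', hr'⟩ := Cmd.exec_compile (W := N ^ 7) (by omega) hev
    (repr_inputStore n E t k (by omega))
  refine ⟨1 + τ', r', .seq ?_ hex, ?_, ?_⟩
  · have h := Exec.arith (W := N ^ 7) (inputState n E t k) .add baseReg 1 1
      (by simp [ArithOp.eval, inputState]; omega)
    have h2 : ArithOp.add.eval ((inputState n E t k).reg 1) ((inputState n E t k).reg 1) =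
        2 * E.length := by
      simp [ArithOp.eval, inputState]
      omega
    rwa [h2] at h
  · have h1 : 2 ^ (n - k' t k) * (max (tc t k) 1 ^ 2 * (n * m)) + 1 ≤ T n m t k := by
      refine le_trans ?_ (hT n m t k)
      have := hk t k
      gcongr
      · norm_num
    have h2 : 1 ≤ T n m t k := le_trans (by omega) h1
    calc 1 + τ' ≤ T n m t k + (setup ;; core).size * (2010 * T n m t k) := by
          refine Nat.add_le_add h2 (hτ'.trans (Nat.mul_le_mul_left _ (hτ.trans ?_)))
          exact Nat.mul_le_mul_left _ h1
      _ = _ := by ring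
  · rw [hQ]
    rw [← hr'.var .n] at hyes hno
    exact ⟨hyes, hno⟩

/-! ### Clubs of a graph on `Fin n` -/

section Transfer

variable {n : ℕ} {G : SimpleGraph (Fin n)}

theorem map_valEmbedding_adj {a b : Fin n} :
    (G.map Fin.valEmbedding).Adj (a : ℕ) (b : ℕ) ↔ G.Adj a b :=
  SimpleGraph.map_adj_apply (f := Fin.valEmbedding)

theorem val_mem_map_iff {a : Fin n} {S : Finset (Fin n)} :
    (a : ℕ) ∈ S.map Fin.valEmbedding ↔ a ∈ S :=
  Finset.mem_map' Fin.valEmbedding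

open Classical in
theorem commonCount_map (S : Finset (Fin n)) (u v : Fin n) :
    commonCount (G.map Fin.valEmbedding) (S.map Fin.valEmbedding) u v =
      (S.filter fun x => G.Adj u x ∧ G.Adj x v).card := by
  rw [commonCount, ← Finset.card_map Fin.valEmbedding]
  congr 1
  ext x
  simp only [Finset.mem_filter, Finset.mem_map, Fin.valEmbedding_apply]
  constructor
  · rintro ⟨⟨a, ha, rfl⟩, h⟩
    exact ⟨a, ⟨ha, map_valEmbedding_adj.1 h.1, map_valEmbedding_adj.1 h.2⟩, rfl⟩
  · rintro ⟨a, ⟨ha, h⟩, rfl⟩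
    exact ⟨⟨a, ha, rfl⟩, map_valEmbedding_adj.2 h.1, map_valEmbedding_adj.2 h.2⟩

theorem not_separated_zero {H : SimpleGraph ℕ} {S : Finset ℕ} {u v : ℕ} :
    ¬ Separated H S 0 u v := by
  rintro ⟨U, A, h, -⟩
  exact absurd h (Nat.not_lt_zero _)

/-- The separator may be cut down to S because only edges between vertices of S matter. -/
theorem separated_map_iff {S : Finset (Fin n)} {c : ℕ} {u v : Fin n} :
    Separated (G.map Fin.valEmbedding) (S.map Fin.valEmbedding) c u v ↔
      ∃ U A : Finset (Fin n), U.card < c ∧ U ⊆ S ∧ A ⊆ S ∧ Disjoint A U ∧ u ∈ A ∧ v ∉ A ∧ v ∉ U ∧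
        ∀ a ∈ A, ∀ b ∈ S, G.Adj a b → b ∈ A ∨ b ∈ U := by
  constructor
  · rintro ⟨U, A, h1, h2, h3, h4, h5, h6, h7⟩
    have hu : u ∈ S := val_mem_map_iff.1 (h2 h4)
    refine ⟨S.filter fun x => (x : ℕ) ∈ U, S.filter fun x => (x : ℕ) ∈ A, ?_,
      Finset.filter_subset _ _, Finset.filter_subset _ _, ?_, by simp [hu, h4], by simp [h5],
      by simp [h6], ?_⟩
    · refine lt_of_le_of_lt ?_ h1
      refine Finset.card_le_card_of_injOn (fun x => (x : ℕ)) (fun x hx => ?_)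
        (Fin.val_injective.injOn)
      simpa using (Finset.mem_filter.1 hx).2
    · rw [Finset.disjoint_left]
      intro x hx hx'
      exact Finset.disjoint_left.1 h3 (Finset.mem_filter.1 hx).2 (Finset.mem_filter.1 hx').2
    · intro a ha b hb hab
      have := h7 a (Finset.mem_filter.1 ha).2 b (val_mem_map_iff.2 hb) (map_valEmbedding_adj.2 hab)
      simpa [hb] using this
  · rintro ⟨U, A, h1, -, h2, h3, h4, h5, h6, h7⟩
    refine ⟨U.map Fin.valEmbedding, A.map Fin.valEmbedding, by simpa using h1, by simpa using h2,
      by simpa using h3, val_mem_map_iff.2 h4, mt val_mem_map_iff.1 h5, mt val_mem_map_iff.1 h6, ?_⟩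
    intro x hx y hy hxy
    obtain ⟨a, ha, rfl⟩ := Finset.mem_map.1 hx
    obtain ⟨b, hb, rfl⟩ := Finset.mem_map.1 hy
    exact (h7 a ha b hb (map_valEmbedding_adj.1 hxy)).imp val_mem_map_iff.2 val_mem_map_iff.2

open Classical in
theorem isClub_map_iff {S : Finset (Fin n)} {w θ c : ℕ} :
    IsClub (G.map Fin.valEmbedding) w θ c (S.map Fin.valEmbedding) ↔
      ∀ u ∈ S, ∀ v ∈ S, u ≠ v →
        θ ≤ (S.filter fun x => G.Adj u x ∧ G.Adj x v).card + w * (if G.Adj u v then 1 else 0) ∧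
        ¬ Separated (G.map Fin.valEmbedding) (S.map Fin.valEmbedding) c u v := by
  have key : ∀ u v : Fin n,
      ¬ BadPair (G.map Fin.valEmbedding) w θ c (S.map Fin.valEmbedding) u v ↔
        θ ≤ (S.filter fun x => G.Adj u x ∧ G.Adj x v).card + w * (if G.Adj u v then 1 else 0) ∧
        ¬ Separated (G.map Fin.valEmbedding) (S.map Fin.valEmbedding) c u v := by
    intro u v
    rw [BadPair, not_or, not_lt, commonCount_map]
    simp only [map_valEmbedding_adj]
  simp only [← key, IsClub]
  constructor
  · intro h u hu v hv huv
    exact h u (val_mem_map_iff.2 hu) v (val_mem_map_iff.2 hv) (fun e => huv (Fin.ext e))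
  · intro h x hx y hy hxy
    obtain ⟨u, hu, rfl⟩ := Finset.mem_map.1 hx
    obtain ⟨v, hv, rfl⟩ := Finset.mem_map.1 hy
    exact h u hu v hv (fun e => hxy (by rw [e]))

theorem exists_isClub_iff {w θ c k : ℕ} :
    (∃ S ⊆ Finset.range n, k ≤ S.card ∧ IsClub (G.map Fin.valEmbedding) w θ c S) ↔
      ∃ S : Finset (Fin n), k ≤ S.card ∧
        IsClub (G.map Fin.valEmbedding) w θ c (S.map Fin.valEmbedding) := by
  constructor
  · rintro ⟨S, hS, hk, h⟩
    have : (Finset.univ.filter fun x : Fin n => (x : ℕ) ∈ S).map Fin.valEmbedding = S := by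
      ext x
      simp only [Finset.mem_map, Finset.mem_filter, Finset.mem_univ, true_and,
        Fin.valEmbedding_apply]
      exact ⟨fun ⟨a, ha, hax⟩ => hax ▸ ha, fun hx => ⟨⟨x, by simpa using hS hx⟩, hx, rfl⟩⟩
    exact ⟨_, by rw [← Finset.card_map Fin.valEmbedding, this]; exact hk, by rwa [this]⟩
  · rintro ⟨S, hk, h⟩
    refine ⟨_, fun x hx => ?_, by simpa using hk, h⟩
    obtain ⟨a, -, rfl⟩ := Finset.mem_map.1 hx
    simp

end Transfer

/-! ### The three models in terms of common neighbours and separators -/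

section Models

variable {V : Type*} {G : SimpleGraph V}

theorem walk_length_le_two {u v : V} (huv : u ≠ v) (p : G.Walk u v) (hp : p.length ≤ 2) :
    (∃ h : G.Adj u v, p = .cons h .nil) ∨
      ∃ (x : V) (h : G.Adj u x) (h' : G.Adj x v), p = .cons h (.cons h' .nil) := by
  cases p with
  | nil => exact absurd rfl huv
  | cons h q =>
    cases q with
    | nil => exact .inl ⟨h, rfl⟩
    | cons h' q =>
      cases q with
      | nil => exact .inr ⟨_, h, h', rfl⟩
      | cons h'' q => simp at hp

theorem isTwoClub_iff {X : Set V} :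
    IsTwoClub G X ↔ ∀ u ∈ X, ∀ v ∈ X, u ≠ v → ¬ G.Adj u v →
      ∃ x ∈ X, G.Adj u x ∧ G.Adj x v := by
  constructor
  · intro h u hu v hv huv hadj
    have h2 := h ⟨u, hu⟩ ⟨v, hv⟩
    obtain ⟨p, hp⟩ := SimpleGraph.exists_walk_of_edist_ne_top
      (ne_top_of_le_ne_top (by simp : (2 : ℕ∞) ≠ ⊤) h2)
    rw [← hp] at h2
    rcases walk_length_le_two (by simpa using huv) p (by exact_mod_cast h2) with
      ⟨h, -⟩ | ⟨x, h, h', -⟩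
    · exact absurd (by simpa using h) hadj
    · exact ⟨x, x.2, by simpa using h, by simpa using h'⟩
  · rintro h ⟨u, hu⟩ ⟨v, hv⟩
    by_cases huv : u = v
    · subst huv
      simp
    by_cases hadj : G.Adj u v
    · have hadj' : (G.induce X).Adj ⟨u, hu⟩ ⟨v, hv⟩ := by simpa using hadj
      refine (SimpleGraph.edist_le (.cons hadj' .nil)).trans ?_
      simp
    · obtain ⟨x, hx, h1, h2⟩ := h u hu v hv huv hadj
      have h1' : (G.induce X).Adj ⟨u, hu⟩ ⟨x, hx⟩ := by simpa using h1
      have h2' : (G.induce X).Adj ⟨x, hx⟩ ⟨v, hv⟩ := by simpa using h2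
      refine (SimpleGraph.edist_le (.cons h1' (.cons h2' .nil))).trans ?_
      simp

-- At most t common neighbours of a nonadjacent pair could all be deleted, destroying the 2-club;
-- conversely, t deletions cannot remove t + 1 of them. Adjacent pairs cannot be harmed, so an edge
-- gets the full weight t + 1.
open Classical in
theorem isHereditaryTwoClub_iff {t : ℕ} {S : Finset V} :
    IsHereditaryTwoClub G t S ↔ ∀ u ∈ S, ∀ v ∈ S, u ≠ v →
      t + 1 ≤ (S.filter fun x => G.Adj u x ∧ G.Adj x v).card +
        (t + 1) * (if G.Adj u v then 1 else 0) := by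
  constructor
  · intro h u hu v hv huv
    by_cases hadj : G.Adj u v
    · simp [hadj]
    by_contra! hlt
    simp only [hadj, if_false, mul_zero, add_zero] at hlt
    -- Neither vertex is a common neighbour of the pair, so both survive and the deleted set is a
    -- proper subset.
    have hu' : u ∉ S.filter fun x => G.Adj u x ∧ G.Adj x v := by simp
    have hv' : v ∉ S.filter fun x => G.Adj u x ∧ G.Adj x v := by simp
    have h2 := isTwoClub_iff.1 (h _ (Finset.ssubset_iff_of_subset (Finset.filter_subset _ _) |>.2
      ⟨u, hu, hu'⟩) (by omega)) u ⟨hu, hu'⟩ v ⟨hv, hv'⟩ huv hadj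
    obtain ⟨x, ⟨hx, hx'⟩, h3, h4⟩ := h2
    exact hx' (by simpa [h3, h4] using hx)
  · intro h U hU hUt
    refine isTwoClub_iff.2 fun u hu v hv huv hadj => ?_
    have := h u hu.1 v hv.1 huv
    simp only [hadj, if_false, mul_zero, add_zero] at this
    obtain ⟨x, hx, hxU⟩ := Finset.exists_mem_notMem_of_card_lt_card (lt_of_le_of_lt hUt this)
    rw [Finset.mem_filter] at hx
    exact ⟨x, ⟨hx.1, hxU⟩, hx.2⟩

open Classical in
/-- The second vertices of the paths of length at most two from `u` to `v`. -/
noncomputable def secondVertices (G : SimpleGraph V) (S : Finset V) (u v : V) : Finset V :=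
  (S.filter fun x => G.Adj u x ∧ G.Adj x v) ∪ if G.Adj u v then {v} else ∅

open Classical in
theorem card_secondVertices (S : Finset V) (u v : V) : (secondVertices G S u v).card =
    (S.filter fun x => G.Adj u x ∧ G.Adj x v).card + if G.Adj u v then 1 else 0 := by
  rw [secondVertices, Finset.card_union_of_disjoint]
  · split_ifs <;> simp
  · split_ifs <;> simp

theorem mem_secondVertices {S : Finset V} {u v x : V} : x ∈ secondVertices G S u v ↔
    (x ∈ S ∧ G.Adj u x ∧ G.Adj x v) ∨ (G.Adj u v ∧ x = v) := by
  classical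
  rw [secondVertices]
  split_ifs with h <;> simp [h, or_comm]

theorem exists_path_of_mem_secondVertices {S : Finset V} {u v : (S : Set V)} (huv : u ≠ v) {x : V}
    (hx : x ∈ secondVertices G S u v) : ∃ p : (G.induce (S : Set V)).Path u v,
      (p : (G.induce (S : Set V)).Walk u v).length ≤ 2 ∧
      (∀ w ∈ (p : (G.induce (S : Set V)).Walk u v).support, w = u ∨ w = v ∨ (w : V) = x) ∧
      ∃ w ∈ (p : (G.induce (S : Set V)).Walk u v).support, (w : V) = x := by
  rcases mem_secondVertices.1 hx with ⟨hxS, h1, h2⟩ | ⟨h1, rfl⟩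
  · have h1' : (G.induce (S : Set V)).Adj u ⟨x, hxS⟩ := by simpa using h1
    have h2' : (G.induce (S : Set V)).Adj ⟨x, hxS⟩ v := by simpa using h2
    refine ⟨⟨.cons h1' (.cons h2' .nil), ?_⟩, by simp, ?_, ?_⟩
    · simp [SimpleGraph.Walk.isPath_def, h1'.ne, h2'.ne, huv]
    · intro w hw
      simp at hw
      rcases hw with rfl | rfl | rfl <;> simp
    · exact ⟨⟨x, hxS⟩, by simp, rfl⟩
  · have h1' : (G.induce (S : Set V)).Adj u v := by simpa using h1
    refine ⟨⟨.cons h1' .nil, ?_⟩, by simp, ?_, ?_⟩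
    · simp [SimpleGraph.Walk.isPath_def, huv]
    · intro w hw
      simp at hw
      rcases hw with rfl | rfl <;> simp
    · exact ⟨v, by simp, rfl⟩

/-- A path of length at most two is determined by its second vertex; the last clause covers the
direct edge, the only path whose second vertex is an endpoint. -/
theorem exists_mem_secondVertices {S : Finset V} {u v : (S : Set V)} (huv : u ≠ v)
    (p : (G.induce (S : Set V)).Path u v)
    (hp : (p : (G.induce (S : Set V)).Walk u v).length ≤ 2) :
    ∃ x : (S : Set V), (x : V) ∈ secondVertices G S u v ∧ x ≠ u ∧
      x ∈ (p : (G.induce (S : Set V)).Walk u v).support ∧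
      (x = v → ∃ h, (p : (G.induce (S : Set V)).Walk u v) = .cons h .nil) := by
  obtain ⟨p, hpath⟩ := p
  rcases walk_length_le_two huv p hp with ⟨h, rfl⟩ | ⟨x, h, h', rfl⟩
  · exact ⟨v, mem_secondVertices.2 (.inr ⟨by simpa using h, rfl⟩), huv.symm, by simp,
      fun _ => ⟨h, rfl⟩⟩
  · exact ⟨x, mem_secondVertices.2 (.inl ⟨x.2, by simpa using h, by simpa using h'⟩), h.ne', by simp,
      fun e => absurd e h'.ne⟩

-- Disjoint paths of length at most two have distinct second vertices, and distinct second vertices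
-- give disjoint paths. So the maximal number of such paths is the number of common neighbours, plus
-- one for an edge.
open Classical in
theorem isRobustTwoClub_iff {t : ℕ} {S : Finset V} :
    IsRobustTwoClub G t S ↔ ∀ u ∈ S, ∀ v ∈ S, u ≠ v →
      t ≤ (S.filter fun x => G.Adj u x ∧ G.Adj x v).card + 1 * (if G.Adj u v then 1 else 0) := by
  simp only [one_mul, ← card_secondVertices]
  constructor
  · intro h u hu v hv huv
    have huv' : (⟨u, hu⟩ : (S : Set V)) ≠ ⟨v, hv⟩ := by simpa using huv
    obtain ⟨P, hinj, hlen, hdisj⟩ := h ⟨u, hu⟩ ⟨v, hv⟩ huv'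
    choose f hf hfu hfs hfv using fun i => exists_mem_secondVertices huv' (P i) (hlen i)
    have hfinj : Function.Injective f := by
      intro i j hij
      by_contra hne
      -- A common second vertex lies on both paths, so it is an endpoint. It is not u, and if it is
      -- v then both paths are the direct edge, against injectivity.
      rcases hdisj i j hne (f i) (hfs i) (hij ▸ hfs j) with h1 | h1
      · exact hfu i h1
      · obtain ⟨_, h2⟩ := hfv i h1
        obtain ⟨_, h3⟩ := hfv j (hij ▸ h1)
        exact hne (hinj (Subtype.ext (h2.trans h3.symm)))
    simpa using Finset.card_le_card_of_injOn (s := (Finset.univ : Finset (Fin t)))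
      (fun i => (f i : V)) (fun i _ => hf i) (Subtype.val_injective.comp hfinj).injOn
  · rintro h u v huv
    have hcard := h u u.2 v v.2 (fun e => huv (Subtype.ext e))
    obtain ⟨f⟩ : Nonempty (Fin t ↪ secondVertices G S (u : V) v) :=
      Function.Embedding.nonempty_of_card_le (by simpa using hcard)
    choose p hp1 hp2 hp3 using fun i => exists_path_of_mem_secondVertices huv (f i).2
    have hne : ∀ i, ((f i : V)) ≠ u := fun i => by
      rcases mem_secondVertices.1 (f i).2 with ⟨-, h1, -⟩ | ⟨h1, h2⟩
      · exact h1.ne'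
      · rw [h2]
        exact h1.ne'
    -- Equal paths have equal second vertices, up to the case where the second vertex of one of them
    -- is v.
    have hcase : ∀ i j, p i = p j → (f i : V) = v ∨ f i = f j := by
      intro i j hij
      obtain ⟨w, hw, hwi⟩ := hp3 i
      rw [hij] at hw
      rcases hp2 j w hw with rfl | rfl | h1
      · exact absurd hwi.symm (hne i)
      · exact .inl hwi.symm
      · exact .inr (Subtype.ext (hwi.symm.trans h1))
    refine ⟨p, fun i j hij => ?_, hp1, fun i j hij w hwi hwj => ?_⟩
    · rcases hcase i j hij with h1 | h1
      · rcases hcase j i hij.symm with h2 | h2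
        · exact f.injective (Subtype.ext (h1.trans h2.symm))
        · exact (f.injective h2).symm
      · exact f.injective h1
    · rcases hp2 i w hwi with h1 | h1 | h1
      · exact .inl h1
      · exact .inr h1
      rcases hp2 j w hwj with h2 | h2 | h2
      · exact .inl h2
      · exact .inr h2
      exact absurd (f.injective (Subtype.ext (h1.symm.trans h2))) hij

theorem mem_of_reachable {X : Set V} {A : Set V} {u v : X}
    (hA : ∀ a ∈ A, ∀ b ∈ X, G.Adj a b → b ∈ A) (h : (G.induce X).Reachable u v)
    (hu : (u : V) ∈ A) : (v : V) ∈ A := by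
  obtain ⟨p⟩ := h
  induction p with
  | nil => exact hu
  | @cons a b c hab q ih => exact ih (hA a hu b b.2 (by simpa using hab))

-- With w = θ = 1 the count says that the pair is adjacent or has a common neighbour, which is the
-- 2-club condition. Connectivity after deleting U fails exactly when U separates some pair.
open Classical in
theorem isConnectedTwoClub_iff {n : ℕ} {G : SimpleGraph (Fin n)} {t : ℕ} {S : Finset (Fin n)} :
    IsConnectedTwoClub G t S ↔ t + 1 ≤ S.card ∧
      IsClub (G.map Fin.valEmbedding) 1 1 t (S.map Fin.valEmbedding) := by
  rw [isClub_map_iff, IsConnectedTwoClub, isTwoClub_iff, and_left_comm]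
  refine and_congr_right fun hcard => ?_
  constructor
  · rintro ⟨h1, h2⟩ u hu v hv huv
    refine ⟨?_, ?_⟩
    · by_cases hadj : G.Adj u v
      · simp [hadj]
      · obtain ⟨x, hx, h⟩ := h1 u hu v hv huv hadj
        have : 0 < (S.filter fun x => G.Adj u x ∧ G.Adj x v).card :=
          Finset.card_pos.2 ⟨x, Finset.mem_filter.2 ⟨hx, h⟩⟩
        omega
    · rw [separated_map_iff]
      rintro ⟨U, A, h3, h4, h5, h6, h7, h8, h9, h10⟩
      refine h8 (mem_of_reachable (X := (S : Set (Fin n)) \ U) (A := (A : Set (Fin n)))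
        (u := ⟨u, hu, Finset.disjoint_left.1 h6 h7⟩) (v := ⟨v, hv, h9⟩) ?_
        ((h2 U h4 h3).preconnected _ _) h7)
      exact fun a ha b hb hab => (h10 a ha b hb.1 hab).resolve_right hb.2
  · intro h
    refine ⟨fun u hu v hv huv hadj => ?_, fun U hUS hUt => ?_⟩
    · have h1 := (h u hu v hv huv).1
      simp only [hadj, if_false, mul_zero, add_zero] at h1
      obtain ⟨x, hx⟩ := Finset.card_pos.1 h1
      exact ⟨x, (Finset.mem_filter.1 hx).1, (Finset.mem_filter.1 hx).2⟩
    -- Connectedness includes nonemptiness, which follows from |U| < t < |S|.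
    · obtain ⟨x, hx, hxU⟩ := Finset.exists_mem_notMem_of_card_lt_card (hUt.trans hcard)
      have : Nonempty ((S : Set (Fin n)) \ (U : Set (Fin n)) : Set (Fin n)) := ⟨x, hx, hxU⟩
      refine ⟨fun u v => ?_⟩
      by_contra hnot
      have huv : (u : Fin n) ≠ v := fun e => hnot (Subtype.ext e ▸ .refl u)
      -- The side of u is its component in G[S \ U].
      refine (h u u.2.1 v v.2.1 huv).2 (separated_map_iff.2 ⟨U, S.filter fun x =>
        ∃ hx : x ∈ (S : Set (Fin n)) \ U, (G.induce _).Reachable u ⟨x, hx⟩, hUt, hUS,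
        Finset.filter_subset _ _, ?_, ?_, ?_, v.2.2, ?_⟩)
      · rw [Finset.disjoint_left]
        intro y hy
        obtain ⟨hy, -⟩ := (Finset.mem_filter.1 hy).2
        exact hy.2
      · exact Finset.mem_filter.2 ⟨u.2.1, u.2, .refl u⟩
      · intro hv
        obtain ⟨_, hv⟩ := (Finset.mem_filter.1 hv).2
        exact hnot hv
      · intro a ha b hb hab
        obtain ⟨ha, hr⟩ := (Finset.mem_filter.1 ha).2
        by_cases hbU : b ∈ U
        · exact .inr hbU
        · refine .inl (Finset.mem_filter.2 ⟨hb, ⟨hb, hbU⟩, hr.trans ?_⟩)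
          exact SimpleGraph.Adj.reachable (by simpa using hab)

end Models

/-! ### The three problems -/

theorem prepares_hereditary :
    Prepares (.w ::= Var.t + 1 ;; .th ::= Var.t + 1 ;; .tc ::= 0)
      (fun t _ => t + 1) (fun t _ => t + 1) (fun _ _ => 0) (fun _ k => k) := by
  intro M B s hB
  simp
  omega

theorem prepares_robust :
    Prepares (.w ::= 1 ;; .th ::= Var.t ;; .tc ::= 0)
      (fun _ _ => 1) (fun t _ => t) (fun _ _ => 0) (fun _ k => k) := by
  intro M B s hB
  simp
  omega

/-- Raising k to at least t + 1 encodes the condition |S| > t, and it keeps every set of the search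
large enough to contain t sources. -/
theorem prepares_connected :
    Prepares (.w ::= 1 ;; .th ::= 1 ;; .tc ::= Var.t ;;
        .ite Var.k (Var.t + 1) (.k ::= Var.t + 1) .skip)
      (fun _ _ => 1) (fun _ _ => 1) (fun t _ => t) (fun t k => max k (t + 1)) := by
  intro M B s hB
  simp
  omega

theorem solvableInTime_hereditary :
    SolvableInTime (fun _ G t k => HereditaryTwoClubProblem G t k)
      (fun n m _ k => 2 ^ (n - k) * (n * m) + 1) := by
  refine solvableInTime_of_prepares prepares_hereditary (fun _ _ => le_rfl) (fun _ _ => Nat.zero_le _)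
    (fun _ _ => Nat.zero_le _) (fun _ _ _ => rfl) (fun _ _ => le_rfl) (fun n G t k => ?_)
    (fun _ _ _ _ => by simp)
  rw [exists_isClub_iff, HereditaryTwoClubProblem]
  simp only [isClub_map_iff, isHereditaryTwoClub_iff, not_separated_zero, not_false_eq_true, and_true]

theorem solvableInTime_robust :
    SolvableInTime (fun _ G t k => RobustTwoClubProblem G t k)
      (fun n m _ k => 2 ^ (n - k) * (n * m) + 1) := by
  refine solvableInTime_of_prepares prepares_robust (fun _ _ => by omega) (fun _ _ => Nat.zero_le _)
    (fun _ _ => Nat.zero_le _) (fun _ _ _ => rfl) (fun _ _ => le_rfl) (fun n G t k => ?_)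
    (fun _ _ _ _ => by simp)
  rw [exists_isClub_iff, RobustTwoClubProblem]
  simp only [isClub_map_iff, isRobustTwoClub_iff, not_separated_zero, not_false_eq_true, and_true]

theorem solvableInTime_connected :
    SolvableInTime (fun _ G t k => ConnectedTwoClubProblem G t k)
      (fun n m t k => 2 ^ (n - k) * ((max t 1) ^ 2 * (n * m)) + 1) := by
  refine solvableInTime_of_prepares prepares_connected (fun _ _ => by omega) (fun _ _ => le_rfl)
    (fun _ _ => by omega) (fun _ _ h => absurd h one_ne_zero) (fun _ _ => le_max_left _ _)
    (fun n G t k => ?_) (fun _ _ _ _ => le_rfl)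
  rw [exists_isClub_iff, ConnectedTwoClubProblem]
  simp only [isConnectedTwoClub_iff, max_le_iff, and_assoc]

end WellConnectedClub

theorem mainTheorem3 :
    WellConnectedClub.SolvableInTime
      (fun _ G t k => WellConnectedClub.HereditaryTwoClubProblem G t k)
      (fun n m _ k => 2 ^ (n - k) * (n * m) + 1) ∧
    WellConnectedClub.SolvableInTime
      (fun _ G t k => WellConnectedClub.RobustTwoClubProblem G t k)
      (fun n m _ k => 2 ^ (n - k) * (n * m) + 1) ∧
    WellConnectedClub.SolvableInTime
      (fun _ G t k => WellConnectedClub.ConnectedTwoClubProblem G t k)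
      (fun n m t k => 2 ^ (n - k) * ((max t 1) ^ 2 * (n * m)) + 1) := by
  exact ⟨WellConnectedClub.solvableInTime_hereditary, WellConnectedClub.solvableInTime_robust,
    WellConnectedClub.solvableInTime_connected⟩
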